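/- **Model.** There are $n$ processors, each with an input bit, communicating by asynchronous message passing. A configuration consists of the local states and a message buffer. In a step, one processor receives at most one message addressed to it from the buffer, computes, and sends finitely many messages; true sources are known to receivers. A non-adaptive full-information adversary fixes a set $F$ of faulty processors at the start, schedules all steps and deliveries on the basis of the whole history, and lets faulty processors change state and send messages arbitrarily; it cannot predict the fresh random choices of good processors. It is *fair* if in every possible execution each good processor takes infinitely many steps and each message addressed to a good processor is eventually received. A protocol *solves asynchronous Byzantine agreement against up to $t$ faults* if for all inputs and all $F$ with $|F|\le t$: in no execution do two good processors decide differently, or does a good processor decide a bit that is not the input of some good processor; and against every fair adversary all good processors decide with probability $1$. The *running time* of an execution is the maximum length of a chain of messages (each sent by the receiver of the previous one, after receiving it), ending once all good processors have decided. **Fully symmetric round protocols.** In round $k\ge 1$ a processor broadcasts a message by its own instance of a deterministic, message-driven Broadcast primitive, waits until it has validated a set $S$ of $n-t$ messages of round $k$, lets $S'$ be the set of all validated messages of rounds $<k$, possibly decides a bit as a deterministic function of $k$ and $S\cup S'$, and draws its next message from a distribution $N(k,S\cup S')$; here $S\cup S'$ is taken as the multiset of round-stamped messages without their senders. The first message is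 drawn from $N(0,b)$, with $b$ the input bit. Each of these distributions has at most $R$ possible outcomes. Broadcast instances do not influence one another. Broadcast has *arbitrary receiver order*: for every invocation of a message $m$ and every permutation $\pi$ of the processors some finite schedule, all processors following the protocol, has prefixes $\sigma_1,\dots,\sigma_n$ such that after $\sigma_i$ exactly $\pi(1),\dots,\pi(i)$ have accepted $m$. Validate is a deterministic function $V$ mapping a set $W$ of accepted messages with senders to a subset $V(W)\subseteq W$, monotone in $W$, and *good message complete*: if $S_1\subseteq\dots\subseteq S_{k-1}\subseteq V(W)$, where $S_i$ has messages of rounds $\le i$ only and exactly $n-t$ of round $i$, if $m_1$ is a possible outcome of $N(0,b)$ for some bit $b$ and $m_{i+1}$ is a possible outcome of $N(i,S_i)$ for $1\le i<k$, and if $W$ contains $m_1,\dots,m_k$ as the messages of one sender for rounds $1,\dots,k$, then $m_k\in V(W)$. **Theorem.** Let $0<c<\tfrac13$ and let $R\ge 1$ be an integer. There is a constant $\delta'>0$, depending only on $c$ and $R$, such that for all integers $n\ge1$ and $t$ with $t=cn$, and every fully symmetric round protocol (with at most $R$ possibilities for each random choice) that solves asynchronous Byzantine agreement with $n$ processors against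 up to $t$ faults, the following holds. Put $E=\frac{c}{2R}e^{\delta' n}$. There are input bits, a set $F$ of $t$ faulty processors and a fair adversary strategy such that with probability at least $\tfrac12$ the execution lasts for more than $E$ rounds, i.e. at some moment every good processor is in a round numbered higher than $E$, there has been a chain of messages of length at least $E$, and some good processor has not decided. Consequently the expected running time is at least $E/2$, which is exponential in $n$. -/

import Mathlib

noncomputable section

namespace AsyncBA

open scoped Classical

/-! ### The broadcast primitive -/

/-- What can happen to a processor inside one instance of the broadcast primitive: it is the owner
of the instance and invokes it on a message, or it receives a payload from the network (the true
network-level source of the payload is known). -/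
inductive BroadcastInput (n : ℕ) (M Payload : Type) : Type
  | invoke (m : M)
  | receive (src : Fin n) (x : Payload)

/-- A deterministic broadcast protocol for messages in `M` among `n` processors. There is one
instance for every owner `s` and every round number `k`, and the instances do not interact.
`trans s k q` is the program of processor `q` in instance `(s, k)`: it returns the new local state,
possibly a message that `q` now accepts as the outcome of the instance, and a finite list of
payloads to be sent, each with its destination (which may be `q` itself). -/
structure BroadcastProtocol (n : ℕ) (M : Type) where
  State : Type
  Payload : Type
  init : Fin n → ℕ → Fin n → State
  trans : Fin n → ℕ → Fin n → BroadcastInput n M Payload → State →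
    State × Option M × List (Fin n × Payload)

namespace BroadcastProtocol

variable {n : ℕ} {M : Type}

/-- Local state of one processor in one instance, with the message it has accepted, if any. -/
structure Local (B : BroadcastProtocol n M) where
  state : B.State
  accepted : Option M

def initLocal (B : BroadcastProtocol n M) (s : Fin n) (k : ℕ) (q : Fin n) : B.Local :=
  ⟨B.init s k q, none⟩

/-- One local transition. The first acceptance in an instance is final. -/
def react (B : BroadcastProtocol n M) (s : Fin n) (k : ℕ) (q : Fin n)
    (i : BroadcastInput n M B.Payload) (l : B.Local) : B.Local × List (Fin n × B.Payload) :=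
  let r := B.trans s k q i l.state
  (⟨r.1, l.accepted <|> r.2.1⟩, r.2.2)

/-- A payload in transit within a single instance. -/
structure InstPacket (B : BroadcastProtocol n M) where
  src : Fin n
  dst : Fin n
  payload : B.Payload

/-- A configuration of a single instance: all local states and the message buffer. -/
structure InstConfig (B : BroadcastProtocol n M) where
  loc : Fin n → B.Local
  buffer : Multiset B.InstPacket

/-- Processor `q` reacts to the input `i`, and its outgoing payloads enter the buffer. -/
def InstConfig.apply {B : BroadcastProtocol n M} (C : B.InstConfig) (s : Fin n) (k : ℕ) (q : Fin n)
    (i : BroadcastInput n M B.Payload) : B.InstConfig where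
  loc := Function.update C.loc q (B.react s k q i (C.loc q)).1
  buffer := C.buffer + ((B.react s k q i (C.loc q)).2.map fun o => (⟨q, o.1, o.2⟩ : B.InstPacket))

/-- Instance `(s, k)` just after its owner has invoked it on the message `m`. -/
def startConfig (B : BroadcastProtocol n M) (s : Fin n) (k : ℕ) (m : M) : B.InstConfig :=
  InstConfig.apply ⟨B.initLocal s k, 0⟩ s k s (.invoke m)

/-- `B.Schedule s k m σ C`: in instance `(s, k)`, invoked on `m`, the deliveries in the list `σ` can
be applied consecutively, all processors following the protocol, and they lead to `C`. -/
inductive Schedule (B : BroadcastProtocol n M) (s : Fin n) (k : ℕ) (m : M) :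
    List B.InstPacket → B.InstConfig → Prop
  | nil : Schedule B s k m [] (B.startConfig s k m)
  | snoc {σ : List B.InstPacket} {C : B.InstConfig} {x : B.InstPacket} :
      Schedule B s k m σ C → x ∈ C.buffer →
      Schedule B s k m (σ ++ [x])
        (InstConfig.apply ⟨C.loc, C.buffer.erase x⟩ s k x.dst (.receive x.src x.payload))

/-- Arbitrary receiver order: for every order `π` of the processors there is a finite schedule with
prefixes after which exactly the first `1, 2, …, n` processors in that order have accepted. -/
def ArbitraryReceiverOrder (B : BroadcastProtocol n M) : Prop :=
  ∀ (s : Fin n) (k : ℕ) (m : M) (π : Equiv.Perm (Fin n)),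
    ∃ (σ : List B.InstPacket) (C : B.InstConfig), B.Schedule s k m σ C ∧
      ∀ i : Fin n, ∃ (τ : List B.InstPacket) (D : B.InstConfig), τ <+: σ ∧ B.Schedule s k m τ D ∧
        ∀ q : Fin n, (D.loc q).accepted = some m ↔ ∃ j ≤ i, π j = q

end BroadcastProtocol

/-! ### Round protocols -/

/-- A broadcast message with its sender and its round number: `(sender, round, content)`. -/
abbrev Tagged (n : ℕ) (M : Type) : Type := Fin n × ℕ × M

/-- The multiset of round-stamped messages, divorced from the sender identities. -/
def bare {n : ℕ} {M : Type} (S : Finset (Tagged n M)) : Multiset (ℕ × M) :=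
  S.val.map Prod.snd

/-- The members of `S` with round number `k`. -/
def ofRound {n : ℕ} {M : Type} (k : ℕ) (S : Finset (Tagged n M)) : Finset (Tagged n M) :=
  S.filter fun x => x.2.1 = k

/-- The members of `S` with round number less than `k`. -/
def beforeRound {n : ℕ} {M : Type} (k : ℕ) (S : Finset (Tagged n M)) : Finset (Tagged n M) :=
  S.filter fun x => x.2.1 < k

/-- A round protocol for `n` processors with resilience `t`. In round `k ≥ 1` a processor broadcasts
a message, waits until it has validated a set `S` of `n - t` messages of round `k`, lets `S'` be the
set of all validated messages of earlier rounds, possibly decides (deterministically), and draws its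
next message at random; decision and distribution depend only on `k` and on the senderless
multiset of `S ∪ S'`. The first message is drawn from a distribution given by the input bit. -/
structure RoundProtocol (n t : ℕ) where
  /-- contents of broadcast messages -/
  Msg : Type
  bc : BroadcastProtocol n Msg
  /-- the Validate algorithm: the validated ones among the accepted messages -/
  validate : Finset (Tagged n Msg) → Finset (Tagged n Msg)
  validate_subset : ∀ W, validate W ⊆ W
  validate_mono : ∀ W S, W ⊆ S → validate W ⊆ validate S
  /-- Which `n - t` messages of round `k` are used if more than `n - t` of them are validated when
  the processor looks; the rule may depend on the order of acceptance. -/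
  select : ℕ → List (Tagged n Msg) → Finset (Tagged n Msg)
  select_spec : ∀ k L, n - t ≤ (ofRound k (validate L.toFinset)).card →
    select k L ⊆ ofRound k (validate L.toFinset) ∧ (select k L).card = n - t
  /-- distribution of the first message, given the input bit: `N(0, b)` -/
  first : Bool → PMF Msg
  /-- distribution of the next message: `N(k, S ∪ S')` -/
  next : ℕ → Multiset (ℕ × Msg) → PMF Msg
  /-- the bit decided at the end of round `k`, if any -/
  decide : ℕ → Multiset (ℕ × Msg) → Option Bool

namespace RoundProtocol

variable {n t : ℕ}

/-- Good message completeness of the Validate algorithm: if `m 1, …, m k` are possible messages of a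
good processor for rounds `1, …, k`, computed from an increasing sequence of sets
`S 1 ⊆ … ⊆ S (k - 1)` of validated messages, `S i` having rounds `≤ i` and exactly `n - t` members of
round `i`, and if these sets and `m 1, …, m k`, sent by the same `s`, are all among the accepted
messages `W`, then `m k` is validated. -/
def GoodMessageComplete (P : RoundProtocol n t) : Prop :=
  ∀ (k : ℕ) (m : ℕ → P.Msg) (S : ℕ → Finset (Tagged n P.Msg)) (s : Fin n)
    (W : Finset (Tagged n P.Msg)), 1 ≤ k →
    (∃ b, m 1 ∈ (P.first b).support) →
    (∀ i, 1 ≤ i → i < k → S i ⊆ P.validate W ∧ (∀ x ∈ S i, x.2.1 ≤ i) ∧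
      (ofRound i (S i)).card = n - t ∧ m (i + 1) ∈ (P.next i (bare (S i))).support) →
    (∀ i, 1 ≤ i → i + 1 < k → S i ⊆ S (i + 1)) →
    (∀ i, 1 ≤ i → i ≤ k → (s, i, m i) ∈ W) →
    (s, k, m k) ∈ P.validate W

/-- Fully symmetric round protocols with at most `R` possibilities for each random choice. The
invariance under permutations of the sender identities is built into the types of `next` and
`decide`. -/
structure FullySymmetric (P : RoundProtocol n t) (R : ℕ) : Prop where
  receiverOrder : P.bc.ArbitraryReceiverOrder
  complete : P.GoodMessageComplete
  first_support : ∀ b, (P.first b).support.encard ≤ R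
  next_support : ∀ k S, (P.next k S).support.encard ≤ R

/-! ### The asynchronous message-passing system -/

/-- Local state of a processor. `round` is the number of messages it has broadcast, so it is in round
`round` and has completed `round - 1` rounds; `log` lists the accepted messages in the order of
acceptance. -/
structure ProcState (P : RoundProtocol n t) where
  round : ℕ
  inst : Fin n → ℕ → P.bc.Local
  log : List (Tagged n P.Msg)
  decision : Option Bool

/-- A payload of broadcast instance `(owner, round)` in transit. `depth` is bookkeeping of the model,
invisible to the processors: the length of the longest chain of messages that ends with this one. -/
structure Packet (P : RoundProtocol n t) where
  src : Fin n
  dst : Fin n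
  owner : Fin n
  round : ℕ
  payload : P.bc.Payload
  depth : ℕ

/-- A configuration: local states, message buffer and, as bookkeeping, for every processor the length
of the longest chain of messages that ends with a message it has received. -/
structure Config (P : RoundProtocol n t) where
  proc : Fin n → P.ProcState
  buffer : Multiset P.Packet
  depth : Fin n → ℕ

def initConfig (P : RoundProtocol n t) : P.Config where
  proc p := ⟨0, fun s k => P.bc.initLocal s k p, [], none⟩
  buffer := 0
  depth _ := 0

/-- An outgoing payload: destination, owner and round of the instance, payload. -/
abbrev Outgoing (P : RoundProtocol n t) : Type := Fin n × Fin n × ℕ × P.bc.Payload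

/-- Processor `p` takes the new state `σ` and sends the messages `out`. -/
def Config.put {P : RoundProtocol n t} (C : P.Config) (p : Fin n) (σ : P.ProcState)
    (out : List P.Outgoing) : P.Config where
  proc := Function.update C.proc p σ
  buffer := C.buffer +
    (out.map fun o => (⟨p, o.1, o.2.1, o.2.2.1, o.2.2.2, C.depth p + 1⟩ : P.Packet))
  depth := C.depth

/-- The packet `x` leaves the buffer and is received by its destination. -/
def Config.take {P : RoundProtocol n t} (C : P.Config) (x : P.Packet) : P.Config where
  proc := C.proc
  buffer := C.buffer.erase x
  depth := Function.update C.depth x.dst (max (C.depth x.dst) x.depth)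

/-- `p` handles the input `i` in broadcast instance `(s, k)`; a new acceptance is logged. -/
def feed (P : RoundProtocol n t) (p s : Fin n) (k : ℕ) (i : BroadcastInput n P.Msg P.bc.Payload)
    (σ : P.ProcState) : P.ProcState × List P.Outgoing :=
  let r := P.bc.react s k p i (σ.inst s k)
  ({ σ with
      inst := Function.update σ.inst s (Function.update (σ.inst s) k r.1)
      log := σ.log ++
        (match (σ.inst s k).accepted, r.1.accepted with
          | none, some m => [(s, k, m)]
          | _, _ => []) },
    r.2.map fun o => (o.1, s, k, o.2))

/-- The wait of the current round is over (a processor that has not started has nothing to wait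
for). -/
def Ready (P : RoundProtocol n t) (σ : P.ProcState) : Prop :=
  σ.round = 0 ∨ n - t ≤ (ofRound σ.round (P.validate σ.log.toFinset)).card

/-- The set `S ∪ S'` used at the end of the current round. -/
def used (P : RoundProtocol n t) (σ : P.ProcState) : Finset (Tagged n P.Msg) :=
  P.select σ.round σ.log ∪ beforeRound σ.round (P.validate σ.log.toFinset)

/-- The distribution of the next message of a ready processor with input bit `b`. -/
def nextMessage (P : RoundProtocol n t) (b : Bool) (σ : P.ProcState) : PMF P.Msg :=
  if σ.round = 0 then P.first b else P.next σ.round (bare (P.used σ))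

/-- The decision of a ready processor when it leaves the current round; a decision is final. -/
def nextDecision (P : RoundProtocol n t) (σ : P.ProcState) : Option Bool :=
  if σ.round = 0 then σ.decision
  else σ.decision <|> P.decide σ.round (bare (P.used σ))

/-- A ready processor `p` enters its next round and broadcasts `m`. -/
def enterRound (P : RoundProtocol n t) (p : Fin n) (σ : P.ProcState) (m : P.Msg) :
    P.ProcState × List P.Outgoing :=
  P.feed p p (σ.round + 1) (.invoke m)
    { σ with round := σ.round + 1, decision := P.nextDecision σ }

/-- The choices of the adversary. `step p rcv`: the good processor `p` takes a step, receiving the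
packet `rcv` or nothing. `byz p rcv σ out`: the faulty processor `p` takes a step, receiving `rcv` or
nothing, moves to an arbitrary state and sends arbitrary messages (under its own name). -/
inductive Action (P : RoundProtocol n t) : Type
  | step (p : Fin n) (rcv : Option P.Packet)
  | byz (p : Fin n) (rcv : Option P.Packet) (σ : P.ProcState) (out : List P.Outgoing)

/-- Which actions can be applied when `F` is the set of faulty processors. A good processor whose
wait is over enters its next round before it receives anything else. -/
def Legal (P : RoundProtocol n t) (F : Finset (Fin n)) (C : P.Config) : P.Action → Prop
  | .step p rcv => p ∉ F ∧
      ∀ x, rcv = some x → x ∈ C.buffer ∧ x.dst = p ∧ ¬ P.Ready (C.proc p)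
  | .byz p rcv _ _ => p ∈ F ∧ ∀ x, rcv = some x → x ∈ C.buffer ∧ x.dst = p

/-- The distribution of the configuration after a legal action, for input bits `b`. -/
def apply (P : RoundProtocol n t) (b : Fin n → Bool) (C : P.Config) : P.Action → PMF P.Config
  | .step p none =>
      if P.Ready (C.proc p) then
        (P.nextMessage (b p) (C.proc p)).map fun m =>
          C.put p (P.enterRound p (C.proc p) m).1 (P.enterRound p (C.proc p) m).2
      else PMF.pure C
  | .step p (some x) =>
      let r := P.feed p x.owner x.round (.receive x.src x.payload) (C.proc p)
      PMF.pure ((C.take x).put p r.1 r.2)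
  | .byz p none σ out => PMF.pure (C.put p σ out)
  | .byz p (some x) σ out => PMF.pure ((C.take x).put p σ out)

/-- Configurations that occur with nonzero probability in some execution with input bits `b` and
faulty processors `F`. -/
inductive Reachable (P : RoundProtocol n t) (b : Fin n → Bool) (F : Finset (Fin n)) :
    P.Config → Prop
  | init : Reachable P b F P.initConfig
  | step {C C' : P.Config} {a : P.Action} : Reachable P b F C → P.Legal F C a →
      C' ∈ (P.apply b C a).support → Reachable P b F C'

/-- A full-information adversary strategy: the next action as a function of all previous
configurations and the current one. -/
abbrev Adversary (P : RoundProtocol n t) : Type := List P.Config → P.Config → P.Action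

/-- One step of an execution against `A`; illegal actions have no effect. -/
def advStep (P : RoundProtocol n t) (b : Fin n → Bool) (F : Finset (Fin n)) (A : P.Adversary)
    (past : List P.Config) (C : P.Config) : PMF P.Config :=
  if P.Legal F C (A past C) then P.apply b C (A past C) else PMF.pure C

/-- The distribution of the execution prefix with `T` steps: previous configurations (oldest first)
and current configuration. -/
def run (P : RoundProtocol n t) (b : Fin n → Bool) (F : Finset (Fin n)) (A : P.Adversary) :
    ℕ → PMF (List P.Config × P.Config)
  | 0 => PMF.pure ([], P.initConfig)
  | T + 1 => (P.run b F A T).bind fun h =>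
      (P.advStep b F A h.1 h.2).map fun C => (h.1 ++ [h.2], C)

/-- `e` is a possible infinite execution against `A`. -/
def IsExecution (P : RoundProtocol n t) (b : Fin n → Bool) (F : Finset (Fin n)) (A : P.Adversary)
    (e : ℕ → P.Config) : Prop :=
  e 0 = P.initConfig ∧
    ∀ T, e (T + 1) ∈ (P.advStep b F A ((List.range T).map e) (e T)).support

/-- The adversary respects the constraints of the asynchronous model: in every possible execution
every good processor takes infinitely many steps, and every message in the buffer that is addressed to
a good processor is eventually received. -/
def Fair (P : RoundProtocol n t) (b : Fin n → Bool) (F : Finset (Fin n)) (A : P.Adversary) : Prop :=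
  ∀ e, P.IsExecution b F A e →
    (∀ p, p ∉ F → ∀ T, ∃ T' ≥ T, ∃ rcv, A ((List.range T').map e) (e T') = .step p rcv ∧
      P.Legal F (e T') (.step p rcv)) ∧
    (∀ (x : P.Packet) (T : ℕ), x.dst ∉ F → x ∈ (e T).buffer →
      ∃ T' ≥ T, A ((List.range T').map e) (e T') = .step x.dst (some x) ∧
        P.Legal F (e T') (.step x.dst (some x)))

/-- The probability that the execution ever passes through a configuration with the property `Q`. -/
def probEventually (P : RoundProtocol n t) (b : Fin n → Bool) (F : Finset (Fin n))
    (A : P.Adversary) (Q : P.Config → Prop) : ENNReal :=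
  ⨆ T : ℕ, (P.run b F A T).toOuterMeasure {h | ∃ C ∈ h.1 ++ [h.2], Q C}

/-- All good processors have decided. -/
def Config.AllDecided {P : RoundProtocol n t} (C : P.Config) (F : Finset (Fin n)) : Prop :=
  ∀ p, p ∉ F → (C.proc p).decision ≠ none

/-- The length of the longest chain of messages received so far. -/
def Config.chainLength {P : RoundProtocol n t} (C : P.Config) : ℕ :=
  Finset.univ.sup C.depth

/-- The running time of an execution prefix: the maximum length of a chain of messages, ending once
all good processors have decided. -/
def runningTime (P : RoundProtocol n t) (F : Finset (Fin n)) (h : List P.Config × P.Config) : ℕ :=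
  (((h.1 ++ [h.2]).filter fun C => ¬ C.AllDecided F).map Config.chainLength).foldr max 0

/-- The expected running time, as the limit over the execution prefixes (on which it increases). -/
def expectedRunningTime (P : RoundProtocol n t) (b : Fin n → Bool) (F : Finset (Fin n))
    (A : P.Adversary) : ENNReal :=
  ⨆ T : ℕ, ∑' h, P.run b F A T h * (P.runningTime F h : ENNReal)

/-- The protocol solves asynchronous Byzantine agreement against up to `t` faults: in every execution
good processors never decide differently, a decided bit is the input of some good processor, and
against every fair adversary all good processors decide with probability one. -/
structure SolvesByzantineAgreement (P : RoundProtocol n t) : Prop where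
  agreement : ∀ (b : Fin n → Bool) (F : Finset (Fin n)), F.card ≤ t →
    ∀ C, P.Reachable b F C → ∀ p q, p ∉ F → q ∉ F → ∀ v w,
      (C.proc p).decision = some v → (C.proc q).decision = some w → v = w
  validity : ∀ (b : Fin n → Bool) (F : Finset (Fin n)), F.card ≤ t →
    ∀ C, P.Reachable b F C → ∀ p, p ∉ F → ∀ v,
      (C.proc p).decision = some v → ∃ q, q ∉ F ∧ b q = v
  termination : ∀ (b : Fin n → Bool) (F : Finset (Fin n)) (A : P.Adversary), F.card ≤ t →
    P.Fair b F A → P.probEventually b F A (fun C => C.AllDecided F) = 1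

/-- The execution has outlasted `E` rounds: every good processor has gone on to a round numbered
higher than `E`, the chains of messages have reached length `E`, and still some good processor has
not decided. -/
def Config.Outlasts {P : RoundProtocol n t} (C : P.Config) (F : Finset (Fin n)) (E : ℝ) : Prop :=
  (∀ p, p ∉ F → E < ((C.proc p).round : ℝ)) ∧ E ≤ (C.chainLength : ℝ) ∧ ¬ C.AllDecided F

end RoundProtocol

end AsyncBA

end

/-! Validation and decisions see only the multiset of messages, and `c`, `R` are fixed. So the `n`
processors can be divided into boundedly many cells, each of linear size and each containing a
linear number of faulty processors, and the adversary can dictate the multiset of messages that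
every cell sends in every round.

Dictating contents. Let a cell have `d` good and `w - d` faulty members, all drawing from a
distribution `ν` with at most `R` outcomes. The target multiset has size `w` and gives each outcome
`m` room for about `d ν(m) + (w - d)/R` copies (`exists_target`). The slack `(w - d)/R` is linear in
`n`, so by a Chernoff bound (`tail_term_le`) the good members overdraw some outcome only with
exponentially small probability. Otherwise the faulty members, who let the good ones draw first and
in all else imitate the protocol, choose possible outcomes that fill up the target exactly. Good
message completeness then validates their messages, and arbitrary receiver order lets each cell
accept exactly the cells chosen for it. Thus a deterministic `Script` of contents and views is
followed for `L` rounds except with probability `L` times an exponentially small number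
(`Script.forces`).

An undecided script. Every cell `i` lies in a set `D i` of cells of total size exactly `t`, whose
messages can be withheld. A `Play` says what is withheld from whom. If every play led all good
processors to a decision by round `L`, agreement would give each play a value. Two plays that differ
only in one choice (or input) of a cell `h`, after which `D h` is silent for everybody, look the
same to all other cells. Since `2t < n`, some good processor lies outside `h`, and so the values
coincide. A backward induction on rounds (`Play.val_silence`) shows that the value does not depend
on whom one silences. The inputs can then be flipped cell by cell, each cell being silent while it
is flipped, so all-zero and all-one inputs have the same value (`Play.exists_val_eq`), against
validity. Hence some script leaves a good processor undecided at round `L`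
(`exists_forces_undecided`).

Strategies are finite trees. To obtain a fair adversary, a tree is followed by endlessly repeated
finite sweeps that meet all current obligations (`fair_toAdversary`). The expected running time
follows by Markov's inequality. -/

noncomputable section

namespace AsyncBA

open scoped Classical

namespace RoundProtocol

variable {n t : ℕ}

/-! ### Finite strategies -/

/-- A finite strategy of the adversary: halt, or perform an action and continue according to the
resulting configuration. -/
inductive Strategy (P : RoundProtocol n t) : Type
  | halt
  | act (a : P.Action) (next : P.Config → Strategy P)

/-- What an action contributes to fairness: a step of a good processor, a packet received by one. -/
def Action.fulfils {P : RoundProtocol n t} : P.Action → Set (Fin n ⊕ P.Packet)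
  | .step p none => {.inl p}
  | .step p (some x) => {.inl p, .inr x}
  | .byz _ _ _ _ => ∅

namespace Strategy

variable {P : RoundProtocol n t}

/-- All actions of the strategy are legal, and on every path all obligations in `todo` are met. -/
def Meets (b : Fin n → Bool) (F : Finset (Fin n)) :
    P.Strategy → P.Config → Set (Fin n ⊕ P.Packet) → Prop
  | .halt, _, todo => todo = ∅
  | .act a next, C, todo => P.Legal F C a ∧
      ∀ C' ∈ (P.apply b C a).support, Meets b F (next C') C' (todo \ a.fulfils)

/-- The probability that the strategy stops without having passed through `Q`. -/
def failProb (b : Fin n → Bool) (Q : P.Config → Prop) : P.Strategy → P.Config → ENNReal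
  | .halt, C => if Q C then 0 else 1
  | .act a next, C => if Q C then 0 else ∑' C', P.apply b C a C' * failProb b Q (next C') C'

def child : P.Strategy → P.Config → P.Strategy
  | .halt, _ => .halt
  | .act _ next, C => next C

/-- The default `a₀` is a placeholder: if `sw` never returns `.halt`, the strategy in force after a
nonempty history is never `.halt`. -/
def root (a₀ : P.Action) : P.Strategy → P.Action
  | .halt => a₀
  | .act a _ => a

/-- A strategy that has stopped is replaced by a new one. -/
def renew (sw : P.Config → P.Strategy) : P.Strategy → P.Config → P.Strategy
  | .halt, C => sw C
  | .act a next, _ => .act a next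

/-- The strategy in force after a sequence of configurations. -/
def current (sw : P.Config → P.Strategy) (a₀ : P.Action) (s : P.Strategy) (l : List P.Config) :
    P.Strategy :=
  -- The dummy root is consumed by the initial configuration, which leaves `s` itself, renewed if it
  -- is already `.halt`.
  l.foldl (fun s C => renew sw (s.child C) C) (.act a₀ fun _ => s)

/-- The adversary that follows `s` and, whenever a strategy has stopped, continues with the one
provided by `sw`. -/
def toAdversary (sw : P.Config → P.Strategy) (a₀ : P.Action) (s : P.Strategy) : P.Adversary :=
  fun past C => (current sw a₀ s (past ++ [C])).root a₀

theorem current_concat (sw : P.Config → P.Strategy) (a₀ : P.Action) (s : P.Strategy)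
    (l : List P.Config) (C : P.Config) :
    current sw a₀ s (l ++ [C]) = renew sw ((current sw a₀ s l).child C) C := by
  simp [current]

theorem current_singleton (sw : P.Config → P.Strategy) (a₀ : P.Action) (s : P.Strategy)
    (C : P.Config) : current sw a₀ s [C] = renew sw s C := by
  simp [current, child]

theorem Meets.mono {b : Fin n → Bool} {F : Finset (Fin n)} :
    ∀ {s : P.Strategy} {C : P.Config} {todo todo' : Set (Fin n ⊕ P.Packet)},
      Meets b F s C todo → todo' ⊆ todo → Meets b F s C todo' := by
  intro s
  induction s with
  | halt => intro C todo todo' h hs; exact Set.subset_eq_empty hs h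
  | act a next ih =>
    intro C todo todo' h hs
    exact ⟨h.1, fun C' hC' => ih C' (h.2 C' hC') (Set.sdiff_subset_sdiff_left hs)⟩

end Strategy

/-! ### Fairness -/

/-- The obligations of a fair adversary in the configuration `C`. -/
def obligations (P : RoundProtocol n t) (F : Finset (Fin n)) (C : P.Config) :
    Set (Fin n ⊕ P.Packet) :=
  {o | (∃ p, p ∉ F ∧ o = .inl p) ∨ ∃ x ∈ C.buffer, x.dst ∉ F ∧ o = .inr x}

section Fair

variable {P : RoundProtocol n t} {b : Fin n → Bool} {F : Finset (Fin n)}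
  {sw : P.Config → P.Strategy} {a₀ : P.Action} {s : P.Strategy} {e : ℕ → P.Config}

theorem map_range_succ (e : ℕ → P.Config) (T : ℕ) :
    (List.range T).map e ++ [e T] = (List.range (T + 1)).map e := by
  simp [List.range_succ]

theorem IsExecution.succ_mem_support {tr : P.Strategy} {a : P.Action}
    {next : P.Config → P.Strategy} (he : P.IsExecution b F (s.toAdversary sw a₀) e) {T : ℕ}
    (htr : Strategy.current sw a₀ s ((List.range (T + 1)).map e) = tr) (ht : tr = .act a next)
    (ha : P.Legal F (e T) a) :
    s.toAdversary sw a₀ ((List.range T).map e) (e T) = a ∧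
      e (T + 1) ∈ (P.apply b (e T) a).support := by
  have h1 : s.toAdversary sw a₀ ((List.range T).map e) (e T) = a := by
    rw [Strategy.toAdversary, map_range_succ, htr, ht]
    rfl
  refine ⟨h1, ?_⟩
  have := he.2 T
  rwa [advStep, h1, if_pos ha] at this

/-- While a strategy with obligations is in force, each of them is met, and later on a renewal
takes place. -/
theorem IsExecution.meets (he : P.IsExecution b F (s.toAdversary sw a₀) e) :
    ∀ (tr : P.Strategy) (T : ℕ) (todo : Set (Fin n ⊕ P.Packet)), tr ≠ .halt →
      Strategy.current sw a₀ s ((List.range (T + 1)).map e) = tr →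
      tr.Meets b F (e T) todo →
      (∀ o ∈ todo, ∃ T' ≥ T, o ∈ (s.toAdversary sw a₀ ((List.range T').map e) (e T')).fulfils ∧
        P.Legal F (e T') (s.toAdversary sw a₀ ((List.range T').map e) (e T'))) ∧
      (∃ T' > T, Strategy.current sw a₀ s ((List.range (T' + 1)).map e) = sw (e T') ∧
        ∀ T'' ≥ T, T'' < T' →
          P.Legal F (e T'') (s.toAdversary sw a₀ ((List.range T'').map e) (e T''))) := by
  intro tr
  induction tr with
  | halt => intro T todo h; exact absurd rfl h
  | act a next ih =>
    intro T todo _ hcur hm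
    obtain ⟨hA, hmem⟩ := he.succ_mem_support hcur rfl hm.1
    have hch := hm.2 _ hmem
    have hcur' : Strategy.current sw a₀ s ((List.range (T + 1 + 1)).map e) =
        Strategy.renew sw (next (e (T + 1))) (e (T + 1)) := by
      rw [← map_range_succ, Strategy.current_concat, hcur]
      rfl
    have hleg : P.Legal F (e T) (s.toAdversary sw a₀ ((List.range T).map e) (e T)) := by
      rw [hA]; exact hm.1
    cases hn : next (e (T + 1)) with
    | halt =>
      rw [hn] at hch hcur'
      refine ⟨fun o ho => ⟨T, le_rfl, ?_, hleg⟩, T + 1, by omega, hcur', ?_⟩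
      -- A strategy that halts has an empty list of obligations, so whatever was still open has been
      -- met by this last action.
      · by_contra hno
        rw [hA] at hno
        have hmem' : o ∈ todo \ a.fulfils := ⟨ho, hno⟩
        rw [show todo \ a.fulfils = ∅ from hch] at hmem'
        exact hmem'
      · intro T'' h1 h2
        obtain rfl : T'' = T := by omega
        exact hleg
    | act a' next' =>
      have hcur2 : Strategy.current sw a₀ s ((List.range (T + 1 + 1)).map e) =
          next (e (T + 1)) := by rw [hcur', hn]; rfl
      obtain ⟨h1, T', hT', h2, h3⟩ :=
        ih (e (T + 1)) (T + 1) _ (by rw [hn]; simp) hcur2 hch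
      refine ⟨fun o ho => ?_, T', by omega, h2, ?_⟩
      · by_cases hoa : o ∈ a.fulfils
        · exact ⟨T, le_rfl, by rw [hA]; exact hoa, hleg⟩
        · obtain ⟨T₁, hT₁, h4⟩ := h1 o ⟨ho, hoa⟩
          exact ⟨T₁, by omega, h4⟩
      · intro T'' h4 h5
        rcases Nat.eq_or_lt_of_le h4 with rfl | h6
        · exact hleg
        · exact h3 T'' h6 h5

theorem mem_fulfils_inl {P : RoundProtocol n t} {a : P.Action} {p : Fin n}
    (h : Sum.inl p ∈ a.fulfils) : ∃ rcv, a = .step p rcv := by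
  match a, h with
  | .step q none, h => simp [Action.fulfils] at h; exact ⟨none, by rw [h]⟩
  | .step q (some x), h => simp [Action.fulfils] at h; exact ⟨some x, by rw [h]⟩
  | .byz _ _ _ _, h => simp [Action.fulfils] at h

theorem mem_fulfils_inr {P : RoundProtocol n t} {a : P.Action} {x : P.Packet} {C : P.Config}
    (h : Sum.inr x ∈ a.fulfils) (hl : P.Legal F C a) : a = .step x.dst (some x) := by
  match a, h with
  | .step q none, h => simp [Action.fulfils] at h
  | .step q (some y), h =>
    simp [Action.fulfils] at h
    subst h
    rw [(hl.2 x rfl).2.1]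
  | .byz _ _ _ _, h => simp [Action.fulfils] at h

/-- A packet for a good processor stays in the buffer unless it is received. -/
theorem mem_buffer_of_mem_support {C C' : P.Config} {a : P.Action} {x : P.Packet}
    (hx : x ∈ C.buffer) (hF : x.dst ∉ F) (hl : P.Legal F C a)
    (hC' : C' ∈ (P.apply b C a).support) (ha : a ≠ .step x.dst (some x)) : x ∈ C'.buffer := by
  match a with
  | .step p none =>
    rw [apply] at hC'
    split_ifs at hC' with h
    · obtain ⟨m, -, rfl⟩ := (PMF.mem_support_map_iff _ _ _).1 hC'
      exact Multiset.mem_add.2 (.inl hx)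
    · rw [PMF.support_pure, Set.mem_singleton_iff] at hC'
      rwa [hC']
  | .step p (some y) =>
    rw [apply, PMF.support_pure, Set.mem_singleton_iff] at hC'
    subst hC'
    refine Multiset.mem_add.2 (.inl ((Multiset.mem_erase_of_ne ?_).2 hx))
    rintro rfl
    exact ha (by rw [(hl.2 x rfl).2.1])
  | .byz p none _ _ =>
    rw [apply, PMF.support_pure, Set.mem_singleton_iff] at hC'
    subst hC'
    exact Multiset.mem_add.2 (.inl hx)
  | .byz p (some y) _ _ =>
    rw [apply, PMF.support_pure, Set.mem_singleton_iff] at hC'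
    subst hC'
    refine Multiset.mem_add.2 (.inl ((Multiset.mem_erase_of_ne ?_).2 hx))
    rintro rfl
    exact hF ((hl.2 x rfl).2 ▸ hl.1)

/-- Every strategy is a well-founded tree, so renewals recur forever. Each renewal starts a sweep
that meets all obligations present at its beginning. -/
theorem fair_toAdversary (hsw : ∀ C, (sw C).Meets b F C (P.obligations F C))
    (hsw' : ∀ C, sw C ≠ .halt) (hs : s.Meets b F P.initConfig ∅) :
    P.Fair b F (s.toAdversary sw a₀) := by
  intro e he
  -- renewals take place again and again
  have hcur : ∀ T, ∃ todo, Strategy.current sw a₀ s ((List.range (T + 1)).map e) ≠ .halt ∧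
      (Strategy.current sw a₀ s ((List.range (T + 1)).map e)).Meets b F (e T) todo := by
    intro T
    induction T with
    | zero =>
      have h0 : (List.range (0 + 1)).map e = [P.initConfig] := by simp [he.1]
      rw [h0, Strategy.current_singleton, he.1]
      cases s with
      | halt => exact ⟨_, hsw' _, hsw _⟩
      | act a next => exact ⟨∅, by simp [Strategy.renew], hs⟩
    | succ T ih =>
      obtain ⟨todo, h1, h2⟩ := ih
      cases hc : Strategy.current sw a₀ s ((List.range (T + 1)).map e) with
      | halt => exact absurd hc h1
      | act a next =>
        rw [hc] at h2
        obtain ⟨-, hmem⟩ := he.succ_mem_support hc rfl h2.1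
        rw [← map_range_succ, Strategy.current_concat, hc]
        change ∃ todo, Strategy.renew sw (next (e (T + 1))) (e (T + 1)) ≠ _ ∧
          (Strategy.renew sw (next (e (T + 1))) (e (T + 1))).Meets b F _ _
        cases hn : next (e (T + 1)) with
        | halt => exact ⟨_, hsw' _, hsw _⟩
        | act a' next' =>
          have := h2.2 _ hmem
          rw [hn] at this
          exact ⟨_, by simp [Strategy.renew], this⟩
  have hrenew : ∀ T, ∃ T' > T,
      (∀ o ∈ P.obligations F (e T'), ∃ T'' ≥ T',
        o ∈ (s.toAdversary sw a₀ ((List.range T'').map e) (e T'')).fulfils ∧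
        P.Legal F (e T'') (s.toAdversary sw a₀ ((List.range T'').map e) (e T''))) ∧
      ∀ T'' ≥ T, T'' < T' →
        P.Legal F (e T'') (s.toAdversary sw a₀ ((List.range T'').map e) (e T'')) := by
    intro T
    obtain ⟨todo, h1, h2⟩ := hcur T
    obtain ⟨-, T', hT', h3, h4⟩ := he.meets _ T todo h1 rfl h2
    exact ⟨T', hT', (he.meets _ T' _ (hsw' _) h3 (hsw _)).1, h4⟩
  constructor
  · intro p hp T
    obtain ⟨T', hT', h, -⟩ := hrenew T
    obtain ⟨T'', hT'', h1, h2⟩ := h (.inl p) (.inl ⟨p, hp, rfl⟩)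
    obtain ⟨rcv, hr⟩ := mem_fulfils_inl h1
    exact ⟨T'', by omega, rcv, hr, hr ▸ h2⟩
  · intro x T hxF hx
    obtain ⟨T', hT', h, hl⟩ := hrenew T
    by_contra hno
    -- A packet that is never received survives until the next renewal, where it becomes an
    -- obligation of the new sweep.
    have hstay : ∀ d, T + d ≤ T' → x ∈ (e (T + d)).buffer := by
      intro d
      induction d with
      | zero => intro _; exact hx
      | succ d ih =>
        intro hd
        have hleg := hl (T + d) (by omega) (by omega)
        have hmem := he.2 (T + d)
        rw [advStep, if_pos hleg] at hmem
        refine mem_buffer_of_mem_support (ih (by omega)) hxF hleg hmem fun heq => hno ?_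
        exact ⟨T + d, by omega, heq, heq ▸ hleg⟩
    have hx' := hstay (T' - T) (by omega)
    rw [show T + (T' - T) = T' by omega] at hx'
    obtain ⟨T'', hT'', h1, h2⟩ := h (.inr x) (.inr ⟨x, hx', hxF, rfl⟩)
    have heq := mem_fulfils_inr h1 h2
    exact hno ⟨T'', by omega, heq, heq ▸ h2⟩

end Fair

/-! ### Hitting probabilities -/

section Hitting

variable (P : RoundProtocol n t) (b : Fin n → Bool) (F : Finset (Fin n)) (A : P.Adversary)

/-- One step of an execution, with its history. -/
def histStep (h : List P.Config × P.Config) : PMF (List P.Config × P.Config) :=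
  (P.advStep b F A h.1 h.2).map fun C => (h.1 ++ [h.2], C)

/-- `T` further steps after the history `h`. -/
def runFrom (h : List P.Config × P.Config) : ℕ → PMF (List P.Config × P.Config)
  | 0 => PMF.pure h
  | T + 1 => (runFrom h T).bind (P.histStep b F A)

theorem run_eq_runFrom (T : ℕ) : P.run b F A T = P.runFrom b F A ([], P.initConfig) T := by
  induction T with
  | zero => rfl
  | succ T ih => rw [run, runFrom, ih]; rfl

theorem runFrom_succ_eq (h : List P.Config × P.Config) (T : ℕ) :
    P.runFrom b F A h (T + 1) = (P.histStep b F A h).bind fun h' => P.runFrom b F A h' T := by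
  induction T with
  | zero => simp [runFrom]
  | succ T ih => rw [runFrom, ih, PMF.bind_bind]; rfl

/-- The histories that have passed through `Q`. -/
def hitSet (Q : P.Config → Prop) : Set (List P.Config × P.Config) := {h | ∃ C ∈ h.1 ++ [h.2], Q C}

variable {P b F A}

theorem toOuterMeasure_eq_one {α : Type*} {p : PMF α} {s : Set α} (h : p.support ⊆ s) :
    p.toOuterMeasure s = 1 :=
  (PMF.toOuterMeasure_apply_eq_one_iff p s).2 h

theorem monotone_runFrom_hitSet (Q : P.Config → Prop) (h : List P.Config × P.Config) :
    Monotone fun T => (P.runFrom b F A h T).toOuterMeasure (P.hitSet Q) := by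
  refine monotone_nat_of_le_succ fun T => ?_
  rw [runFrom, PMF.toOuterMeasure_bind_apply, PMF.toOuterMeasure_apply]
  refine ENNReal.tsum_le_tsum fun h' => ?_
  by_cases hh : h' ∈ P.hitSet Q
  · rw [Set.indicator_of_mem hh, toOuterMeasure_eq_one, mul_one]
    intro h'' hh''
    obtain ⟨C, -, rfl⟩ := (PMF.mem_support_map_iff _ _ _).1 hh''
    obtain ⟨D, hD, hQ⟩ := hh
    exact ⟨D, List.mem_append_left _ hD, hQ⟩
  · rw [Set.indicator_of_notMem hh]
    exact zero_le

/-- Monotone convergence, in the one direction that is needed. -/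
theorem tsum_mul_iSup_le {α : Type*} (w : α → ENNReal) (f : ℕ → α → ENNReal)
    (hf : ∀ a, Monotone fun T => f T a) :
    ∑' a, w a * ⨆ T, f T a ≤ ⨆ T, ∑' a, w a * f T a := by
  rw [ENNReal.tsum_eq_iSup_sum]
  refine iSup_le fun s => ?_
  simp_rw [ENNReal.mul_iSup]
  rw [ENNReal.finsetSum_iSup_of_monotone (f := fun a T => w a * f T a)
    fun a => fun T T' hT => mul_le_mul_right (hf a hT) _]
  exact iSup_mono fun T => ENNReal.sum_le_tsum s

/-- Induction on the tree, conditioning on the first step. Equality can fail, because the sweeps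
after the end of the tree may still pass through `Q`. -/
theorem one_le_hit_add_failProb {sw : P.Config → P.Strategy} {a₀ : P.Action} {s : P.Strategy}
    (Q : P.Config → Prop) : ∀ (tr : P.Strategy) (h : List P.Config × P.Config),
      Strategy.current sw a₀ s (h.1 ++ [h.2]) = Strategy.renew sw tr h.2 →
      tr.Meets b F h.2 ∅ →
      1 ≤ (⨆ T, (P.runFrom b F (s.toAdversary sw a₀) h T).toOuterMeasure (P.hitSet Q)) +
        tr.failProb b Q h.2 := by
  intro tr
  have hhit : ∀ h : List P.Config × P.Config, Q h.2 →
      1 ≤ ⨆ T, (P.runFrom b F (s.toAdversary sw a₀) h T).toOuterMeasure (P.hitSet Q) := by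
    intro h hQ
    refine le_iSup_of_le 0 (le_of_eq (toOuterMeasure_eq_one ?_).symm)
    rw [runFrom, PMF.support_pure, Set.singleton_subset_iff]
    exact ⟨h.2, by simp, hQ⟩
  induction tr with
  | halt =>
    intro h _ _
    by_cases hQ : Q h.2
    · exact le_add_right (hhit h hQ)
    · simp [Strategy.failProb, hQ]
  | act a next ih =>
    intro h hcur hm
    by_cases hQ : Q h.2
    · exact le_add_right (hhit h hQ)
    have hA : s.toAdversary sw a₀ h.1 h.2 = a := by
      rw [Strategy.toAdversary, hcur]; rfl
    have hstep : P.histStep b F (s.toAdversary sw a₀) h =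
        (P.apply b h.2 a).map fun C => (h.1 ++ [h.2], C) := by
      rw [histStep, advStep, hA, if_pos hm.1]
    set f : ℕ → P.Config → ENNReal := fun T C =>
      (P.runFrom b F (s.toAdversary sw a₀) (h.1 ++ [h.2], C) T).toOuterMeasure (P.hitSet Q)
    have hsucc : ∀ T, (P.runFrom b F (s.toAdversary sw a₀) h (T + 1)).toOuterMeasure
        (P.hitSet Q) = ∑' C, P.apply b h.2 a C * f T C := by
      intro T
      rw [runFrom_succ_eq, hstep, PMF.bind_map, PMF.toOuterMeasure_bind_apply]
      rfl
    have hge : ∑' C, P.apply b h.2 a C * ⨆ T, f T C ≤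
        ⨆ T, (P.runFrom b F (s.toAdversary sw a₀) h T).toOuterMeasure (P.hitSet Q) := by
      refine (tsum_mul_iSup_le _ _ fun C => monotone_runFrom_hitSet Q _).trans ?_
      exact iSup_le fun T => (hsucc T).symm.le.trans
        (le_iSup (fun T => (P.runFrom b F (s.toAdversary sw a₀) h T).toOuterMeasure
          (P.hitSet Q)) (T + 1))
    rw [Strategy.failProb, if_neg hQ]
    calc (1 : ENNReal) = ∑' C, P.apply b h.2 a C := (PMF.tsum_coe _).symm
      _ ≤ ∑' C, (P.apply b h.2 a C * (⨆ T, f T C) +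
            P.apply b h.2 a C * (next C).failProb b Q C) := by
          refine ENNReal.tsum_le_tsum fun C => ?_
          by_cases hC : C ∈ (P.apply b h.2 a).support
          · rw [← mul_add]
            refine le_mul_of_one_le_right zero_le ?_
            refine ih C (h.1 ++ [h.2], C) ?_ ((hm.2 C hC).mono (Set.empty_subset _))
            rw [Strategy.current_concat, hcur]
            rfl
          · rw [(PMF.apply_eq_zero_iff _ _).2 hC]
            exact zero_le
      _ ≤ _ := by
          rw [ENNReal.tsum_add]
          exact add_le_add hge le_rfl

theorem one_le_probEventually_add_failProb {sw : P.Config → P.Strategy} {a₀ : P.Action}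
    {s : P.Strategy} (Q : P.Config → Prop) (hs : s.Meets b F P.initConfig ∅) :
    1 ≤ P.probEventually b F (s.toAdversary sw a₀) Q + s.failProb b Q P.initConfig := by
  have := one_le_hit_add_failProb (sw := sw) (a₀ := a₀) (s := s) Q s ([], P.initConfig)
    (by simp [Strategy.current_singleton]) hs
  simp_rw [← run_eq_runFrom] at this
  exact this

theorem le_foldr_max {l : List ℕ} {a : ℕ} (h : a ∈ l) : a ≤ l.foldr max 0 := by
  induction l with
  | nil => simp at h
  | cons x l ih =>
    rcases List.mem_cons.1 h with rfl | h
    · exact le_max_left _ _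
    · exact (ih h).trans (le_max_right _ _)

/-- Markov's inequality: a history that has passed through an outlasting configuration has running
time at least `E`, since that configuration is undecided and has chains of that length. -/
theorem ofReal_mul_probEventually_le (E : ℝ) :
    ENNReal.ofReal E * P.probEventually b F A (fun C => C.Outlasts F E) ≤
      P.expectedRunningTime b F A := by
  rw [probEventually, ENNReal.mul_iSup, expectedRunningTime]
  refine iSup_mono fun T => ?_
  rw [PMF.toOuterMeasure_apply, ← ENNReal.tsum_mul_left]
  refine ENNReal.tsum_le_tsum fun h => ?_
  by_cases hh : h ∈ {h : List P.Config × P.Config | ∃ C ∈ h.1 ++ [h.2], C.Outlasts F E}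
  · rw [Set.indicator_of_mem hh, mul_comm]
    refine mul_le_mul_right ?_ _
    obtain ⟨C, hC, hE⟩ := hh
    refine ENNReal.ofReal_le_of_le_toReal ?_
    rw [ENNReal.toReal_natCast]
    refine hE.2.1.trans (Nat.cast_le.2 (le_foldr_max ?_))
    exact List.mem_map.2 ⟨C, List.mem_filter.2 ⟨hC, by simpa using hE.2.2⟩, rfl⟩
  · rw [Set.indicator_of_notMem hh, mul_zero]
    exact zero_le

end Hitting

/-! ### Fair sweeps -/

section Sweep

variable {P : RoundProtocol n t} {b : Fin n → Bool} {F : Finset (Fin n)}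

theorem exists_meets_empty (C : P.Config) : ∃ s : P.Strategy, s.Meets b F C ∅ := ⟨.halt, rfl⟩

theorem exists_meets_of_act {C : P.Config} {a : P.Action} {todo : Set (Fin n ⊕ P.Packet)}
    (ha : P.Legal F C a) (h : ∀ C' ∈ (P.apply b C a).support,
      ∃ s : P.Strategy, s.Meets b F C' (todo \ a.fulfils)) :
    ∃ s : P.Strategy, s.Meets b F C todo := by
  have : Nonempty P.Strategy := ⟨.halt⟩
  choose! next hnext using h
  exact ⟨.act a next, ha, hnext⟩

theorem enterRound_round (p : Fin n) (σ : P.ProcState) (m : P.Msg) :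
    (P.enterRound p σ m).1.round = σ.round + 1 := rfl

theorem exists_enterRound_log (p : Fin n) (σ : P.ProcState) (m : P.Msg) :
    ∃ l : List (Tagged n P.Msg), (P.enterRound p σ m).1.log = σ.log ++ l ∧ l.length ≤ 1 ∧
      ∀ y ∈ l, y.2.1 = σ.round + 1 := by
  refine ⟨_, rfl, ?_, ?_⟩
  · split <;> simp
  · intro y hy
    split at hy <;> simp at hy
    subst hy
    rfl

/-- A good processor can be led to a state in which it waits. -/
theorem exists_meets_of_not_ready (hnt : 2 ≤ n - t) {p : Fin n} (hp : p ∉ F)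
    {todo : Set (Fin n ⊕ P.Packet)} (B : ℕ) : ∀ (d : ℕ) (C : P.Config), (C.proc p).round + d = B →
      (∀ y ∈ (C.proc p).log, y.2.1 ≤ B) →
      (∀ C' : P.Config, ¬ P.Ready (C'.proc p) → C.buffer ≤ C'.buffer →
        ∃ s : P.Strategy, s.Meets b F C' todo) →
      ∃ s : P.Strategy, s.Meets b F C todo := by
  intro d
  induction d with
  | zero =>
    intro C hd hlog h
    by_cases hr : P.Ready (C.proc p)
    · refine exists_meets_of_act (a := .step p none) ⟨hp, by simp⟩ fun C' hC' => ?_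
      rw [apply, if_pos hr] at hC'
      obtain ⟨m, -, rfl⟩ := (PMF.mem_support_map_iff _ _ _).1 hC'
      suffices hnr : ¬ P.Ready ((C.put p (P.enterRound p (C.proc p) m).1
          (P.enterRound p (C.proc p) m).2).proc p) by
        obtain ⟨s, hs⟩ := h (C.put p (P.enterRound p (C.proc p) m).1
          (P.enterRound p (C.proc p) m).2) hnr (Multiset.le_add_right _ _)
        exact ⟨s, hs.mono Set.sdiff_subset⟩
      · have hproc : (C.put p (P.enterRound p (C.proc p) m).1
            (P.enterRound p (C.proc p) m).2).proc p = (P.enterRound p (C.proc p) m).1 := by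
          simp [Config.put]
        rw [hproc]
        rintro (h0 | h1)
        · simp [enterRound_round] at h0
        · obtain ⟨l, hl, hlen, -⟩ := exists_enterRound_log p (C.proc p) m
          rw [enterRound_round, hl] at h1
          -- Older log entries have rounds at most `B`, the round just left. So only the processor's
          -- own new message can carry the current round number, and one message is fewer than `n -
          -- t`.
          have hsub : ofRound ((C.proc p).round + 1)
              (P.validate ((C.proc p).log ++ l).toFinset) ⊆ l.toFinset := by
            intro y hy
            obtain ⟨hy1, hy2⟩ := Finset.mem_filter.1 hy
            have hy3 := P.validate_subset _ hy1
            rw [List.mem_toFinset, List.mem_append] at hy3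
            rcases hy3 with hy3 | hy3
            · have := hlog y hy3
              omega
            · exact List.mem_toFinset.2 hy3
          have := (Finset.card_le_card hsub).trans (List.toFinset_card_le l)
          omega
    · exact h C hr le_rfl
  | succ d ih =>
    intro C hd hlog h
    by_cases hr : P.Ready (C.proc p)
    · refine exists_meets_of_act (a := .step p none) ⟨hp, by simp⟩ fun C' hC' => ?_
      rw [apply, if_pos hr] at hC'
      obtain ⟨m, -, rfl⟩ := (PMF.mem_support_map_iff _ _ _).1 hC'
      have hproc : (C.put p (P.enterRound p (C.proc p) m).1
          (P.enterRound p (C.proc p) m).2).proc p = (P.enterRound p (C.proc p) m).1 := by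
        simp [Config.put]
      suffices hs : ∃ s : P.Strategy, s.Meets b F (C.put p (P.enterRound p (C.proc p) m).1
          (P.enterRound p (C.proc p) m).2) todo by
        obtain ⟨s, hs⟩ := hs
        exact ⟨s, hs.mono Set.sdiff_subset⟩
      refine ih (C.put p (P.enterRound p (C.proc p) m).1
        (P.enterRound p (C.proc p) m).2) (by rw [hproc, enterRound_round]; omega) ?_ ?_
      · obtain ⟨l, hl, -, hl2⟩ := exists_enterRound_log p (C.proc p) m
        intro y hy
        rw [hproc, hl, List.mem_append] at hy
        rcases hy with hy | hy
        · exact hlog y hy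
        · have := hl2 y hy
          omega
      · exact fun C' h1 h2 => h C' h1 ((Multiset.le_add_right _ _).trans h2)
    · exact h C hr le_rfl

/-- A ready processor must enter its next round before it may receive, so each destination is first
led to a waiting state. The other packets stay in the buffer meanwhile. -/
theorem exists_meets_packets (hnt : 2 ≤ n - t) : ∀ (l : List P.Packet) (C : P.Config), l.Nodup →
    (∀ x ∈ l, x ∈ C.buffer ∧ x.dst ∉ F) →
    ∃ s : P.Strategy, s.Meets b F C {o | ∃ x ∈ l, o = .inr x} := by
  intro l
  induction l with
  | nil => intro C _ _; simpa using exists_meets_empty C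
  | cons x l ih =>
    intro C hnd hl
    obtain ⟨hx, hxF⟩ := hl x (by simp)
    let B := max (C.proc x.dst).round (((C.proc x.dst).log.map fun y => y.2.1).foldr max 0)
    refine exists_meets_of_not_ready hnt hxF B (B - (C.proc x.dst).round) C ?_ ?_ ?_
    · have : (C.proc x.dst).round ≤ B := le_max_left _ _
      omega
    · intro y hy
      have hy' : y.2.1 ∈ (C.proc x.dst).log.map fun y => y.2.1 := List.mem_map.2 ⟨y, hy, rfl⟩
      exact (le_foldr_max hy').trans (le_max_right _ _)
    · intro C' hr hbuf
      refine exists_meets_of_act (a := .step x.dst (some x)) ⟨hxF, ?_⟩ fun C'' hC'' => ?_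
      · rintro _ ⟨rfl⟩
        exact ⟨Multiset.mem_of_le hbuf hx, rfl, hr⟩
      · rw [apply, PMF.support_pure, Set.mem_singleton_iff] at hC''
        suffices hs : ∃ s : P.Strategy, s.Meets b F C'' {o | ∃ x ∈ l, o = .inr x} by
          obtain ⟨s, hs⟩ := hs
          refine ⟨s, hs.mono ?_⟩
          rintro o ⟨⟨y, hy, rfl⟩, hno⟩
          rcases List.mem_cons.1 hy with rfl | hy
          · exact absurd (by simp [Action.fulfils]) hno
          · exact ⟨y, hy, rfl⟩
        refine ih C'' (List.nodup_cons.1 hnd).2 fun y hy => ?_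
        obtain ⟨h1, h2⟩ := hl y (by simp [hy])
        refine ⟨?_, h2⟩
        rw [hC'']
        refine Multiset.mem_add.2 (.inl ((Multiset.mem_erase_of_ne ?_).2
          (Multiset.mem_of_le hbuf h1)))
        rintro rfl
        exact (List.nodup_cons.1 hnd).1 hy

theorem exists_meets_procs (hnt : 2 ≤ n - t) (lx : List P.Packet) (hnd : lx.Nodup) :
    ∀ (l : List (Fin n)) (C : P.Config), (∀ p ∈ l, p ∉ F) →
    (∀ x ∈ lx, x ∈ C.buffer ∧ x.dst ∉ F) →
    ∃ s : P.Strategy, s.Meets b F C {o | (∃ p ∈ l, o = .inl p) ∨ ∃ x ∈ lx, o = .inr x} := by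
  intro l
  induction l with
  | nil => intro C _ hx; simpa using exists_meets_packets hnt lx C hnd hx
  | cons p l ih =>
    intro C hl hx
    have hleg : P.Legal F C (.step p none) := ⟨hl p (by simp), by simp⟩
    refine exists_meets_of_act hleg fun C' hC' => ?_
    obtain ⟨s, hs⟩ := ih C' (fun q hq => hl q (by simp [hq])) fun x hxl =>
      ⟨mem_buffer_of_mem_support (hx x hxl).1 (hx x hxl).2
        hleg hC' (by simp), (hx x hxl).2⟩
    refine ⟨s, hs.mono ?_⟩
    rintro o ⟨⟨q, hq, rfl⟩ | h, hno⟩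
    · rcases List.mem_cons.1 hq with rfl | hq
      · exact absurd (by simp [Action.fulfils]) hno
      · exact .inl ⟨q, hq, rfl⟩
    · exact .inr h

theorem exists_meets_obligations (hnt : 2 ≤ n - t) (C : P.Config) :
    ∃ s : P.Strategy, s.Meets b F C (P.obligations F C) := by
  obtain ⟨s, hs⟩ := exists_meets_procs (b := b) (F := F) hnt
    (C.buffer.toFinset.filter fun x => x.dst ∉ F).toList (Finset.nodup_toList _)
    (Finset.univ.filter fun p => p ∉ F).toList C (by simp) (by simp)
  refine ⟨s, hs.mono ?_⟩
  rintro o (⟨p, hp, rfl⟩ | ⟨x, hx, hF, rfl⟩)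
  · exact .inl ⟨p, by simpa using hp, rfl⟩
  · exact .inr ⟨x, by simpa using ⟨hx, hF⟩, rfl⟩

end Sweep

/-! ### Forcing -/

/-- From `C` the adversary can force the execution to pass through `Q`, except with probability at
most `ε`. -/
def Forces (P : RoundProtocol n t) (b : Fin n → Bool) (F : Finset (Fin n)) (Q : P.Config → Prop)
    (C : P.Config) (ε : ENNReal) : Prop :=
  ∃ s : P.Strategy, s.Meets b F C ∅ ∧ s.failProb b Q C ≤ ε

section Forces

variable {P : RoundProtocol n t} {b : Fin n → Bool} {F : Finset (Fin n)} {Q : P.Config → Prop}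
  {C : P.Config} {ε : ENNReal}

theorem Forces.of_mem (h : Q C) : P.Forces b F Q C ε :=
  ⟨.halt, rfl, by simp [Strategy.failProb, h]⟩

theorem Forces.of_one_le (h : 1 ≤ ε) : P.Forces b F Q C ε := by
  refine ⟨.halt, rfl, le_trans ?_ h⟩
  rw [Strategy.failProb]
  split_ifs <;> simp

theorem Forces.of_pure {C' : P.Config} {a : P.Action} (ha : P.Legal F C a)
    (hC' : P.apply b C a = PMF.pure C') (h : P.Forces b F Q C' ε) : P.Forces b F Q C ε := by
  obtain ⟨s, hs, hε⟩ := h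
  refine ⟨.act a fun _ => s, ⟨ha, fun C'' hC'' => ?_⟩, ?_⟩
  · rw [hC', PMF.support_pure, Set.mem_singleton_iff] at hC''
    rw [hC'', Set.empty_sdiff]
    exact hs
  · rw [Strategy.failProb, hC']
    split_ifs
    · exact zero_le
    · rw [tsum_eq_single C' fun C'' hne => by simp [PMF.pure_apply, hne]]
      simpa using hε

/-- A strategy sees only the resulting configuration, and different messages might produce the same
one. The continuation is therefore chosen per configuration, not per message. -/
theorem Forces.of_enter {p : Fin n} (hp : p ∉ F) (hr : P.Ready (C.proc p)) (f : P.Msg → ENNReal)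
    (hfin : (P.nextMessage (b p) (C.proc p)).support.Finite)
    (h : ∀ m ∈ (P.nextMessage (b p) (C.proc p)).support,
      P.Forces b F Q (C.put p (P.enterRound p (C.proc p) m).1 (P.enterRound p (C.proc p) m).2)
        (f m))
    (hε : ∑' m, P.nextMessage (b p) (C.proc p) m * f m ≤ ε) : P.Forces b F Q C ε := by
  set μ := P.nextMessage (b p) (C.proc p) with hμ
  set g : P.Msg → P.Config := fun m =>
    C.put p (P.enterRound p (C.proc p) m).1 (P.enterRound p (C.proc p) m).2 with hg
  have key : ∀ C' : P.Config, ∃ s : P.Strategy, C' ∈ (μ.map g).support →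
      s.Meets b F C' ∅ ∧ ∀ m ∈ μ.support, g m = C' → s.failProb b Q C' ≤ f m := by
    intro C'
    by_cases hC' : C' ∈ (μ.map g).support
    · obtain ⟨m₀, hm₀, hgm₀⟩ := (PMF.mem_support_map_iff _ _ _).1 hC'
      -- Among the finitely many messages leading to `C'`, the one with the smallest bound supplies
      -- a continuation that serves all of them.
      obtain ⟨m₁, ⟨hm₁, hgm₁⟩, hmin⟩ := Set.exists_min_image (μ.support ∩ {m | g m = C'}) f
        (hfin.inter_of_left _) ⟨m₀, hm₀, hgm₀⟩
      obtain ⟨s, hs, hf⟩ := h m₁ hm₁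
      change g m₁ = C' at hgm₁
      change s.Meets b F (g m₁) ∅ at hs
      change s.failProb b Q (g m₁) ≤ f m₁ at hf
      rw [hgm₁] at hs hf
      exact ⟨s, fun _ => ⟨hs, fun m hm hgm => hf.trans (hmin m ⟨hm, hgm⟩)⟩⟩
    · exact ⟨.halt, fun h => absurd h hC'⟩
  choose next hnext using key
  have happ : P.apply b C (.step p none) = μ.map g := by rw [apply, if_pos hr]
  refine ⟨.act (.step p none) next, ⟨⟨hp, by simp⟩, fun C' hC' => ?_⟩, ?_⟩
  · rw [happ] at hC'
    rw [Set.empty_sdiff]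
    exact (hnext C' hC').1
  · rw [Strategy.failProb]
    split_ifs
    · exact zero_le
    refine le_trans ?_ hε
    rw [happ]
    have hsum : ∀ φ : P.Config → ENNReal, ∑' C', (μ.map g) C' * φ C' = ∑' m, μ m * φ (g m) := by
      intro φ
      simp_rw [PMF.map_apply, ← ENNReal.tsum_mul_right]
      rw [ENNReal.tsum_comm]
      refine tsum_congr fun m => ?_
      rw [tsum_eq_single (g m)]
      · simp
      · intro C' hne
        simp [hne]
    rw [hsum]
    refine ENNReal.tsum_le_tsum fun m => ?_
    by_cases hm : m ∈ μ.support
    · gcongr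
      exact (hnext (g m) ((PMF.mem_support_map_iff _ _ _).2 ⟨m, hm, rfl⟩)).2 m hm rfl
    · rw [(PMF.apply_eq_zero_iff _ _).2 hm]
      simp

/-- This is how agreement and validity, which speak of all reachable configurations, are applied to
forced executions. -/
theorem Forces.exists_reachable (h : P.Forces b F Q C ε) (hε : ε < 1) (hC : P.Reachable b F C) :
    ∃ C', P.Reachable b F C' ∧ Q C' := by
  obtain ⟨s, hs, hf⟩ := h
  replace hf := hf.trans_lt hε
  clear hε
  induction s generalizing C with
  | halt =>
    by_cases hQ : Q C
    · exact ⟨C, hC, hQ⟩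
    · simp [Strategy.failProb, hQ] at hf
  | act a next ih =>
    by_cases hQ : Q C
    · exact ⟨C, hC, hQ⟩
    rw [Strategy.failProb, if_neg hQ] at hf
    have : ∃ C' ∈ (P.apply b C a).support, (next C').failProb b Q C' < 1 := by
      by_contra! hno
      refine absurd hf (not_lt.2 ?_)
      calc (1 : ENNReal) = ∑' C', P.apply b C a C' := (PMF.tsum_coe _).symm
        _ ≤ _ := ENNReal.tsum_le_tsum fun C' => by
          by_cases hC' : C' ∈ (P.apply b C a).support
          · exact le_mul_of_one_le_right zero_le (hno C' hC')
          · rw [(PMF.apply_eq_zero_iff _ _).2 hC']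
            exact zero_le
    obtain ⟨C', hC', hlt⟩ := this
    exact ih C' (hC.step hs.1 hC') ((hs.2 C' hC').mono (Set.empty_subset _)) hlt

/-- A strategy that outlasts `E` rounds with probability `1 / 2` extends to a fair adversary. -/
theorem Forces.exists_adversary {E : ℝ} (hE : 0 ≤ E) (hnt : 2 ≤ n - t) (hF : F.card < n)
    (h : P.Forces b F (fun C => C.Outlasts F E) P.initConfig (1 / 2)) :
    ∃ A : P.Adversary, P.Fair b F A ∧
      1 / 2 ≤ P.probEventually b F A (fun C => C.Outlasts F E) ∧
      ENNReal.ofReal (E / 2) ≤ P.expectedRunningTime b F A := by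
  obtain ⟨s, hs, hf⟩ := h
  obtain ⟨p₀, -, hp₀⟩ := Finset.exists_mem_notMem_of_card_lt_card
    (show F.card < (Finset.univ : Finset (Fin n)).card by simpa using hF)
  choose sw hsw using fun C : P.Config => exists_meets_obligations (b := b) (F := F) hnt C
  have hsw' : ∀ C, sw C ≠ .halt := by
    intro C hC
    have := hsw C
    rw [hC] at this
    have hmem : Sum.inl p₀ ∈ P.obligations F C := .inl ⟨p₀, hp₀, rfl⟩
    rw [show P.obligations F C = ∅ from this] at hmem
    exact hmem
  have hprob : 1 / 2 ≤ P.probEventually b F (s.toAdversary sw (.step p₀ none))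
      (fun C => C.Outlasts F E) := by
    have h1 := (one_le_probEventually_add_failProb (sw := sw) (a₀ := .step p₀ none)
      (fun C => C.Outlasts F E) hs).trans (add_le_add_right hf _)
    nth_rw 1 [← ENNReal.add_halves 1] at h1
    exact (ENNReal.add_le_add_iff_right (by simp)).1 h1
  refine ⟨s.toAdversary sw (.step p₀ none), fair_toAdversary hsw hsw' hs, hprob, ?_⟩
  refine le_trans ?_ (ofReal_mul_probEventually_le E)
  rw [div_eq_mul_one_div, ENNReal.ofReal_mul hE]
  gcongr
  refine le_trans (le_of_eq ?_) hprob
  rw [ENNReal.ofReal_div_of_pos two_pos]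
  simp

end Forces

end RoundProtocol

/-! ### Broadcast plans -/

namespace BroadcastProtocol

variable {n : ℕ} {M : Type} {B : BroadcastProtocol n M}

/-- Delivery of the packet `x` within instance `(s, k)`. -/
def InstConfig.deliver (C : B.InstConfig) (s : Fin n) (k : ℕ) (x : B.InstPacket) : B.InstConfig :=
  InstConfig.apply ⟨C.loc, C.buffer.erase x⟩ s k x.dst (.receive x.src x.payload)

theorem InstConfig.deliver_accepted {C : B.InstConfig} {s : Fin n} {k : ℕ} {x : B.InstPacket}
    {p : Fin n} {v : M} (h : (C.loc p).accepted = some v) :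
    ((C.deliver s k x).loc p).accepted = some v := by
  by_cases hp : p = x.dst
  · subst hp
    simp [deliver, apply, react, h]
  · simpa [deliver, apply, hp] using h

/-- The configuration after the first `j` deliveries of `σ`. -/
def afterTake (B : BroadcastProtocol n M) (s : Fin n) (k : ℕ) (m : M) (σ : List B.InstPacket)
    (j : ℕ) : B.InstConfig :=
  (σ.take j).foldl (fun C x => C.deliver s k x) (B.startConfig s k m)

theorem afterTake_succ (s : Fin n) (k : ℕ) (m : M) (σ : List B.InstPacket) {j : ℕ}
    (hj : j < σ.length) :
    B.afterTake s k m σ (j + 1) = (B.afterTake s k m σ j).deliver s k σ[j] := by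
  rw [afterTake, List.take_add_one, List.foldl_append, List.getElem?_eq_getElem hj]
  rfl

theorem Schedule.eq_foldl {s : Fin n} {k : ℕ} {m : M} {σ : List B.InstPacket} {C : B.InstConfig}
    (h : B.Schedule s k m σ C) :
    C = σ.foldl (fun C x => C.deliver s k x) (B.startConfig s k m) := by
  induction h with
  | nil => rfl
  | snoc h hx ih => rw [List.foldl_append, ← ih]; rfl

theorem Schedule.mem_buffer {s : Fin n} {k : ℕ} {m : M} {σ : List B.InstPacket} {C : B.InstConfig}
    (h : B.Schedule s k m σ C) {j : ℕ} (hj : j < σ.length) :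
    σ[j] ∈ (B.afterTake s k m σ j).buffer := by
  induction h with
  | nil => simp at hj
  | @snoc σ C x h hx ih =>
    by_cases hj' : j < σ.length
    · have := ih hj'
      rw [afterTake] at this ⊢
      rwa [List.take_append_of_le_length hj'.le, List.getElem_append_left hj']
    · have : j = σ.length := by simp at hj; omega
      subst this
      rw [afterTake, List.take_left, ← h.eq_foldl]
      simpa using hx

theorem afterTake_accepted {s : Fin n} {k : ℕ} {m : M} {σ : List B.InstPacket} {i j : ℕ}
    (hij : i ≤ j) (hj : j ≤ σ.length) {p : Fin n} {v : M}
    (h : ((B.afterTake s k m σ i).loc p).accepted = some v) :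
    ((B.afterTake s k m σ j).loc p).accepted = some v := by
  induction j, hij using Nat.le_induction with
  | base => exact h
  | succ j hij ih =>
    rw [afterTake_succ s k m σ (by omega)]
    exact InstConfig.deliver_accepted (ih (by omega))

/-- Arbitrary receiver order in terms of a list of deliveries and the lengths of its prefixes. -/
theorem ArbitraryReceiverOrder.exists_lengths (hB : B.ArbitraryReceiverOrder) (hn : 0 < n)
    (s : Fin n) (k : ℕ) (m : M) (π : Equiv.Perm (Fin n)) :
    ∃ (σ : List B.InstPacket) (ℓ : Fin n → ℕ), (∀ i, ℓ i ≤ σ.length) ∧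
      (∀ j (hj : j < σ.length), σ[j] ∈ (B.afterTake s k m σ j).buffer) ∧
      (∀ i q, ((B.afterTake s k m σ (ℓ i)).loc q).accepted = some m ↔ ∃ j ≤ i, π j = q) ∧
      ∀ i q v, ((B.afterTake s k m σ (ℓ i)).loc q).accepted = some v → v = m := by
  obtain ⟨σ, C, hσ, h⟩ := hB s k m π
  choose τ D hτ hD hacc using h
  have hloc : ∀ i, B.afterTake s k m σ (τ i).length = D i := by
    intro i
    rw [(hD i).eq_foldl, afterTake, ← List.prefix_iff_eq_take.1 (hτ i)]
  have hiff : ∀ i q, ((B.afterTake s k m σ (τ i).length).loc q).accepted = some m ↔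
      ∃ j ≤ i, π j = q := by
    intro i q
    rw [hloc]
    exact hacc i q
  refine ⟨σ, fun i => (τ i).length, fun i => (hτ i).length_le, fun j hj => hσ.mem_buffer hj, hiff,
    fun i q v hv => ?_⟩
  -- After the longest of the given prefixes everybody has accepted `m`. Acceptance is final, so
  -- nobody can have accepted anything else at any cut.
  have hlast : ((B.afterTake s k m σ (τ ⟨n - 1, by omega⟩).length).loc q).accepted = some m :=
    (hiff _ q).2 ⟨π.symm q, by rw [Fin.le_def]; have := (π.symm q).isLt; simp; omega, by simp⟩
  rcases le_total (τ i).length (τ ⟨n - 1, by omega⟩).length with hle | hle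
  · have := afterTake_accepted hle (hτ _).length_le hv
    rw [hlast] at this
    exact (Option.some.inj this).symm
  · have := afterTake_accepted hle (hτ _).length_le hlast
    rw [hv] at this
    exact Option.some.inj this

/-- In an order that begins with a processor other than `p`, there is a prefix after which `p` has
not accepted `m`. Acceptance is final, so `p` cannot have accepted at the start. -/
theorem ArbitraryReceiverOrder.start_accepted (hB : B.ArbitraryReceiverOrder) (hn : 2 ≤ n)
    (s : Fin n) (k : ℕ) (m : M) (p : Fin n) : ((B.startConfig s k m).loc p).accepted = none := by
  rw [Option.eq_none_iff_forall_ne_some]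
  intro v hv
  obtain ⟨p', hp'⟩ : ∃ p' : Fin n, p' ≠ p :=
    haveI : Nontrivial (Fin n) := Fin.nontrivial_iff_two_le.2 hn
    exists_ne p
  obtain ⟨σ, ℓ, hℓ, -, hiff, hval⟩ := hB.exists_lengths (by omega) s k m
    (Equiv.swap ⟨0, by omega⟩ p')
  have h0 : ((B.afterTake s k m σ 0).loc p).accepted = some v := by simpa [afterTake] using hv
  have h1 := afterTake_accepted (Nat.zero_le _) (hℓ ⟨0, by omega⟩) h0
  obtain rfl := hval _ _ _ h1
  obtain ⟨j, hj, hjp⟩ := (hiff _ _).1 h1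
  have : j = ⟨0, by omega⟩ := by
    rw [Fin.le_def] at hj
    exact Fin.ext (by simpa using hj)
  rw [this, Equiv.swap_apply_left] at hjp
  exact hp' hjp

/-- A run of instance `(s, k)`, invoked on `m`, with cut points at which exactly the processors in
the given sets have accepted. -/
structure Plan (B : BroadcastProtocol n M) (s : Fin n) (k : ℕ) (m : M)
    (T : ℕ → Finset (Fin n)) where
  st : ℕ → B.InstConfig
  cut : ℕ → ℕ
  st_zero : st 0 = B.startConfig s k m
  step : ∀ q j, j < cut q → ∃ x ∈ (st j).buffer, st (j + 1) = (st j).deliver s k x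
  cut_mono : Monotone cut
  accepted_cut : ∀ q p, ((st (cut q)).loc p).accepted = if p ∈ T q then some m else none
  cut_empty : ∀ q, T q = ∅ → cut q = 0

theorem Plan.accepted_mono {s : Fin n} {k : ℕ} {m : M} {T : ℕ → Finset (Fin n)}
    (pl : B.Plan s k m T) {q i j : ℕ} (hij : i ≤ j) (hj : j ≤ pl.cut q) {p : Fin n} {v : M}
    (h : ((pl.st i).loc p).accepted = some v) : ((pl.st j).loc p).accepted = some v := by
  induction j, hij using Nat.le_induction with
  | base => exact h
  | succ j hij ih =>
    obtain ⟨x, -, hx⟩ := pl.step q j (by omega)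
    rw [hx]
    exact InstConfig.deliver_accepted (ih (by omega))

theorem Plan.of_accepted {s : Fin n} {k : ℕ} {m : M} {T : ℕ → Finset (Fin n)}
    (pl : B.Plan s k m T) {q j : ℕ} (hj : j ≤ pl.cut q) {p : Fin n} {v : M}
    (h : ((pl.st j).loc p).accepted = some v) : p ∈ T q ∧ v = m := by
  have := pl.accepted_mono hj le_rfl h
  rw [pl.accepted_cut] at this
  split_ifs at this with hp
  exact ⟨hp, (Option.some.inj this).symm⟩

/-- Sorting the processors by the first phase in which they belong to `T` makes every `T q` an
initial segment of a single receiver order. -/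
theorem ArbitraryReceiverOrder.nonempty_plan (hB : B.ArbitraryReceiverOrder) (hn : 2 ≤ n)
    (s : Fin n) (k : ℕ) (m : M) {T : ℕ → Finset (Fin n)} (hT : Monotone T) :
    Nonempty (B.Plan s k m T) := by
  -- The first phase in which `p` is to have accepted, `⊤` if there is none.
  let α : Fin n → ℕ∞ := fun p => if h : ∃ q, p ∈ T q then (Nat.find h : ℕ∞) else ⊤
  have hα : ∀ p q, p ∈ T q ↔ α p ≤ q := by
    intro p q
    by_cases h : ∃ q, p ∈ T q
    · simp only [α, dif_pos h, Nat.cast_le]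
      exact ⟨fun hp => Nat.find_min' h hp, fun hle => hT hle (Nat.find_spec h)⟩
    · simp only [α, dif_neg h, top_le_iff, ENat.natCast_ne_top, iff_false]
      exact fun hp => h ⟨q, hp⟩
  let π := Tuple.sort α
  have hπ : Monotone (α ∘ π) := Tuple.monotone_sort α
  obtain ⟨σ, ℓ, hℓ, hmem, hiff, hval⟩ := hB.exists_lengths (by omega) s k m π
  let S : Finset (Fin n) → Finset (Fin n) := fun U => U.map π.symm.toEmbedding
  have hS : ∀ U j, j ∈ S U ↔ π j ∈ U := by
    intro U j
    simp [S]
  let c : Finset (Fin n) → ℕ := fun U => if h : (S U).Nonempty then ℓ ((S U).max' h) else 0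
  have hc : ∀ U, c U ≤ σ.length := by
    intro U
    simp only [c]
    split_ifs
    · exact hℓ _
    · exact Nat.zero_le _
  have hacc : ∀ q p, ((B.afterTake s k m σ (c (T q))).loc p).accepted =
      if p ∈ T q then some m else none := by
    intro q p
    by_cases h : (S (T q)).Nonempty
    · have hmax : ∀ j, j ≤ (S (T q)).max' h ↔ j ∈ S (T q) := by
        intro j
        refine ⟨fun hj => ?_, fun hj => Finset.le_max' _ _ hj⟩
        have := Finset.max'_mem _ h
        rw [hS, hα] at this ⊢
        exact (hπ hj).trans this
      have hset : ∀ p, (∃ j ≤ (S (T q)).max' h, π j = p) ↔ p ∈ T q := by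
        intro p
        constructor
        · rintro ⟨j, hj, rfl⟩
          rwa [hmax, hS] at hj
        · intro hp
          exact ⟨π.symm p, by rw [hmax, hS]; simpa using hp, by simp⟩
      simp only [c, dif_pos h]
      split_ifs with hp
      · rw [hiff, hset]
        exact hp
      · rw [Option.eq_none_iff_forall_ne_some]
        intro v hv
        obtain rfl := hval _ _ _ hv
        rw [hiff, hset] at hv
        exact hp hv
    · have hp : p ∉ T q := by
        intro hp
        exact h ⟨π.symm p, by rw [hS]; simpa using hp⟩
      simp only [c, dif_neg h, if_neg hp]
      simpa [afterTake] using hB.start_accepted hn s k m p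
  refine ⟨{
    st := B.afterTake s k m σ
    cut := fun q => c (T q)
    st_zero := by simp [afterTake]
    step := fun q j hj => ⟨σ[j]'(hj.trans_le (hc _)), hmem j _, afterTake_succ s k m σ _⟩
    cut_mono := ?_
    accepted_cut := hacc
    cut_empty := ?_ }⟩
  -- The prefixes given by receiver order are not assumed to be nested. If the later cut came
  -- earlier, finality of acceptance would give `T q' ⊆ T q`, hence equal sets and equal cuts.
  · intro q q' hqq
    by_contra hlt
    rw [not_le] at hlt
    have hsub : T q' ⊆ T q := by
      intro p hp
      have h1 := hacc q' p
      rw [if_pos hp] at h1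
      have h2 := afterTake_accepted hlt.le (hc _) h1
      rw [hacc] at h2
      by_contra hno
      simp [hno] at h2
    have : T q = T q' := (hT hqq).antisymm hsub
    simp only [this, lt_self_iff_false] at hlt
  · intro q hq
    simp [c, S, hq]

end BroadcastProtocol

/-! ### Instances within a configuration -/

namespace RoundProtocol

variable {n t : ℕ} {P : RoundProtocol n t}

/-- The payload of a packet within its instance. -/
def Packet.inst (x : P.Packet) : P.bc.InstPacket := ⟨x.src, x.dst, x.payload⟩

/-- The state of broadcast instance `(s, k)` in the configuration `C`. -/
def Config.instAt (C : P.Config) (s : Fin n) (k : ℕ) : P.bc.InstConfig where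
  loc q := (C.proc q).inst s k
  buffer := (C.buffer.filter fun x => x.owner = s ∧ x.round = k).map Packet.inst

theorem instConfig_ext {C D : P.bc.InstConfig} (h1 : C.loc = D.loc) (h2 : C.buffer = D.buffer) :
    C = D := by
  cases C; cases D; simp_all

/-- Instances do not interact, so one step of the system projects to one step of the instance
concerned. All other instances are untouched, as the companion lemma shows. -/
theorem instAt_put_feed (C : P.Config) (p s : Fin n) (k : ℕ)
    (i : BroadcastInput n P.Msg P.bc.Payload) (σ : P.ProcState)
    (hσ : σ.inst = (C.proc p).inst) :
    (C.put p (P.feed p s k i σ).1 (P.feed p s k i σ).2).instAt s k =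
      (C.instAt s k).apply s k p i := by
  refine instConfig_ext ?_ ?_
  · funext q
    by_cases hq : q = p
    · subst hq
      simp [Config.instAt, Config.put, feed, BroadcastProtocol.InstConfig.apply, hσ]
    · simp [Config.instAt, Config.put, BroadcastProtocol.InstConfig.apply, hq]
  · simp only [Config.instAt, Config.put, feed, BroadcastProtocol.InstConfig.apply, hσ,
      Multiset.filter_add, Multiset.map_add]
    congr 1
    rw [Multiset.filter_coe, Multiset.map_coe, List.filter_eq_self.2]
    · simp [Function.comp_def, Packet.inst]
    · intro x hx
      simp only [List.mem_map, List.map_map] at hx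
      obtain ⟨o, -, rfl⟩ := hx
      simp

theorem instAt_put_feed_of_ne (C : P.Config) (p s : Fin n) (k : ℕ)
    (i : BroadcastInput n P.Msg P.bc.Payload) (σ : P.ProcState)
    (hσ : σ.inst = (C.proc p).inst) {s' : Fin n} {k' : ℕ} (h : ¬ (s' = s ∧ k' = k)) :
    (C.put p (P.feed p s k i σ).1 (P.feed p s k i σ).2).instAt s' k' = C.instAt s' k' := by
  refine instConfig_ext ?_ ?_
  · funext q
    by_cases hq : q = p
    · subst hq
      by_cases hs : s' = s
      · subst hs
        have hk : k' ≠ k := fun hk => h ⟨rfl, hk⟩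
        simp [Config.instAt, Config.put, feed, hσ, hk]
      · simp [Config.instAt, Config.put, feed, hσ, hs]
    · simp [Config.instAt, Config.put, hq]
  · simp only [Config.instAt, Config.put, feed, Multiset.filter_add, Multiset.map_add]
    rw [Multiset.filter_coe, List.filter_eq_nil_iff.2]
    · simp
    · intro x hx
      simp only [List.mem_map, List.map_map] at hx
      obtain ⟨o, -, rfl⟩ := hx
      simp only [Function.comp, decide_eq_true_eq]
      rintro ⟨rfl, rfl⟩
      exact h ⟨rfl, rfl⟩

theorem instAt_take (C : P.Config) {x : P.Packet} (hx : x ∈ C.buffer) :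
    (C.take x).instAt x.owner x.round = ⟨(C.instAt x.owner x.round).loc,
      (C.instAt x.owner x.round).buffer.erase x.inst⟩ := by
  refine instConfig_ext rfl ?_
  simp only [Config.instAt, Config.take]
  obtain ⟨s, hs⟩ := Multiset.exists_cons_of_mem hx
  rw [hs, Multiset.erase_cons_head, Multiset.filter_cons_of_pos _ ⟨rfl, rfl⟩, Multiset.map_cons,
    Multiset.erase_cons_head]

theorem instAt_take_of_ne (C : P.Config) {x : P.Packet} (hx : x ∈ C.buffer) {s : Fin n} {k : ℕ}
    (h : ¬ (s = x.owner ∧ k = x.round)) : (C.take x).instAt s k = C.instAt s k := by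
  refine instConfig_ext rfl ?_
  simp only [Config.instAt, Config.take]
  obtain ⟨u, hu⟩ := Multiset.exists_cons_of_mem hx
  rw [hu, Multiset.erase_cons_head, Multiset.filter_cons_of_neg]
  rintro ⟨h1, h2⟩
  exact h ⟨h1.symm, h2.symm⟩

/-- The configuration after the packet `x` has been received and handled by the protocol. -/
def Config.receive (C : P.Config) (x : P.Packet) : P.Config :=
  (C.take x).put x.dst (P.feed x.dst x.owner x.round (.receive x.src x.payload) (C.proc x.dst)).1
    (P.feed x.dst x.owner x.round (.receive x.src x.payload) (C.proc x.dst)).2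

/-- The configuration after `p` has entered its next round with message `m`. -/
def Config.enter (C : P.Config) (p : Fin n) (m : P.Msg) : P.Config :=
  C.put p (P.enterRound p (C.proc p) m).1 (P.enterRound p (C.proc p) m).2

theorem instAt_receive (C : P.Config) {x : P.Packet} (hx : x ∈ C.buffer) :
    (C.receive x).instAt x.owner x.round =
      (C.instAt x.owner x.round).deliver x.owner x.round x.inst := by
  rw [Config.receive, instAt_put_feed (C.take x) x.dst x.owner x.round _ (C.proc x.dst) rfl,
    instAt_take C hx]
  rfl

theorem instAt_receive_of_ne (C : P.Config) {x : P.Packet} (hx : x ∈ C.buffer) {s : Fin n} {k : ℕ}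
    (h : ¬ (s = x.owner ∧ k = x.round)) : (C.receive x).instAt s k = C.instAt s k := by
  rw [Config.receive, instAt_put_feed_of_ne (C.take x) x.dst x.owner x.round _ (C.proc x.dst) rfl h,
    instAt_take_of_ne C hx h]

theorem instAt_enter (C : P.Config) (p : Fin n) (m : P.Msg) :
    (C.enter p m).instAt p ((C.proc p).round + 1) =
      (C.instAt p ((C.proc p).round + 1)).apply p ((C.proc p).round + 1) p (.invoke m) := by
  rw [Config.enter, enterRound, instAt_put_feed]
  rfl

theorem instAt_enter_of_ne (C : P.Config) (p : Fin n) (m : P.Msg) {s : Fin n} {k : ℕ}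
    (h : ¬ (s = p ∧ k = (C.proc p).round + 1)) : (C.enter p m).instAt s k = C.instAt s k := by
  rw [Config.enter, enterRound, instAt_put_feed_of_ne (h := h)]
  rfl

/-! ### Consistency of logs and depths -/

theorem feed_inst_of_ne {p s : Fin n} {k : ℕ} {i : BroadcastInput n P.Msg P.bc.Payload}
    {σ : P.ProcState} {s' : Fin n} {k' : ℕ} (h : ¬ (s' = s ∧ k' = k)) :
    (P.feed p s k i σ).1.inst s' k' = σ.inst s' k' := by
  by_cases hs : s' = s
  · subst hs
    have hk : k' ≠ k := fun hk => h ⟨rfl, hk⟩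
    simp [feed, hk]
  · simp [feed, hs]

/-- The log lists exactly the accepted messages. -/
def LogConsistent (σ : P.ProcState) : Prop :=
  ∀ s k m, (s, k, m) ∈ σ.log ↔ (σ.inst s k).accepted = some m

theorem LogConsistent.feed {σ : P.ProcState} (h : LogConsistent σ) (p s : Fin n) (k : ℕ)
    (i : BroadcastInput n P.Msg P.bc.Payload) : LogConsistent (P.feed p s k i σ).1 := by
  intro s' k' m'
  by_cases hsk : s' = s ∧ k' = k
  · obtain ⟨rfl, rfl⟩ := hsk
    have := h s' k' m'
    simp only [RoundProtocol.feed, Function.update_self, List.mem_append, this,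
      BroadcastProtocol.react]
    cases ha : (σ.inst s' k').accepted with
    | none =>
      cases hb : (P.bc.trans s' k' p i (σ.inst s' k').state).2.1 with
      | none => simp
      | some v => simp [eq_comm]
    | some v => simp
  · rw [feed_inst_of_ne hsk, ← h]
    simp only [RoundProtocol.feed, List.mem_append, or_iff_left_iff_imp]
    intro hm
    split at hm
    · simp only [List.mem_singleton, Prod.mk.injEq] at hm
      exact absurd ⟨hm.1, hm.2.1⟩ hsk
    · simp at hm

/-- Chains of messages are at least as long as the round numbers suggest. -/
structure DepthConsistent (C : P.Config) : Prop where
  round_le : ∀ p, (C.proc p).round ≤ C.depth p + 1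
  packet : ∀ x ∈ C.buffer, x.round ≤ x.depth
  -- The own instance is excluded because its invocation could cause an acceptance without any
  -- message having been received.
  accepted : ∀ p s k, s ≠ p → ((C.proc p).inst s k).accepted ≠ none → k ≤ C.depth p

theorem mem_put_buffer {C : P.Config} {p : Fin n} {σ : P.ProcState} {out : List P.Outgoing}
    {x : P.Packet} (hx : x ∈ (C.put p σ out).buffer) :
    x ∈ C.buffer ∨ ∃ o ∈ out, x.round = o.2.2.1 ∧ x.depth = C.depth p + 1 := by
  rcases Multiset.mem_add.1 hx with hx | hx
  · exact .inl hx
  · rw [Multiset.mem_coe, List.mem_map] at hx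
    obtain ⟨o, ho, rfl⟩ := hx
    exact .inr ⟨o, ho, rfl, rfl⟩

theorem feed_round_of_mem {p s : Fin n} {k : ℕ} {i : BroadcastInput n P.Msg P.bc.Payload}
    {σ : P.ProcState} {o : P.Outgoing} (h : o ∈ (P.feed p s k i σ).2) : o.2.2.1 = k := by
  simp only [feed, List.mem_map] at h
  obtain ⟨o', -, rfl⟩ := h
  rfl

theorem DepthConsistent.receive {C : P.Config} (h : DepthConsistent C) {x : P.Packet}
    (hx : x ∈ C.buffer) : DepthConsistent (C.receive x) := by
  have hx' := h.packet x hx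
  have hd : ∀ p, C.depth p ≤ (C.receive x).depth p := by
    intro p
    by_cases hp : p = x.dst
    · subst hp; simp [Config.receive, Config.put, Config.take]
    · simp [Config.receive, Config.put, Config.take, hp]
  have hd' : x.depth ≤ (C.receive x).depth x.dst := by
    simp [Config.receive, Config.put, Config.take]
  refine ⟨fun p => ?_, fun y hy => ?_, fun p s k hs ha => ?_⟩
  · have h1 : ((C.receive x).proc p).round = (C.proc p).round := by
      by_cases hp : p = x.dst
      · subst hp; simp [Config.receive, Config.put, feed]
      · simp [Config.receive, Config.put, Config.take, hp]
    rw [h1]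
    have := h.round_le p
    have := hd p
    omega
  · rcases mem_put_buffer hy with hy | ⟨o, ho, h1, h2⟩
    · exact h.packet y (Multiset.mem_of_mem_erase hy)
    · rw [h1, h2, feed_round_of_mem ho]
      change _ ≤ (C.receive x).depth x.dst + 1
      omega
  · by_cases hp : p = x.dst
    · subst hp
      by_cases hsk : s = x.owner ∧ k = x.round
      · rw [hsk.2]
        omega
      · refine (h.accepted x.dst s k hs ?_).trans (hd _)
        have h1 : ((C.receive x).proc x.dst).inst s k = (C.proc x.dst).inst s k := by
          simp only [Config.receive, Config.put, Function.update_self]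
          exact feed_inst_of_ne hsk
        rwa [h1] at ha
    · refine (h.accepted p s k hs ?_).trans (hd _)
      simpa [Config.receive, Config.put, Config.take, hp] using ha

theorem DepthConsistent.enter {C : P.Config} (h : DepthConsistent C) {p : Fin n}
    (hp : (C.proc p).round ≤ C.depth p) (m : P.Msg) : DepthConsistent (C.enter p m) := by
  refine ⟨fun q => ?_, fun y hy => ?_, fun q s k hs ha => ?_⟩
  · by_cases hq : q = p
    · subst hq
      simpa [Config.enter, Config.put, enterRound_round] using hp
    · simpa [Config.enter, Config.put, hq] using h.round_le q
  · rcases mem_put_buffer hy with hy | ⟨o, ho, h1, h2⟩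
    · exact h.packet y hy
    · rw [h1, h2, feed_round_of_mem ho]
      omega
  · change k ≤ C.depth q
    refine h.accepted q s k hs ?_
    by_cases hq : q = p
    · subst hq
      have h1 : ((C.enter q m).proc q).inst s k = (C.proc q).inst s k := by
        simp only [Config.enter, Config.put, Function.update_self, enterRound]
        rw [feed_inst_of_ne fun h => hs h.1]
      rwa [h1] at ha
    · simpa [Config.enter, Config.put, hq] using ha

end RoundProtocol

/-! ### Scripts -/

/-- Which messages are to be accepted when: `sees h q g k` says that the processors of cell `h` have
accepted the messages of round `k` of the senders in cell `g` when they leave round `q`. -/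
structure Views (n t : ℕ) {ι : Type} (cell : Fin n → ι) where
  sees : ι → ℕ → ι → ℕ → Prop
  bounds : ∀ {h q g k}, sees h q g k → 1 ≤ k ∧ k ≤ q
  succ : ∀ {h q g k}, sees h q g k → sees h (q + 1) g k
  card : ∀ h q, 1 ≤ q → (Finset.univ.filter fun s => sees h q (cell s) q).card = n - t
  -- This condition and the next are what good message completeness asks for: along with a message
  -- one has its sender's earlier messages and everything its sender had seen when drawing it.
  pred : ∀ {h q g k}, sees h q g (k + 1) → 1 ≤ k → sees h q g k
  causal : ∀ {h q g k g' k'}, sees h q g (k + 1) → sees g k g' k' → sees h q g' k'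

namespace Views

variable {n t : ℕ} {ι M : Type} {cell : Fin n → ι} (U : Views n t cell)

theorem mono {h q q' : _} {g : ι} {k : ℕ} (hq : q ≤ q') (hs : U.sees h q g k) :
    U.sees h q' g k := by
  induction q', hq using Nat.le_induction with
  | base => exact hs
  | succ q' _ ih => exact U.succ ih

theorem of_le {h : ι} {q : ℕ} {g : ι} {j k : ℕ} (hs : U.sees h q g k) (hj : 1 ≤ j)
    (hjk : j ≤ k) : U.sees h q g j := by
  induction k, hjk using Nat.le_induction with
  | base => exact hs
  | succ k hk ih => exact ih (U.pred hs (by omega))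

/-- The messages seen by cell `h` at the end of round `q`. -/
def viewSet (msg : Fin n → ℕ → M) (h : ι) (q : ℕ) : Finset (Tagged n M) :=
  (((Finset.univ : Finset (Fin n)) ×ˢ Finset.range (q + 1)).filter
    fun x => U.sees h q (cell x.1) x.2).image fun x => (x.1, x.2, msg x.1 x.2)

theorem mem_viewSet {msg : Fin n → ℕ → M} {h : ι} {q : ℕ} {x : Tagged n M} :
    x ∈ U.viewSet msg h q ↔ U.sees h q (cell x.1) x.2.1 ∧ x.2.2 = msg x.1 x.2.1 := by
  obtain ⟨s, k, m⟩ := x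
  simp only [viewSet, Finset.mem_image, Finset.mem_filter, Finset.mem_product, Finset.mem_univ,
    Finset.mem_range, true_and, Prod.exists, Prod.mk.injEq]
  constructor
  · rintro ⟨s', k', ⟨-, h2⟩, rfl, rfl, rfl⟩
    exact ⟨h2, rfl⟩
  · rintro ⟨h1, rfl⟩
    have := U.bounds h1
    exact ⟨s, k, ⟨by omega, h1⟩, rfl, rfl, rfl⟩

theorem card_ofRound_viewSet (msg : Fin n → ℕ → M) (h : ι) {q : ℕ} (hq : 1 ≤ q) :
    (ofRound q (U.viewSet msg h q)).card = n - t := by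
  rw [← U.card h q hq]
  refine Finset.card_bij' (fun x _ => x.1) (fun s _ => (s, q, msg s q)) ?_ ?_ ?_ ?_
  · intro x hx
    obtain ⟨h1, h2⟩ := Finset.mem_filter.1 hx
    rw [mem_viewSet, h2] at h1
    simpa using h1.1
  · intro s hs
    refine Finset.mem_filter.2 ⟨U.mem_viewSet.2 ⟨?_, rfl⟩, rfl⟩
    simpa using hs
  · intro x hx
    obtain ⟨h1, h2⟩ := Finset.mem_filter.1 hx
    rw [mem_viewSet] at h1
    obtain ⟨s, k, m⟩ := x
    simp_all
  · intro s hs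
    rfl

/-- The senderless content of a view, given the contents of the cells. -/
def viewContent [Fintype ι] (cont : ι → ℕ → Multiset M) (h : ι) (q : ℕ) : Multiset (ℕ × M) :=
  ∑ k ∈ Finset.range (q + 1), ∑ g, if U.sees h q g k then (cont g k).map (Prod.mk k) else 0

/-- The multiset of round-`k` messages of the cell `g`. -/
def _root_.AsyncBA.cellContent (cell : Fin n → ι) (msg : Fin n → ℕ → M) (g : ι) (k : ℕ) :
    Multiset M :=
  (Finset.univ.filter fun s => cell s = g).val.map fun s => msg s k

theorem _root_.AsyncBA.map_val_eq_sum {α β : Type*} (A : Finset α) (f : α → β) :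
    A.val.map f = ∑ a ∈ A, {f a} := by
  rw [← Multiset.sum_map_singleton (A.val.map f), Multiset.map_map]
  rfl

/-- Here full symmetry enters: without senders, a view depends on the messages only through the
multiset sent by each cell. -/
theorem bare_viewSet [Fintype ι] (msg : Fin n → ℕ → M) (h : ι) (q : ℕ) :
    bare (U.viewSet msg h q) = U.viewContent (cellContent cell msg) h q := by
  have h1 : bare (U.viewSet msg h q) =
      (((Finset.univ : Finset (Fin n)) ×ˢ Finset.range (q + 1)).filter
        fun x => U.sees h q (cell x.1) x.2).val.map fun x => (x.2, msg x.1 x.2) := by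
    rw [bare, viewSet, Finset.image_val_of_injOn, Multiset.map_map]
    · rfl
    · rintro ⟨s, k⟩ - ⟨s', k'⟩ - heq
      simp only [Prod.mk.injEq] at heq
      exact Prod.ext heq.1 heq.2.1
  rw [h1, map_val_eq_sum, Finset.sum_filter, Finset.sum_product_right, viewContent]
  refine Finset.sum_congr rfl fun k _ => ?_
  rw [← Finset.sum_fiberwise (s := Finset.univ) (g := cell)]
  refine Finset.sum_congr rfl fun g _ => ?_
  rw [cellContent, Multiset.map_map, map_val_eq_sum]
  split_ifs with hg
  · refine Finset.sum_congr rfl fun s hs => ?_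
    rw [Finset.mem_filter] at hs
    rw [if_pos (by rw [hs.2]; exact hg)]
    rfl
  · refine Finset.sum_eq_zero fun s hs => ?_
    rw [Finset.mem_filter] at hs
    rw [if_neg (by rw [hs.2]; exact hg)]

theorem viewContent_congr [Fintype ι] {cont cont' : ι → ℕ → Multiset M} {h : ι} {q : ℕ}
    (hc : ∀ g k, U.sees h q g k → cont g k = cont' g k) :
    U.viewContent cont h q = U.viewContent cont' h q := by
  refine Finset.sum_congr rfl fun k _ => Finset.sum_congr rfl fun g _ => ?_
  split_ifs with hg
  · rw [hc g k hg]
  · rfl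

end Views

/-- What the adversary wants to happen: inputs, views, and the contents of the messages of every
cell in every round. -/
structure Script {n t : ℕ} (P : RoundProtocol n t) (ι : Type) where
  cell : Fin n → ι
  bit : ι → Bool
  views : Views n t cell
  cont : ι → ℕ → Multiset P.Msg

namespace Script

open RoundProtocol BroadcastProtocol

variable {n t : ℕ} {P : RoundProtocol n t} {ι : Type} (S : Script P ι)

/-- The processors that have accepted the message of `s` for round `k` when they leave round `q`. -/
def receivers (s : Fin n) (k q : ℕ) : Finset (Fin n) :=
  Finset.univ.filter fun p => S.views.sees (S.cell p) q (S.cell s) k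

theorem receivers_mono (s : Fin n) (k : ℕ) : Monotone (S.receivers s k) := by
  intro q q' hq p hp
  simp only [receivers, Finset.mem_filter, Finset.mem_univ, true_and] at hp ⊢
  exact S.views.mono hq hp

theorem receivers_eq_empty {s : Fin n} {k q : ℕ} (h : q < k) : S.receivers s k q = ∅ := by
  refine Finset.filter_eq_empty_iff.2 fun p _ hp => ?_
  have := S.views.bounds hp
  omega

variable [Fintype ι]

/-- The distribution of the message that a processor of cell `g` draws when it leaves round `q`. -/
def dist (g : ι) (q : ℕ) : PMF P.Msg :=
  if q = 0 then P.first (S.bit g) else P.next q (S.views.viewContent S.cont g q)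

/-- The decision of the processors of cell `h` in round `q`. -/
def decision (h : ι) : ℕ → Option Bool
  | 0 => none
  | q + 1 => if q = 0 then none else
      decision h q <|> P.decide q (S.views.viewContent S.cont h q)

/-- The messages in the script are possible ones. -/
structure Consistent : Prop where
  card_cont : ∀ g q, (S.cont g (q + 1)).card = (Finset.univ.filter fun s => S.cell s = g).card
  mem_cont : ∀ g q m, m ∈ S.cont g (q + 1) → m ∈ (S.dist g q).support

/-! ### Configurations that follow a script -/

/-- The configuration `C` follows the script `S` in phase `q`, in which the processors leave round
`q`. The message of `s` for round `k` is `msg s k`, and `pos s k` is the progress of instance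
`(s, k)`. -/
structure Follows (F : Finset (Fin n))
    (plan : ∀ s k m, P.bc.Plan s k m (S.receivers s k)) (q : ℕ) (C : P.Config)
    (msg : Fin n → ℕ → P.Msg) (pos : Fin n → ℕ → ℕ) : Prop where
  round : ∀ p, (C.proc p).round = q ∨ (C.proc p).round = q + 1
  inst : ∀ s k, 1 ≤ k → k ≤ (C.proc s).round → C.instAt s k = (plan s k (msg s k)).st (pos s k)
  fresh : ∀ s k, k = 0 ∨ (C.proc s).round < k → C.instAt s k = ⟨P.bc.initLocal s k, 0⟩
  log : ∀ p, LogConsistent (C.proc p)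
  pos_le : ∀ s k, pos s k ≤ (plan s k (msg s k)).cut q
  -- Round-`q` instances advance only after all older ones have reached their cuts. Hence a
  -- processor that has enough round-`q` messages has everything older as well.
  order : ∀ s, 0 < pos s q → ∀ s' k, k < q → pos s' k = (plan s' k (msg s' k)).cut q
  content : ∀ g k, 1 ≤ k → k ≤ q → cellContent S.cell msg g k = S.cont g k
  support : ∀ s k, k < (C.proc s).round → msg s (k + 1) ∈ (S.dist (S.cell s) k).support
  decision : ∀ p, p ∉ F → (C.proc p).decision = S.decision (S.cell p) (C.proc p).round
  depth : DepthConsistent C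

namespace Follows

variable {S : Script P ι} {F : Finset (Fin n)}
  {plan : ∀ s k m, P.bc.Plan s k m (S.receivers s k)} {q : ℕ} {C : P.Config}
  {msg : Fin n → ℕ → P.Msg} {pos : Fin n → ℕ → ℕ}

theorem le_round (hC : S.Follows F plan q C msg pos) (p : Fin n) : q ≤ (C.proc p).round := by
  rcases hC.round p with h | h <;> omega

theorem accepted (hC : S.Follows F plan q C msg pos) {p s : Fin n} {k : ℕ} {m : P.Msg}
    (h : ((C.proc p).inst s k).accepted = some m) :
    S.views.sees (S.cell p) q (S.cell s) k ∧ m = msg s k ∧ 0 < pos s k := by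
  have h' : ((C.instAt s k).loc p).accepted = some m := h
  by_cases hk : k = 0 ∨ (C.proc s).round < k
  · rw [hC.fresh s k hk] at h'
    simp [initLocal] at h'
  · push Not at hk
    rw [hC.inst s k (by omega) hk.2] at h'
    obtain ⟨h1, h2⟩ := (plan s k (msg s k)).of_accepted (hC.pos_le s k) h'
    refine ⟨by simpa [receivers] using h1, h2, Nat.pos_of_ne_zero fun h0 => ?_⟩
    rw [h0] at h'
    have h3 := ((plan s k (msg s k)).of_accepted (q := 0) (Nat.zero_le _) h').1
    have := S.views.bounds (Finset.mem_filter.1 h3).2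
    omega

theorem log_subset (hC : S.Follows F plan q C msg pos) (p : Fin n) :
    (C.proc p).log.toFinset ⊆ S.views.viewSet msg (S.cell p) q := by
  rintro ⟨s, k, m⟩ hx
  rw [List.mem_toFinset, hC.log] at hx
  obtain ⟨h1, h2, -⟩ := hC.accepted hx
  exact S.views.mem_viewSet.2 ⟨h1, h2⟩

theorem accepted_of_pos_eq (hC : S.Follows F plan q C msg pos) {p s : Fin n} {k : ℕ}
    (hs : S.views.sees (S.cell p) q (S.cell s) k) (hpos : pos s k = (plan s k (msg s k)).cut q) :
    ((C.proc p).inst s k).accepted = some (msg s k) := by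
  have hb := S.views.bounds hs
  change ((C.instAt s k).loc p).accepted = _
  rw [hC.inst s k hb.1 (hb.2.trans (hC.le_round s)), hpos, Plan.accepted_cut, if_pos]
  simpa [receivers] using hs

theorem bare_viewSet (hC : S.Follows F plan q C msg pos) (h : ι) {k : ℕ} (hk : k ≤ q) :
    bare (S.views.viewSet msg h k) = S.views.viewContent S.cont h k := by
  rw [Views.bare_viewSet]
  refine S.views.viewContent_congr fun g j hj => ?_
  have := S.views.bounds hj
  exact hC.content g j this.1 (this.2.trans hk)

/-- By good message completeness all messages in a view are validated. -/
theorem validate_viewSet (hC : S.Follows F plan q C msg pos) (hP : P.GoodMessageComplete) (h : ι) :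
    P.validate (S.views.viewSet msg h q) = S.views.viewSet msg h q := by
  refine (P.validate_subset _).antisymm ?_
  suffices key : ∀ k s, S.views.sees h q (S.cell s) k →
      (s, k, msg s k) ∈ P.validate (S.views.viewSet msg h q) by
    rintro ⟨s, k, m⟩ hx
    obtain ⟨h1, h2⟩ := S.views.mem_viewSet.1 hx
    simp only at h1 h2
    rw [h2]
    exact key k s h1
  intro k
  induction k using Nat.strong_induction_on with
  | _ k ih =>
    intro s hs
    have hb := S.views.bounds hs
    -- The sets that certify the messages of `s` are the views of its own cell. Causality puts them
    -- into the present view, where the induction hypothesis validates their members, all of smaller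
    -- round.
    refine hP k (msg s) (fun i => S.views.viewSet msg (S.cell s) i) s _ hb.1 ?_ ?_ ?_ ?_
    · refine ⟨S.bit (S.cell s), ?_⟩
      simpa [dist] using hC.support s 0 (by have := hC.le_round s; omega)
    · intro i hi hik
      refine ⟨?_, ?_, S.views.card_ofRound_viewSet msg _ hi, ?_⟩
      · rintro ⟨s', k', m'⟩ hx
        obtain ⟨h1, h2⟩ := S.views.mem_viewSet.1 hx
        simp only at h1 h2
        rw [h2]
        have hb' := S.views.bounds h1
        exact ih k' (by omega) s' (S.views.causal (S.views.of_le hs (by omega) hik) h1)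
      · intro x hx
        exact (S.views.bounds (S.views.mem_viewSet.1 hx).1).2
      · have := hC.support s i (by have := hC.le_round s; omega)
        rwa [dist, if_neg (by omega), ← hC.bare_viewSet _ (by omega)] at this
    · intro i _ _ x hx
      obtain ⟨h1, h2⟩ := S.views.mem_viewSet.1 hx
      exact S.views.mem_viewSet.2 ⟨S.views.succ h1, h2⟩
    · intro i hi hik
      exact S.views.mem_viewSet.2 ⟨S.views.of_le hs hi hik, rfl⟩

/-- `p` has accepted exactly what it is meant to see in phase `q`. -/
def Complete (S : Script P ι) (q : ℕ) (C : P.Config) (msg : Fin n → ℕ → P.Msg) (p : Fin n) :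
    Prop :=
  q = 0 ∨ (C.proc p).log.toFinset = S.views.viewSet msg (S.cell p) q

theorem complete_of_pos_eq (hC : S.Follows F plan q C msg pos)
    (hpos : ∀ s k, k ≤ q → pos s k = (plan s k (msg s k)).cut q) (p : Fin n) :
    Complete S q C msg p := by
  refine .inr ((hC.log_subset p).antisymm ?_)
  rintro ⟨s, k, m⟩ hx
  obtain ⟨h1, h2⟩ := S.views.mem_viewSet.1 hx
  simp only at h1 h2
  rw [List.mem_toFinset, hC.log, h2]
  exact hC.accepted_of_pos_eq h1 (hpos s k (S.views.bounds h1).2)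

theorem ready_of_complete (hC : S.Follows F plan q C msg pos) (hP : P.GoodMessageComplete)
    {p : Fin n} (hp : (C.proc p).round = q) (hc : Complete S q C msg p) : P.Ready (C.proc p) := by
  rcases Nat.eq_zero_or_pos q with h0 | h0
  · exact .inl (by rw [hp, h0])
  · rcases hc with h | h
    · omega
    right
    rw [hp, h, hC.validate_viewSet hP, S.views.card_ofRound_viewSet _ _ h0]

/-- A view holds exactly `n - t` messages of round `q`, so a ready processor has accepted all of
them. One such acceptance shows that a round-`q` instance has advanced, and then `order` supplies
the older messages. -/
theorem complete_of_ready (hC : S.Follows F plan q C msg pos) (hnt : 0 < n - t)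
    {p : Fin n} (hp : (C.proc p).round = q) (hr : P.Ready (C.proc p)) :
    Complete S q C msg p := by
  rcases Nat.eq_zero_or_pos q with h0 | h0
  · exact .inl h0
  rcases hr with hr | hr
  · omega
  rw [hp] at hr
  have hsub : ofRound q (P.validate (C.proc p).log.toFinset) ⊆
      ofRound q (S.views.viewSet msg (S.cell p) q) :=
    Finset.filter_subset_filter _ ((P.validate_subset _).trans (hC.log_subset p))
  have heq := Finset.eq_of_subset_of_card_le hsub
    (by rw [S.views.card_ofRound_viewSet _ _ h0]; exact hr)
  have hlog : ofRound q (S.views.viewSet msg (S.cell p) q) ⊆ (C.proc p).log.toFinset := by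
    rw [← heq]
    exact (Finset.filter_subset _ _).trans (P.validate_subset _)
  have hne : (ofRound q (S.views.viewSet msg (S.cell p) q)).Nonempty := by
    rw [← Finset.card_pos, S.views.card_ofRound_viewSet _ _ h0]
    exact hnt
  have hpos : ∃ s, 0 < pos s q := by
    obtain ⟨⟨s, k, m⟩, hx⟩ := hne
    have hk : k = q := (Finset.mem_filter.1 hx).2
    subst hk
    have := hlog hx
    rw [List.mem_toFinset, hC.log] at this
    exact ⟨s, (hC.accepted this).2.2⟩
  obtain ⟨s₀, hs₀⟩ := hpos
  refine .inr ((hC.log_subset p).antisymm ?_)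
  rintro ⟨s, k, m⟩ hx
  by_cases hk : k = q
  · exact hlog (Finset.mem_filter.2 ⟨hx, hk⟩)
  · obtain ⟨h1, h2⟩ := S.views.mem_viewSet.1 hx
    simp only at h1 h2
    have hb := S.views.bounds h1
    rw [List.mem_toFinset, hC.log, h2]
    exact hC.accepted_of_pos_eq h1 (hC.order s₀ hs₀ s k (by omega))

/-- During phase `q` no view contains a message of round `q + 1`. -/
theorem not_ready_of_round_succ (hC : S.Follows F plan q C msg pos) (hnt : 0 < n - t)
    {p : Fin n} (hp : (C.proc p).round = q + 1) : ¬ P.Ready (C.proc p) := by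
  rintro (h | h)
  · omega
  · have : ofRound (C.proc p).round (P.validate (C.proc p).log.toFinset) = ∅ := by
      refine Finset.filter_eq_empty_iff.2 fun x hx hxr => ?_
      have h1 := hC.log_subset p (P.validate_subset _ hx)
      have := (S.views.bounds (S.views.mem_viewSet.1 h1).1).2
      omega
    rw [this] at h
    simp at h
    omega

/-- With exactly `n - t` messages of round `q` available, the rule `select` has no freedom. -/
theorem used_eq (hC : S.Follows F plan q C msg pos) (hP : P.GoodMessageComplete)
    {p : Fin n} (hp : (C.proc p).round = q) (hq : 0 < q) (hc : Complete S q C msg p) :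
    P.used (C.proc p) = S.views.viewSet msg (S.cell p) q := by
  rcases hc with h | h
  · omega
  have hcard := S.views.card_ofRound_viewSet msg (S.cell p) hq
  have hsel := P.select_spec q (C.proc p).log
    (by rw [h, hC.validate_viewSet hP, hcard])
  rw [h, hC.validate_viewSet hP] at hsel
  have hsel' := Finset.eq_of_subset_of_card_le hsel.1 (by rw [hsel.2, hcard])
  rw [used, hp, hsel', h, hC.validate_viewSet hP]
  ext x
  simp only [ofRound, beforeRound, Finset.mem_union, Finset.mem_filter, ← and_or_left]
  refine ⟨fun hx => hx.1, fun hx => ⟨hx, ?_⟩⟩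
  have := (S.views.bounds (S.views.mem_viewSet.1 hx).1).2
  omega

theorem nextMessage_eq (hC : S.Follows F plan q C msg pos) (hP : P.GoodMessageComplete)
    {p : Fin n} (hp : (C.proc p).round = q) (hc : Complete S q C msg p) :
    P.nextMessage (S.bit (S.cell p)) (C.proc p) = S.dist (S.cell p) q := by
  rw [nextMessage, dist, hp]
  split_ifs with h0
  · rfl
  · rw [hC.used_eq hP hp (by omega) hc, hC.bare_viewSet _ le_rfl]

theorem nextDecision_eq (hC : S.Follows F plan q C msg pos) (hP : P.GoodMessageComplete)
    {p : Fin n} (hpF : p ∉ F) (hp : (C.proc p).round = q) (hc : Complete S q C msg p) :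
    P.nextDecision (C.proc p) = S.decision (S.cell p) (q + 1) := by
  rw [nextDecision, Script.decision, hC.decision p hpF, hp]
  split_ifs with h0
  · subst h0; rfl
  · rw [hC.used_eq hP hp (by omega) hc, hC.bare_viewSet _ le_rfl]

/-- As `n - t ≥ 2`, a message of round `q` from another sender has been accepted, and that takes a
chain of length at least `q`. -/
theorem le_depth (hC : S.Follows F plan q C msg pos) (hnt : 2 ≤ n - t)
    {p : Fin n} (hc : Complete S q C msg p) : q ≤ C.depth p := by
  rcases Nat.eq_zero_or_pos q with h0 | h0
  · omega
  rcases hc with h | h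
  · omega
  have hcard := S.views.card (S.cell p) q h0
  obtain ⟨s, hs, hsp⟩ := Finset.exists_mem_ne (by rw [hcard]; omega) p
  have hmem : (s, q, msg s q) ∈ (C.proc p).log := by
    rw [← List.mem_toFinset, h]
    exact S.views.mem_viewSet.2 ⟨by simpa using hs, rfl⟩
  rw [hC.log] at hmem
  exact hC.depth.accepted p s q hsp (by rw [hmem]; simp)

/-! ### Steps -/

theorem receive_round (C : P.Config) (x : P.Packet) (p : Fin n) :
    ((C.receive x).proc p).round = (C.proc p).round := by
  by_cases hp : p = x.dst
  · subst hp; simp [Config.receive, Config.put, feed]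
  · simp [Config.receive, Config.put, Config.take, hp]

theorem receive_decision (C : P.Config) (x : P.Packet) (p : Fin n) :
    ((C.receive x).proc p).decision = (C.proc p).decision := by
  by_cases hp : p = x.dst
  · subst hp; simp [Config.receive, Config.put, feed]
  · simp [Config.receive, Config.put, Config.take, hp]

/-- Progress in an instance: the next packet of its plan can be received. -/
theorem exists_receive (hC : S.Follows F plan q C msg pos) {s : Fin n} {k : ℕ} (hk : 1 ≤ k)
    (hkq : k ≤ q) (hlt : pos s k < (plan s k (msg s k)).cut q)
    (hord : k = q → ∀ s' k', k' < q → pos s' k' = (plan s' k' (msg s' k')).cut q) :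
    ∃ x ∈ C.buffer, S.Follows F plan q (C.receive x) msg
      (Function.update pos s (Function.update (pos s) k (pos s k + 1))) := by
  obtain ⟨y, hy, hst⟩ := (plan s k (msg s k)).step q (pos s k) hlt
  have hinst := hC.inst s k hk (hkq.trans (hC.le_round s))
  rw [← hinst] at hy
  obtain ⟨x, hx, rfl⟩ := Multiset.mem_map.1 hy
  obtain ⟨hxb, hxs, hxk⟩ := Multiset.mem_filter.1 hx
  have hpos : ∀ s' k', ¬ (s' = s ∧ k' = k) →
      Function.update pos s (Function.update (pos s) k (pos s k + 1)) s' k' = pos s' k' := by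
    intro s' k' hne
    by_cases hs : s' = s
    · subst hs
      have : k' ≠ k := fun h => hne ⟨rfl, h⟩
      simp [this]
    · simp [hs]
  have hpos' : Function.update pos s (Function.update (pos s) k (pos s k + 1)) s k =
      pos s k + 1 := by simp
  refine ⟨x, hxb, ?_⟩
  refine ⟨fun p => ?_, fun s' k' h1 h2 => ?_, fun s' k' h1 => ?_, fun p => ?_, fun s' k' => ?_,
    fun s' h1 s'' k'' h2 => ?_, hC.content, fun s' k' h1 => ?_, fun p hp => ?_,
    hC.depth.receive hxb⟩
  · rw [receive_round]
    exact hC.round p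
  · rw [receive_round] at h2
    by_cases hne : s' = s ∧ k' = k
    · obtain ⟨rfl, rfl⟩ := hne
      rw [hpos', hst, ← hinst]
      subst hxs hxk
      exact instAt_receive C hxb
    · rw [hpos _ _ hne, instAt_receive_of_ne C hxb (by rwa [hxs, hxk]), hC.inst s' k' h1 h2]
  · rw [receive_round] at h1
    rw [instAt_receive_of_ne C hxb, hC.fresh s' k' h1]
    rintro ⟨h2, h3⟩
    rw [hxs] at h2
    rw [hxk] at h3
    subst h2 h3
    have := hC.le_round s'
    omega
  · by_cases hp : p = x.dst
    · subst hp
      simp only [Config.receive, Config.put, Function.update_self]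
      exact (hC.log x.dst).feed _ _ _ _
    · simpa [Config.receive, Config.put, Config.take, hp] using hC.log p
  · by_cases hne : s' = s ∧ k' = k
    · obtain ⟨rfl, rfl⟩ := hne
      rw [hpos']
      exact hlt
    · rw [hpos _ _ hne]
      exact hC.pos_le s' k'
  · by_cases hkq' : k = q
    · rw [hpos _ _ (by omega)]
      exact hord hkq' s'' k'' h2
    · rw [hpos _ _ (by omega)] at h1
      by_cases hne : s'' = s ∧ k'' = k
      · obtain ⟨rfl, rfl⟩ := hne
        have := hC.order s' h1 s'' k'' h2
        omega
      · rw [hpos _ _ hne]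
        exact hC.order s' h1 s'' k'' h2
  · rw [receive_round] at h1
    exact hC.support s' k' h1
  · rw [receive_round, receive_decision]
    exact hC.decision p hp

/-- A processor that has seen all it is meant to see enters its next round. -/
theorem enter (hC : S.Follows F plan q C msg pos) (hP : P.GoodMessageComplete) (hnt : 2 ≤ n - t)
    {p : Fin n} (hp : (C.proc p).round = q) (hc : Complete S q C msg p) {m : P.Msg}
    (hm : m ∈ (S.dist (S.cell p) q).support) :
    S.Follows F plan q (C.enter p m)
      (Function.update msg p (Function.update (msg p) (q + 1) m)) pos := by
  set msg' := Function.update msg p (Function.update (msg p) (q + 1) m) with hmsg'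
  have hmsg : ∀ s k, ¬ (s = p ∧ k = q + 1) → msg' s k = msg s k := by
    intro s k hne
    by_cases hs : s = p
    · subst hs
      have : k ≠ q + 1 := fun h => hne ⟨rfl, h⟩
      simp [hmsg', this]
    · simp [hmsg', hs]
  have hmsg2 : msg' p (q + 1) = m := by simp [hmsg']
  have hround : ∀ r, r ≠ p → ((C.enter p m).proc r).round = (C.proc r).round := by
    intro r hr
    simp [Config.enter, Config.put, hr]
  have hround' : ((C.enter p m).proc p).round = q + 1 := by
    simp [Config.enter, Config.put, enterRound_round, hp]
  have hcut : ∀ s, (plan s (q + 1) (msg s (q + 1))).cut q = 0 :=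
    fun s => (plan _ _ _).cut_empty q (S.receivers_eq_empty (by omega))
  have hpos0 : pos p (q + 1) = 0 := by
    have := hC.pos_le p (q + 1)
    rw [hcut] at this
    omega
  refine ⟨fun r => ?_, fun s k h1 h2 => ?_, fun s k h1 => ?_, fun r => ?_, fun s k => ?_,
    fun s h1 s' k h2 => ?_, fun g k h1 h2 => ?_, fun s k h1 => ?_, fun r hr => ?_,
    hC.depth.enter (by rw [hp]; exact hC.le_depth hnt hc) m⟩
  · by_cases hr : r = p
    · rw [hr, hround']; exact .inr rfl
    · rw [hround r hr]; exact hC.round r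
  · by_cases hne : s = p ∧ k = q + 1
    · obtain ⟨rfl, rfl⟩ := hne
      rw [hpos0, hmsg2, Plan.st_zero]
      have := instAt_enter C s m
      rw [hp, hC.fresh s (q + 1) (.inr (by omega))] at this
      exact this
    · rw [hmsg _ _ hne, instAt_enter_of_ne C p m (by rwa [hp])]
      refine hC.inst s k h1 ?_
      by_cases hs : s = p
      · subst hs
        rw [hround'] at h2
        have : k ≠ q + 1 := fun h => hne ⟨rfl, h⟩
        omega
      · rwa [hround s hs] at h2
  · have hne : ¬ (s = p ∧ k = q + 1) := by
      rintro ⟨rfl, rfl⟩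
      rw [hround'] at h1
      omega
    rw [instAt_enter_of_ne C p m (by rwa [hp])]
    refine hC.fresh s k ?_
    by_cases hs : s = p
    · subst hs
      rw [hround'] at h1
      omega
    · rwa [hround s hs] at h1
  · by_cases hr : r = p
    · subst hr
      simp only [Config.enter, Config.put, Function.update_self, enterRound]
      exact LogConsistent.feed (fun s k m => hC.log r s k m) _ _ _ _
    · simpa [Config.enter, Config.put, hr] using hC.log r
  · by_cases hne : s = p ∧ k = q + 1
    · obtain ⟨rfl, rfl⟩ := hne
      rw [hpos0]
      exact Nat.zero_le _
    · rw [hmsg _ _ hne]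
      exact hC.pos_le s k
  · rw [hmsg _ _ (by omega)]
    exact hC.order s h1 s' k h2
  · rw [← hC.content g k h1 h2]
    refine Multiset.map_congr rfl fun s _ => hmsg _ _ (by omega)
  · by_cases hne : s = p ∧ k + 1 = q + 1
    · obtain ⟨rfl, h⟩ := hne
      obtain rfl : k = q := by omega
      rw [hmsg2]
      exact hm
    · rw [hmsg _ _ hne]
      refine hC.support s k ?_
      by_cases hs : s = p
      · subst hs
        rw [hround'] at h1
        have : k + 1 ≠ q + 1 := fun h => hne ⟨rfl, h⟩
        omega
      · rwa [hround s hs] at h1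
  · by_cases hrp : r = p
    · subst hrp
      rw [hround', ← hC.nextDecision_eq hP hr hp hc]
      simp [Config.enter, Config.put, enterRound, feed]
    · rw [hround r hrp]
      simpa [Config.enter, Config.put, hrp] using hC.decision r hr

/-- Only the contents of the new round need checking. The condition `order` is vacuous at first,
since no instance of round `q + 1` has advanced. -/
theorem next_phase (hC : S.Follows F plan q C msg pos) (hr : ∀ p, (C.proc p).round = q + 1)
    (hcont : ∀ g, cellContent S.cell msg g (q + 1) = S.cont g (q + 1)) :
    S.Follows F plan (q + 1) C msg pos := by
  refine ⟨fun p => .inl (hr p), hC.inst, hC.fresh, hC.log, fun s k => (hC.pos_le s k).trans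
    ((plan _ _ _).cut_mono (by omega)), fun s h1 => ?_, fun g k h1 h2 => ?_, hC.support,
    hC.decision, hC.depth⟩
  · have := hC.pos_le s (q + 1)
    rw [(plan _ _ _).cut_empty q (S.receivers_eq_empty (by omega))] at this
    omega
  · rcases Nat.lt_or_ge q k with h | h
    · obtain rfl : k = q + 1 := by omega
      exact hcont g
    · exact hC.content g k h1 h

end Follows

theorem follows_init (S : Script P ι) (F : Finset (Fin n))
    (plan : ∀ s k m, P.bc.Plan s k m (S.receivers s k)) (msg : Fin n → ℕ → P.Msg) :
    S.Follows F plan 0 P.initConfig msg (fun _ _ => 0) := by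
  refine ⟨fun p => .inl rfl, fun s k h1 h2 => ?_, fun s k _ => ?_, fun p s k m => ?_,
    fun s k => Nat.zero_le _, fun s h => absurd h (by simp), fun g k h1 h2 => by omega,
    fun s k h => ?_, fun p _ => rfl, ⟨fun p => by simp [initConfig], fun x hx => ?_,
      fun p s k _ h => ?_⟩⟩
  · simp [initConfig] at h2
    omega
  · simp [Config.instAt, initConfig]
  · simp [initConfig, initLocal]
  · simp [initConfig] at h
  · simp [initConfig] at hx
  · simp [initConfig, initLocal] at h

end Script

theorem RoundProtocol.Forces.mono {n t : ℕ} {P : RoundProtocol n t} {b : Fin n → Bool}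
    {F : Finset (Fin n)} {Q : P.Config → Prop} {C : P.Config} {ε ε' : ENNReal}
    (h : P.Forces b F Q C ε) (hε : ε ≤ ε') : P.Forces b F Q C ε' := by
  obtain ⟨s, hs, hf⟩ := h
  exact ⟨s, hs, hf.trans hε⟩

theorem RoundProtocol.Forces.imp {n t : ℕ} {P : RoundProtocol n t} {b : Fin n → Bool}
    {F : Finset (Fin n)} {Q Q' : P.Config → Prop} {C : P.Config} {ε : ENNReal}
    (h : P.Forces b F Q C ε) (hQ : ∀ C, Q C → Q' C) : P.Forces b F Q' C ε := by
  obtain ⟨s, hs, hf⟩ := h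
  refine ⟨s, hs, le_trans ?_ hf⟩
  clear hs hf
  induction s generalizing C with
  | halt =>
    simp only [Strategy.failProb]
    by_cases h : Q C
    · simp [h, hQ C h]
    · rw [if_neg h]
      split_ifs <;> simp
  | act a next ih =>
    simp only [Strategy.failProb]
    by_cases h : Q C
    · simp [h, hQ C h]
    · rw [if_neg h]
      split_ifs
      · exact zero_le
      · exact ENNReal.tsum_le_tsum fun C' => mul_le_mul_right (ih C') _

theorem exists_map_val_eq {α β : Type*} [Nonempty β] (A : Finset α) :
    ∀ M : Multiset β, M.card = A.card → ∃ f : α → β, A.val.map f = M := by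
  induction A using Finset.induction_on with
  | empty =>
    intro M hM
    rw [Finset.card_empty, Multiset.card_eq_zero] at hM
    exact ⟨fun _ => Classical.arbitrary β, by simp [hM]⟩
  | insert a A ha ih =>
    intro M hM
    rw [Finset.card_insert_of_notMem ha] at hM
    obtain ⟨y, hy⟩ := Multiset.card_pos_iff_exists_mem.1 (show 0 < M.card by omega)
    obtain ⟨M', rfl⟩ := Multiset.exists_cons_of_mem hy
    obtain ⟨f, hf⟩ := ih M' (by simpa using hM)
    refine ⟨Function.update f a y, ?_⟩
    rw [Finset.insert_val_of_notMem ha, Multiset.map_cons, Function.update_self, ← hf]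
    congr 1
    refine Multiset.map_congr rfl fun x hx => ?_
    rw [Function.update_of_ne]
    rintro rfl
    exact ha hx

/-- The moment generating function, at `log X`, of the indicator of `m` under `ν`. -/
def indicatorMGF {M : Type} (X : ENNReal) (ν : PMF M) (m : M) : ENNReal :=
  ∑' m', ν m' * if m' = m then X else 1

namespace Script

open RoundProtocol BroadcastProtocol

variable {n t : ℕ} {P : RoundProtocol n t} {ι : Type} [Fintype ι]

/-! ### The potential -/

/-- Bound for the conditional probability that in phase `q` some message is drawn more often in its
cell than the script allows, when the processors in `A` have drawn and those in `B` have not. -/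
def potential (S : Script P ι) (hfin : ∀ g q, (S.dist g q).support.Finite) (X : ENNReal) (q : ℕ)
    (A B : Finset (Fin n)) (msg : Fin n → ℕ → P.Msg) : ENNReal :=
  ∑ g, ∑ m ∈ (hfin g q).toFinset,
    X ^ (A.filter fun p => S.cell p = g ∧ msg p (q + 1) = m).card *
      (indicatorMGF X (S.dist g q) m ^ (B.filter fun p => S.cell p = g).card *
        (X ^ ((S.cont g (q + 1)).count m + 1))⁻¹)

/-- The potential is a martingale: a draw by `p` replaces one factor `indicatorMGF` by the random
variable of which it is the expectation. -/
theorem tsum_potential (S : Script P ι) (hfin : ∀ g q, (S.dist g q).support.Finite) (X : ENNReal)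
    (q : ℕ) {A B : Finset (Fin n)} (msg : Fin n → ℕ → P.Msg) {p : Fin n} (hpA : p ∉ A)
    (hpB : p ∈ B) :
    ∑' m, S.dist (S.cell p) q m * S.potential hfin X q (insert p A) (B.erase p)
      (Function.update msg p (Function.update (msg p) (q + 1) m)) =
      S.potential hfin X q A B msg := by
  have hA : ∀ g m m', (((insert p A).filter fun r => S.cell r = g ∧
      Function.update msg p (Function.update (msg p) (q + 1) m) r (q + 1) = m').card) =
      (A.filter fun r => S.cell r = g ∧ msg r (q + 1) = m').card +
        if S.cell p = g ∧ m = m' then 1 else 0 := by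
    intro g m m'
    have hfilt : (A.filter fun r => S.cell r = g ∧
        Function.update msg p (Function.update (msg p) (q + 1) m) r (q + 1) = m') =
        A.filter fun r => S.cell r = g ∧ msg r (q + 1) = m' := by
      refine Finset.filter_congr fun r hr => ?_
      have : r ≠ p := fun h => hpA (h ▸ hr)
      simp [this]
    rw [Finset.filter_insert]
    simp only [Function.update_self]
    split_ifs with h
    · rw [Finset.card_insert_of_notMem, hfilt]
      exact fun h' => hpA (Finset.mem_filter.1 h').1
    · rw [hfilt, add_zero]
  have hB : ∀ g, (B.filter fun r => S.cell r = g).card =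
      ((B.erase p).filter fun r => S.cell r = g).card + if S.cell p = g then 1 else 0 := by
    intro g
    rw [← Finset.insert_erase hpB, Finset.filter_insert, Finset.erase_insert (Finset.notMem_erase _ _)]
    split_ifs with h
    · rw [Finset.card_insert_of_notMem]
      exact fun h' => Finset.notMem_erase _ _ (Finset.mem_filter.1 h').1
    · rw [add_zero]
  simp only [potential, hA, hB, Finset.mul_sum]
  rw [Summable.tsum_finsetSum fun _ _ => ENNReal.summable]
  refine Finset.sum_congr rfl fun g _ => ?_
  rw [Summable.tsum_finsetSum fun _ _ => ENNReal.summable]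
  refine Finset.sum_congr rfl fun m' _ => ?_
  by_cases hg : S.cell p = g
  · subst hg
    simp only [true_and, if_true]
    set a := X ^ (A.filter fun r => S.cell r = S.cell p ∧ msg r (q + 1) = m').card
    set c := ((B.erase p).filter fun r => S.cell r = S.cell p).card
    set w := (X ^ ((S.cont (S.cell p) (q + 1)).count m' + 1))⁻¹
    set μ := indicatorMGF X (S.dist (S.cell p) q) m' with hμ
    have : ∀ m, S.dist (S.cell p) q m * (X ^ ((A.filter fun r => S.cell r = S.cell p ∧
        msg r (q + 1) = m').card + if m = m' then 1 else 0) * (μ ^ c * w)) =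
        (S.dist (S.cell p) q m * if m = m' then X else 1) * (a * (μ ^ c * w)) := by
      intro m
      rw [pow_add]
      split_ifs <;> ring
    simp_rw [this]
    rw [ENNReal.tsum_mul_right, ← indicatorMGF, ← hμ]
    ring
  · simp only [hg, false_and, if_false, add_zero]
    rw [ENNReal.tsum_mul_right, PMF.tsum_coe, one_mul]

/-- When nobody is left to draw, an outcome exceeding its allotted count by itself contributes a
summand at least `1`. -/
theorem card_le_count_of_potential_lt_one (S : Script P ι)
    (hfin : ∀ g q, (S.dist g q).support.Finite) {X : ENNReal} (hX : 1 ≤ X) (hX' : X ≠ ⊤) {q : ℕ}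
    {A : Finset (Fin n)} {msg : Fin n → ℕ → P.Msg} (h : S.potential hfin X q A ∅ msg < 1) {g : ι}
    {m : P.Msg} (hm : m ∈ (S.dist g q).support) :
    (A.filter fun p => S.cell p = g ∧ msg p (q + 1) = m).card ≤ (S.cont g (q + 1)).count m := by
  by_contra! hlt
  refine absurd h (not_lt.2 ?_)
  refine le_trans ?_ (Finset.single_le_sum (fun _ _ => zero_le) (Finset.mem_univ g))
  refine le_trans ?_ (Finset.single_le_sum (fun _ _ => zero_le) ((hfin g q).mem_toFinset.2 hm))
  rw [Finset.filter_empty, Finset.card_empty, pow_zero, one_mul]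
  have h0 : X ^ ((S.cont g (q + 1)).count m + 1) ≠ 0 :=
    pow_ne_zero _ (zero_lt_one.trans_le hX).ne'
  rw [← ENNReal.mul_inv_cancel h0 (ENNReal.pow_ne_top hX')]
  gcongr
  exact hlt

/-! ### Forcing a script -/

section Forcing

variable {S : Script P ι} {F : Finset (Fin n)}
  {plan : ∀ s k m, P.bc.Plan s k m (S.receivers s k)} {q : ℕ} {C : P.Config}
  {msg : Fin n → ℕ → P.Msg} {pos : Fin n → ℕ → ℕ} {Q : P.Config → Prop} {ε : ENNReal}
  {b : Fin n → Bool}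

/-- The good processors in round `q`. -/
def goodIn (F : Finset (Fin n)) (C : P.Config) (q : ℕ) : Finset (Fin n) :=
  Finset.univ.filter fun p => p ∉ F ∧ (C.proc p).round = q

theorem mem_goodIn {p : Fin n} : p ∈ goodIn F C q ↔ p ∉ F ∧ (C.proc p).round = q := by
  simp [goodIn]

/-- A faulty receiver imitates the protocol, so packets can be delivered to it in the same way, and
without regard to readiness. -/
theorem forces_of_receive {x : P.Packet} (hx : x ∈ C.buffer)
    (hr : x.dst ∉ F → ¬ P.Ready (C.proc x.dst)) (h : P.Forces b F Q (C.receive x) ε) :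
    P.Forces b F Q C ε := by
  by_cases hF : x.dst ∈ F
  · refine Forces.of_pure (a := .byz x.dst (some x) _ _) ⟨hF, ?_⟩ rfl h
    rintro _ ⟨rfl⟩
    exact ⟨hx, rfl⟩
  · refine Forces.of_pure (a := .step x.dst (some x)) ⟨hF, ?_⟩ rfl h
    rintro _ ⟨rfl⟩
    exact ⟨hx, rfl, hr hF⟩

theorem goodIn_enter {p : Fin n} (hpF : p ∉ F) (hp : (C.proc p).round = q) (m : P.Msg) :
    goodIn F (C.enter p m) (q + 1) = insert p (goodIn F C (q + 1)) ∧
      goodIn F (C.enter p m) q = (goodIn F C q).erase p := by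
  constructor <;> ext r <;> simp only [Finset.mem_insert, Finset.mem_erase, mem_goodIn] <;>
    by_cases hr : r = p
  · subst hr
    simp [Config.enter, Config.put, enterRound_round, hpF, hp]
  · simp [Config.enter, Config.put, hr]
  · subst hr
    simp [Config.enter, Config.put, enterRound_round, hp]
  · simp [Config.enter, Config.put, hr]

/-- One phase for the good processors, by induction on the number of pending deliveries plus the
number of good processors still in round `q`. The potential bounds the probability of an overdraw,
and `ε` covers what follows. -/
theorem forces_good (hP : P.GoodMessageComplete) (hnt : 2 ≤ n - t)
    (hfin : ∀ g q, (S.dist g q).support.Finite) (X : ENNReal)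
    (hb : ∀ p, b p = S.bit (S.cell p))
    (next : ∀ C msg pos, S.Follows F plan q C msg pos →
      (∀ s k, k ≤ q → pos s k = (plan s k (msg s k)).cut q) →
      (∀ p, p ∉ F → (C.proc p).round = q + 1) → (∀ p ∈ F, (C.proc p).round = q) →
      S.potential hfin X q (goodIn F C (q + 1)) ∅ msg < 1 → P.Forces b F Q C ε) :
    ∀ (N : ℕ) (C : P.Config) (msg : Fin n → ℕ → P.Msg) (pos : Fin n → ℕ → ℕ),
      S.Follows F plan q C msg pos → (∀ p ∈ F, (C.proc p).round = q) →
      (∑ s, ∑ k ∈ Finset.range (q + 1), ((plan s k (msg s k)).cut q - pos s k)) +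
        (goodIn F C q).card = N →
      P.Forces b F Q C
        (S.potential hfin X q (goodIn F C (q + 1)) (goodIn F C q) msg + ε) := by
  intro N
  induction N using Nat.strong_induction_on with
  | _ N ih =>
    intro C msg pos hC hF hN
    -- Ready processors go first, as the model demands. Having completed their views, they draw from
    -- the distribution of the script.
    by_cases hready : ∃ p, p ∉ F ∧ P.Ready (C.proc p)
    · obtain ⟨p, hpF, hr⟩ := hready
      have hp : (C.proc p).round = q := by
        rcases hC.round p with h | h
        · exact h
        · exact absurd hr (hC.not_ready_of_round_succ (by omega) h)
      have hc := hC.complete_of_ready (by omega) hp hr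
      have hdist : P.nextMessage (b p) (C.proc p) = S.dist (S.cell p) q := by
        rw [hb]
        exact hC.nextMessage_eq hP hp hc
      have hpB : p ∈ goodIn F C q := by simp [goodIn, hpF, hp]
      have hpA : p ∉ goodIn F C (q + 1) := by simp [goodIn, hp]
      refine Forces.of_enter hpF hr
        (fun m => S.potential hfin X q (insert p (goodIn F C (q + 1))) ((goodIn F C q).erase p)
          (Function.update msg p (Function.update (msg p) (q + 1) m)) + ε)
        (by rw [hdist]; exact hfin _ _) ?_ ?_
      · intro m hm
        rw [hdist] at hm
        obtain ⟨h1, h2⟩ := goodIn_enter hpF hp m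
        rw [← h1, ← h2]
        refine ih _ ?_ (C.enter p m) _ pos (hC.enter hP hnt hp hc hm) ?_ rfl
        · rw [h2, ← hN, Finset.card_erase_of_mem hpB]
          have hpos := Finset.card_pos.2 ⟨p, hpB⟩
          have hsum : (∑ s, ∑ k ∈ Finset.range (q + 1), ((plan s k
              (Function.update msg p (Function.update (msg p) (q + 1) m) s k)).cut q - pos s k)) =
              ∑ s, ∑ k ∈ Finset.range (q + 1), ((plan s k (msg s k)).cut q - pos s k) := by
            refine Finset.sum_congr rfl fun s _ => Finset.sum_congr rfl fun k hk => ?_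
            rw [Finset.mem_range] at hk
            have : Function.update msg p (Function.update (msg p) (q + 1) m) s k = msg s k := by
              by_cases hs : s = p
              · subst hs
                simp [show k ≠ q + 1 by omega]
              · simp [hs]
            rw [this]
          rw [hsum]
          omega
        · intro r hrF
          have : r ≠ p := fun h => hpF (h ▸ hrF)
          simpa [Config.enter, Config.put, this] using hF r hrF
      · rw [hdist]
        simp_rw [mul_add]
        rw [ENNReal.tsum_add, tsum_potential S hfin X q msg hpA hpB, ENNReal.tsum_mul_right,
          PMF.tsum_coe, one_mul]
    push Not at hready
    by_cases hwork : ∃ s k, k ≤ q ∧ pos s k < (plan s k (msg s k)).cut q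
    · have hone : ∀ s k, pos s k < (plan s k (msg s k)).cut q → 1 ≤ k := by
        intro s k hlt
        by_contra h0
        obtain rfl : k = 0 := by omega
        rw [(plan s 0 (msg s 0)).cut_empty q] at hlt
        · omega
        · refine Finset.filter_eq_empty_iff.2 fun p _ hp => ?_
          have := S.views.bounds hp
          omega
      have hpick : ∃ s k, 1 ≤ k ∧ k ≤ q ∧ pos s k < (plan s k (msg s k)).cut q ∧
          (k = q → ∀ s' k', k' < q → pos s' k' = (plan s' k' (msg s' k')).cut q) := by
        -- Older rounds are delivered before round `q`, to preserve `order`.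
        by_cases hold : ∃ s k, k < q ∧ pos s k < (plan s k (msg s k)).cut q
        · obtain ⟨s, k, hk, hlt⟩ := hold
          exact ⟨s, k, hone s k hlt, hk.le, hlt, fun h => by omega⟩
        · push Not at hold
          obtain ⟨s, k, hk, hlt⟩ := hwork
          exact ⟨s, k, hone s k hlt, hk, hlt, fun _ s' k' hk' =>
            (hC.pos_le s' k').antisymm (hold s' k' hk')⟩
      obtain ⟨s, k, hk1, hkq, hlt, hord⟩ := hpick
      obtain ⟨x, hx, hfol⟩ := hC.exists_receive hk1 hkq hlt hord
      refine forces_of_receive hx (fun h => hready _ h) ?_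
      have hgood : ∀ r, goodIn F (C.receive x) r = goodIn F C r := by
        intro r
        ext p
        simp [goodIn, Follows.receive_round]
      have hres := ih _ ?_ (C.receive x) msg _ hfol
        (fun p hp => by rw [Follows.receive_round]; exact hF p hp) rfl
      · rwa [hgood, hgood] at hres
      · rw [hgood, ← hN]
        refine Nat.add_lt_add_right ?_ _
        refine Finset.sum_lt_sum (fun s' _ => Finset.sum_le_sum fun k' _ => ?_)
          ⟨s, Finset.mem_univ _, Finset.sum_lt_sum (fun k' _ => ?_)
            ⟨k, Finset.mem_range.2 (by omega), ?_⟩⟩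
        · refine Nat.sub_le_sub_left ?_ _
          by_cases hs : s' = s
          · subst hs
            by_cases hk : k' = k
            · subst hk; simp
            · simp [hk]
          · simp [hs]
        · refine Nat.sub_le_sub_left ?_ _
          by_cases hk : k' = k
          · subst hk; simp
          · simp [hk]
        · simp only [Function.update_self]
          omega
    · push Not at hwork
      have hpos : ∀ s k, k ≤ q → pos s k = (plan s k (msg s k)).cut q :=
        fun s k hk => (hC.pos_le s k).antisymm (hwork s k hk)
      have hround : ∀ p, p ∉ F → (C.proc p).round = q + 1 := by
        intro p hp
        rcases hC.round p with h | h
        · exact absurd (hC.ready_of_complete hP h (hC.complete_of_pos_eq hpos p)) (hready p hp)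
        · exact h
      have hempty : goodIn F C q = ∅ := by
        refine Finset.filter_eq_empty_iff.2 fun p _ hp => ?_
        have := hround p hp.1
        omega
      rw [hempty]
      -- If the potential has reached `1`, the claimed bound is trivial. Otherwise no outcome has
      -- been overdrawn and the phase can be completed.
      by_cases hlt : S.potential hfin X q (goodIn F C (q + 1)) ∅ msg < 1
      · exact (next C msg pos hC hpos hround hF hlt).mono le_add_self
      · exact Forces.of_one_le ((not_lt.1 hlt).trans le_self_add)

/-- The faulty processors enter the round one after another, following the protocol except that
their draws are prescribed possible outcomes `a`. This part involves no randomness. -/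
theorem forces_faulty (hP : P.GoodMessageComplete) (hnt : 2 ≤ n - t) (a : Fin n → P.Msg)
    (ha : ∀ p ∈ F, a p ∈ (S.dist (S.cell p) q).support) :
    ∀ (l : List (Fin n)) (C : P.Config) (msg : Fin n → ℕ → P.Msg), l.Nodup → (∀ p ∈ l, p ∈ F) →
      S.Follows F plan q C msg pos →
      (∀ s k, k ≤ q → pos s k = (plan s k (msg s k)).cut q) →
      (∀ p, p ∉ l → (C.proc p).round = q + 1) → (∀ p ∈ l, (C.proc p).round = q) →
      (∀ C' msg', S.Follows F plan q C' msg' pos → (∀ p, (C'.proc p).round = q + 1) →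
        (∀ p, msg' p (q + 1) = if p ∈ l then a p else msg p (q + 1)) → P.Forces b F Q C' ε) →
      P.Forces b F Q C ε := by
  intro l
  induction l with
  | nil =>
    intro C msg _ _ hC _ hr _ h
    exact h C msg hC (fun p => hr p (by simp)) (by simp)
  | cons p l ih =>
    intro C msg hnd hlF hC hpos hr hr' h
    have hp := hr' p (by simp)
    have hpl := (List.nodup_cons.1 hnd).1
    have hpF := hlF p (by simp)
    refine Forces.of_pure (a := .byz p none (P.enterRound p (C.proc p) (a p)).1
      (P.enterRound p (C.proc p) (a p)).2) ⟨hpF, by simp⟩ rfl ?_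
    change P.Forces b F Q (C.enter p (a p)) ε
    have hround : ∀ r, r ≠ p → ((C.enter p (a p)).proc r).round = (C.proc r).round := by
      intro r hr
      simp [Config.enter, Config.put, hr]
    refine ih (C.enter p (a p)) _ (List.nodup_cons.1 hnd).2 (fun r hr => hlF r (by simp [hr]))
      (hC.enter hP hnt hp (hC.complete_of_pos_eq hpos p) (ha p hpF)) ?_ ?_ ?_ ?_
    · intro s k hk
      rw [hpos s k hk]
      have : Function.update msg p (Function.update (msg p) (q + 1) (a p)) s k = msg s k := by
        by_cases hs : s = p
        · subst hs
          simp [show k ≠ q + 1 by omega]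
        · simp [hs]
      rw [this]
    · intro r hrl
      by_cases hrp : r = p
      · subst hrp
        simp [Config.enter, Config.put, enterRound_round, hp]
      · rw [hround r hrp]
        exact hr r (by simp [hrp, hrl])
    · intro r hrl
      rw [hround r (fun h => hpl (h ▸ hrl))]
      exact hr' r (by simp [hrl])
    · intro C' msg' h1 h2 h3
      refine h C' msg' h1 h2 fun r => ?_
      rw [h3 r]
      by_cases hrp : r = p
      · subst hrp
        simp [hpl]
      · simp [hrp]

/-- The faulty processors can complete the messages of the good ones to what the script says. -/
theorem exists_completion (hS : S.Consistent) {msg : Fin n → ℕ → P.Msg}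
    (hsupp : ∀ p, p ∉ F → msg p (q + 1) ∈ (S.dist (S.cell p) q).support)
    (hcount : ∀ g, ∀ m ∈ (S.dist g q).support,
      ((Finset.univ.filter fun p => p ∉ F).filter
        fun p => S.cell p = g ∧ msg p (q + 1) = m).card ≤ (S.cont g (q + 1)).count m) :
    ∃ a : Fin n → P.Msg, (∀ p ∈ F, a p ∈ (S.dist (S.cell p) q).support) ∧
      ∀ msg' : Fin n → ℕ → P.Msg,
        (∀ p, msg' p (q + 1) = if p ∈ F then a p else msg p (q + 1)) →
        ∀ g, cellContent S.cell msg' g (q + 1) = S.cont g (q + 1) := by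
  have hne : Nonempty P.Msg := ⟨(P.first true).support_nonempty.some⟩
  set good : ι → Finset (Fin n) := fun g => Finset.univ.filter fun p => S.cell p = g ∧ p ∉ F
  set bad : ι → Finset (Fin n) := fun g => Finset.univ.filter fun p => S.cell p = g ∧ p ∈ F
  have hval : ∀ g, (Finset.univ.filter fun p => S.cell p = g).val = (good g).val + (bad g).val := by
    intro g
    have hdisj : Disjoint (good g) (bad g) := by
      rw [Finset.disjoint_left]
      intro p hp hp'
      simp only [good, bad, Finset.mem_filter] at hp hp'
      exact hp.2.2 hp'.2.2
    rw [← Finset.disjUnion_val (good g) (bad g) hdisj]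
    congr 1
    ext p
    rw [Finset.mem_disjUnion]
    simp only [good, bad, Finset.mem_filter, Finset.mem_univ, true_and]
    tauto
  have hle : ∀ g, (good g).val.map (fun p => msg p (q + 1)) ≤ S.cont g (q + 1) := by
    intro g
    rw [Multiset.le_iff_count]
    intro m
    rw [Multiset.count_map]
    by_cases hm : m ∈ (S.dist g q).support
    · refine le_trans (le_of_eq ?_) (hcount g m hm)
      rw [← Finset.filter_val, Finset.card_val, Finset.filter_filter, Finset.filter_filter]
      congr 1
      ext p
      simp only [Finset.mem_filter, Finset.mem_univ, true_and, eq_comm (a := m)]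
      tauto
    · rw [Multiset.filter_eq_nil.2]
      · simp
      · intro p hp hpm
        have hp' : S.cell p = g ∧ p ∉ F := by simpa [good] using hp
        have := hsupp p hp'.2
        rw [hp'.1, ← hpm] at this
        exact hm this
  have hex : ∀ g, ∃ f : Fin n → P.Msg, (bad g).val.map f =
      S.cont g (q + 1) - (good g).val.map (fun p => msg p (q + 1)) := by
    intro g
    refine exists_map_val_eq _ _ ?_
    rw [Multiset.card_sub (hle g), hS.card_cont, Multiset.card_map, Finset.card_def, hval,
      Multiset.card_add, Finset.card_def]
    omega
  choose f hf using hex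
  refine ⟨fun p => f (S.cell p) p, fun p hp => ?_, fun msg' hmsg' g => ?_⟩
  · refine hS.mem_cont _ _ _ (Multiset.mem_of_le (Multiset.sub_le_self _ _)
      ((hf (S.cell p)).symm ▸ Multiset.mem_map_of_mem (f (S.cell p)) ?_))
    simp [bad, hp]
  · rw [cellContent, hval, Multiset.map_add,
      ← Multiset.add_sub_cancel (hle g), ← hf g,
      add_comm (Multiset.map _ (bad g).val)]
    congr 1
    · refine Multiset.map_congr rfl fun p hp => ?_
      have hp' : S.cell p = g ∧ p ∉ F := by simpa [good] using hp
      rw [hmsg', if_neg hp'.2]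
    · refine Multiset.map_congr rfl fun p hp => ?_
      have hp' : S.cell p = g ∧ p ∈ F := by simpa [bad] using hp
      rw [hmsg', if_pos hp'.2]
      simp only [hp'.1]

/-- A union bound over rounds: each phase costs at most `η`, the initial value of its potential. -/
theorem forces_rounds (hP : P.GoodMessageComplete) (hnt : 2 ≤ n - t) (hS : S.Consistent)
    (hfin : ∀ g q, (S.dist g q).support.Finite) {X : ENNReal} (hX : 1 ≤ X) (hX' : X ≠ ⊤)
    (hb : ∀ p, b p = S.bit (S.cell p)) {η : ENNReal} {L : ℕ}
    (hη : ∀ q msg, S.potential hfin X q ∅ (Finset.univ.filter fun p => p ∉ F) msg ≤ η) :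
    ∀ (d q : ℕ) (C : P.Config) (msg : Fin n → ℕ → P.Msg) (pos : Fin n → ℕ → ℕ), q + d = L →
      S.Follows F plan q C msg pos → (∀ p, (C.proc p).round = q) →
      P.Forces b F (fun C => ∃ msg pos, S.Follows F plan L C msg pos ∧
        ∀ p, (C.proc p).round = L) C (d * η) := by
  intro d
  induction d with
  | zero =>
    intro q C msg pos hq hC hr
    obtain rfl : q = L := by omega
    exact Forces.of_mem ⟨msg, pos, hC, hr⟩
  | succ d ih =>
    intro q C msg pos hq hC hr
    have h1 : goodIn F C (q + 1) = ∅ := by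
      refine Finset.filter_eq_empty_iff.2 fun p _ hp => ?_
      have := hr p
      omega
    have h2 : goodIn F C q = Finset.univ.filter fun p => p ∉ F := by
      ext p
      simp [goodIn, hr]
    refine Forces.mono (forces_good hP hnt hfin X hb (ε := d * η) ?_ _ C msg pos hC
      (fun p _ => hr p) rfl) ?_
    · intro C msg pos hC hpos hgood hfaulty hlt
      have hA : goodIn F C (q + 1) = Finset.univ.filter fun p => p ∉ F := by
        ext p
        simp only [goodIn, Finset.mem_filter, Finset.mem_univ, true_and, and_iff_left_iff_imp]
        exact hgood p
      rw [hA] at hlt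
      obtain ⟨a, ha, hcont⟩ := exists_completion (F := F) (q := q) hS (msg := msg)
        (fun p hp => hC.support p q (by rw [hgood p hp]; omega))
        (fun g m hm => card_le_count_of_potential_lt_one S hfin hX hX' hlt hm)
      refine forces_faulty hP hnt a ha F.toList C msg F.nodup_toList (by simp) hC hpos
        (fun p hp => hgood p (by simpa using hp)) (fun p hp => hfaulty p (by simpa using hp)) ?_
      intro C' msg' hC' hr' hmsg'
      refine ih (q + 1) C' msg' pos (by omega) (hC'.next_phase hr' (hcont msg' ?_)) hr'
      intro p
      simpa using hmsg' p
    · rw [h1, h2]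
      push_cast
      rw [add_mul, one_mul, add_comm]
      exact add_le_add_right (hη q msg) _

end Forcing

/-- A script can be enforced up to round `L`, except with small probability. -/
theorem forces (S : Script P ι) {F : Finset (Fin n)} {b : Fin n → Bool}
    (hB : P.bc.ArbitraryReceiverOrder)
    (hP : P.GoodMessageComplete) (hnt : 2 ≤ n - t) (hS : S.Consistent)
    (hfin : ∀ g q, (S.dist g q).support.Finite) {X : ENNReal} (hX : 1 ≤ X) (hX' : X ≠ ⊤)
    (hb : ∀ p, b p = S.bit (S.cell p)) {η : ENNReal} (L : ℕ)
    (hη : ∀ q msg, S.potential hfin X q ∅ (Finset.univ.filter fun p => p ∉ F) msg ≤ η) :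
    P.Forces b F (fun C => (∀ p, (C.proc p).round = L) ∧ (∀ p, L ≤ C.depth p + 1) ∧
      ∀ p, p ∉ F → (C.proc p).decision = S.decision (S.cell p) L) P.initConfig (L * η) := by
  let plan : ∀ s k m, P.bc.Plan s k m (S.receivers s k) := fun s k m =>
    (hB.nonempty_plan (by omega) s k m (S.receivers_mono s k)).some
  have hne : Nonempty P.Msg := ⟨(P.first true).support_nonempty.some⟩
  refine (forces_rounds (plan := plan) hP hnt hS hfin hX hX' hb (L := L) hη L 0
    P.initConfig (fun _ _ => Classical.arbitrary _) _ (by omega) (follows_init S F plan _)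
    (fun p => rfl)).imp ?_
  rintro C ⟨msg, pos, hC, hr⟩
  refine ⟨hr, fun p => ?_, fun p hp => ?_⟩
  · have := hC.depth.round_le p
    rwa [hr] at this
  · rw [hC.decision p hp, hr]

end Script

/-! ### Plays -/

/-- A play prescribes for every round and every cell a pair `(i, k)`: the processors of the cell are
to leave the round without the messages of the silent set of `i` for rounds `k` and later. -/
abbrev Play (ι : Type) : Type := ℕ → ι → ι × ℕ

namespace Play

variable {ι : Type}

/-- Before round `m`, whatever is withheld from some cell has been withheld from all cells since the
round given by the second component. -/
def LegitBefore (m : ℕ) (ρ : Play ι) : Prop :=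
  ∀ q h, 1 ≤ q → q < m → 1 ≤ (ρ q h).2 ∧ (ρ q h).2 ≤ q ∧
    ∀ q', (ρ q h).2 ≤ q' → q' < q → ∀ h', ρ q' h' = ρ q h

def Legit (ρ : Play ι) : Prop := ∀ m, ρ.LegitBefore m

/-- From round `l` on, the silent set of `i` is ignored. -/
def silence (l : ℕ) (ρ : Play ι) (i : ι) : Play ι := fun q h => if q < l then ρ q h else (i, l)

theorem silence_of_lt {l : ℕ} {ρ : Play ι} {i : ι} {q : ℕ} (hq : q < l) (h : ι) :
    ρ.silence l i q h = ρ q h := if_pos hq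

theorem silence_of_le {l : ℕ} {ρ : Play ι} {i : ι} {q : ℕ} (hq : l ≤ q) (h : ι) :
    ρ.silence l i q h = (i, l) := if_neg (by omega)

theorem LegitBefore.silence {l : ℕ} {ρ : Play ι} (hρ : ρ.LegitBefore l) (hl : 1 ≤ l) (i : ι) :
    (ρ.silence l i).Legit := by
  intro m q h hq _
  rcases Nat.lt_or_ge q l with hql | hql
  · rw [silence_of_lt hql]
    obtain ⟨h1, h2, h3⟩ := hρ q h hq hql
    refine ⟨h1, h2, fun q' h4 h5 h' => ?_⟩
    rw [silence_of_lt (by omega)]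
    exact h3 q' h4 h5 h'
  · rw [silence_of_le hql]
    refine ⟨hl, hql, fun q' h4 h5 h' => ?_⟩
    rw [silence_of_le h4]

/-- Two plays agree except for the choice of cell `h` in round `l - 1` (its input if `l = 1`), and
from round `l` on everybody ignores the silent set of `h`. -/
structure Adjacent (bit bit' : ι → Bool) (ρ ρ' : Play ι) (h : ι) (l : ℕ) : Prop where
  pos : 1 ≤ l
  bit_eq : ∀ g, 1 < l ∨ g ≠ h → bit g = bit' g
  row_eq : ∀ r g, 1 ≤ r → r + 1 < l ∨ g ≠ h ∨ l ≤ r → ρ r g = ρ' r g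
  silent : ∀ r g, l ≤ r → ρ r g = (h, l)

/-! ### Invariance of the outcome along chains of adjacent plays. -/

section Constant

variable {val : (ι → Bool) → Play ι → Bool} {L : ℕ}

/-- Row `l` is changed one cell at a time. By `hU` the set silenced from round `l + 1` on may be
switched freely, so before each change it is made that of the cell about to change, which turns the
change into an adjacency. -/
theorem val_congr_of_adjacent_chain [Fintype ι]
    (hadj : ∀ bit bit' ρ ρ' h l, ρ.Legit → ρ'.Legit → Adjacent bit bit' ρ ρ' h l →
      val bit ρ = val bit' ρ') (bit : ι → Bool) {l : ℕ} (hl : 1 ≤ l)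
    (hU : ∀ ρ : Play ι, ρ.LegitBefore (l + 1) → ∀ i j,
      val bit (ρ.silence (l + 1) i) = val bit (ρ.silence (l + 1) j))
    {ρ ρ' : Play ι} (hρ : ρ.LegitBefore (l + 1)) (hρ' : ρ'.LegitBefore (l + 1))
    (heq : ∀ q < l, ∀ g, ρ q g = ρ' q g) (i j : ι) :
    val bit (ρ.silence (l + 1) i) = val bit (ρ'.silence (l + 1) j) := by
  -- The cells in `A` have already been switched from `ρ` to `ρ'`.
  let mix : Finset ι → Play ι := fun A q g => if g ∈ A then ρ' q g else ρ q g
  have hmixlt : ∀ A q, q < l → ∀ g, mix A q g = ρ q g := by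
    intro A q hq g
    simp only [mix]
    split_ifs
    · exact (heq q hq g).symm
    · rfl
  have hmix : ∀ A, (mix A).LegitBefore (l + 1) := by
    intro A q h hq hql
    have key : ∀ τ : Play ι, τ.LegitBefore (l + 1) → (∀ q < l, ∀ g, τ q g = ρ q g) →
        1 ≤ (τ q h).2 ∧ (τ q h).2 ≤ q ∧
          ∀ q', (τ q h).2 ≤ q' → q' < q → ∀ h', mix A q' h' = τ q h := by
      intro τ hτ hτ'
      obtain ⟨h1, h2, h3⟩ := hτ q h hq hql
      refine ⟨h1, h2, fun q' h4 h5 h' => ?_⟩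
      rw [hmixlt A q' (by omega), ← hτ' q' (by omega)]
      exact h3 q' h4 h5 h'
    by_cases hA : h ∈ A
    · have : mix A q h = ρ' q h := if_pos hA
      rw [this]
      exact key ρ' hρ' fun q hq g => (heq q hq g).symm
    · have : mix A q h = ρ q h := if_neg hA
      rw [this]
      exact key ρ hρ fun q hq g => rfl
  have hchain : ∀ A : Finset ι,
      val bit ((mix A).silence (l + 1) i) = val bit (ρ.silence (l + 1) i) := by
    intro A
    induction A using Finset.induction_on with
    | empty =>
      have : mix ∅ = ρ := by
        funext q g
        simp [mix]
      rw [this]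
    | insert h A hA ih =>
      -- Silence `h` on both sides; the plays then differ only in the choice of `h` in round `l`.
      rw [← ih, hU _ (hmix _) i h, hU _ (hmix A) i h]
      refine hadj bit bit _ _ h (l + 1) ((hmix _).silence (by omega) _)
        ((hmix _).silence (by omega) _) ⟨by omega, fun _ _ => rfl, fun r g _ hr => ?_,
          fun r g hr => silence_of_le hr _⟩
      rcases Nat.lt_or_ge r (l + 1) with hrl | hrl
      · rw [silence_of_lt hrl, silence_of_lt hrl]
        rcases hr with hr | hr | hr
        · rw [hmixlt _ _ (by omega), hmixlt _ _ (by omega)]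
        · simp [mix, hr]
        · omega
      · rw [silence_of_le hrl, silence_of_le hrl]
  have huniv : mix Finset.univ = ρ' := by
    funext q g
    simp [mix]
  rw [← hchain Finset.univ, huniv, hU _ hρ' i j]

/-- If the outcome depends only on the first `L` rounds and is the same for adjacent plays, then it
does not depend on whom one silences, and silencing may be interrupted. -/
theorem val_silence [Fintype ι]
    (hadj : ∀ bit bit' ρ ρ' h l, ρ.Legit → ρ'.Legit → Adjacent bit bit' ρ ρ' h l →
      val bit ρ = val bit' ρ')
    (hL : ∀ bit (ρ ρ' : Play ι), ρ.Legit → ρ'.Legit → (∀ q < L, ∀ g, ρ q g = ρ' q g) →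
      val bit ρ = val bit ρ') (bit : ι → Bool) :
    ∀ d l, 1 ≤ l → L ≤ l + d → ∀ ρ : Play ι, ρ.LegitBefore l →
      (∀ i, val bit (ρ.silence l i) = val bit ((ρ.silence l i).silence (l + 1) i)) ∧
      ∀ i j, val bit (ρ.silence l i) = val bit (ρ.silence l j) := by
  intro d
  induction d with
  | zero =>
    intro l hl hLl ρ hρ
    refine ⟨fun i => hL _ _ _ (hρ.silence hl i)
      ((hρ.silence hl i (l + 1)).silence (by omega) i) fun q hq g => ?_,
      fun i j => hL _ _ _ (hρ.silence hl i) (hρ.silence hl j) fun q hq g => ?_⟩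
    · rw [silence_of_lt (l := l + 1) (by omega)]
    · rw [silence_of_lt (by omega), silence_of_lt (by omega)]
  | succ d ih =>
    intro l hl hLl ρ hρ
    -- Releasing the withheld round-`l` messages at the end of round `l + 1` is shown to be harmless
    -- by delaying the release round by round, until it lies beyond the horizon `L`.
    have hinterrupt : ∀ i,
        val bit (ρ.silence l i) = val bit ((ρ.silence l i).silence (l + 1) i) := by
      intro i
      set z := ρ.silence l i with hz
      have hzl : z.Legit := hρ.silence hl i
      have hstep : ∀ m, l + 1 ≤ m →
          val bit (z.silence (l + 1) i) = val bit (z.silence m i) := by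
        intro m hm
        induction m, hm using Nat.le_induction with
        | base => rfl
        | succ m hm ihm =>
          -- Going from `m` to `m + 1`: silence from `m` on may be interrupted by induction, after
          -- which the two plays differ only in row `m`.
          rw [ihm, (ih m (by omega) (by omega) z (hzl m)).1 i]
          have hz' : (z.silence m i).Legit := (hzl m).silence (by omega) i
          exact val_congr_of_adjacent_chain hadj bit (by omega)
            (fun ρ hρ => (ih (m + 1) (by omega) (by omega) ρ hρ).2) (hz' _) (hzl _)
            (fun q hq g => silence_of_lt hq g) i i
      rw [hstep (l + 1 + L) (by omega)]
      refine hL _ _ _ hzl ((hzl _).silence (by omega) i) fun q hq g => ?_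
      rw [silence_of_lt (by omega)]
    refine ⟨hinterrupt, fun i j => ?_⟩
    -- After the interruption the two plays differ only in row `l`, with a fresh silence from `l +
    -- 1` on.
    rw [hinterrupt i, hinterrupt j]
    exact val_congr_of_adjacent_chain hadj bit hl
      (fun ρ hρ => (ih (l + 1) (by omega) (by omega) ρ hρ).2) (hρ.silence hl i _)
      (hρ.silence hl j _) (fun q hq g => by rw [silence_of_lt hq, silence_of_lt hq]) i j

/-- The outcome is the same for all-zero and all-one inputs. -/
theorem exists_val_eq [Fintype ι] [Nonempty ι]
    (hadj : ∀ bit bit' ρ ρ' h l, ρ.Legit → ρ'.Legit → Adjacent bit bit' ρ ρ' h l →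
      val bit ρ = val bit' ρ')
    (hL : ∀ bit (ρ ρ' : Play ι), ρ.Legit → ρ'.Legit → (∀ q < L, ∀ g, ρ q g = ρ' q g) →
      val bit ρ = val bit ρ') :
    ∃ ρ : Play ι, ρ.Legit ∧ val (fun _ => false) ρ = val (fun _ => true) ρ := by
  let i₀ : ι := Classical.arbitrary ι
  let y : Play ι := fun _ _ => (i₀, 1)
  have hy : y.LegitBefore 1 := fun q h h1 h2 => by omega
  have hleg : ∀ i, (y.silence 1 i).Legit := fun i => hy.silence le_rfl i
  have hU : ∀ bit i j, val bit (y.silence 1 i) = val bit (y.silence 1 j) :=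
    fun bit => (val_silence hadj hL bit L 1 le_rfl (by omega) y hy).2
  refine ⟨y.silence 1 i₀, hleg i₀, ?_⟩
  have hchain : ∀ A : Finset ι, val (fun _ => false) (y.silence 1 i₀) =
      val (fun g => decide (g ∈ A)) (y.silence 1 i₀) := by
    intro A
    induction A using Finset.induction_on with
    | empty => simp
    | insert h A hA ih =>
      -- While the input of `h` is flipped, `h` is silent from the first round on.
      rw [ih, hU _ i₀ h, hU (fun g => decide (g ∈ insert h A)) i₀ h]
      refine hadj _ _ _ _ h 1 (hleg h) (hleg h) ⟨le_rfl, fun g hg => ?_, fun _ _ _ _ => rfl,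
        fun r g hr => silence_of_le hr _⟩
      rcases hg with hg | hg
      · omega
      · simp [hg]
  have := hchain Finset.univ
  simpa using this

end Constant

/-! ### Views and scripts of plays -/

section Views

variable {n t : ℕ} {cell : Fin n → ι} {D : ι → Finset ι}

/-- The views prescribed by a play. -/
def views (hD : ∀ i, (Finset.univ.filter fun s => cell s ∈ D i).card = t) {ρ : Play ι}
    (hρ : ρ.Legit) : Views n t cell where
  sees h q g k := 1 ≤ k ∧ k ≤ q ∧ ¬ (g ∈ D (ρ q h).1 ∧ (ρ q h).2 ≤ k)
  bounds h := ⟨h.1, h.2.1⟩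
  succ := by
    rintro h q g k ⟨h1, h2, h3⟩
    refine ⟨h1, by omega, fun ⟨h4, h5⟩ => h3 ?_⟩
    -- If a message of round at most `q` is withheld at `q + 1`, legitimacy says that it was already
    -- withheld at `q`.
    rw [(hρ _ (q + 1) h (by omega) (Nat.lt_succ_self _)).2.2 q (by omega) (by omega) h]
    exact ⟨h4, h5⟩
  card := by
    intro h q hq
    trans (Finset.univ.filter fun s => ¬ cell s ∈ D (ρ q h).1).card
    · congr 1
      ext s
      simp only [Finset.mem_filter, Finset.mem_univ, true_and]
      have := (hρ _ q h hq (Nat.lt_succ_self _)).2.1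
      tauto
    have h2 := Finset.card_filter_add_card_filter_not (s := (Finset.univ : Finset (Fin n)))
      (fun s => cell s ∈ D (ρ q h).1)
    rw [hD, Finset.card_univ, Fintype.card_fin] at h2
    omega
  pred := by
    rintro h q g k ⟨h1, h2, h3⟩ h4
    exact ⟨h4, by omega, fun ⟨h5, h6⟩ => h3 ⟨h5, by omega⟩⟩
  causal := by
    rintro h q g k g' k' ⟨h1, h2, h3⟩ ⟨h4, h5, h6⟩
    refine ⟨h4, by omega, fun ⟨h7, h8⟩ => h6 ?_⟩
    -- What is withheld from `h` now was equally withheld from the sender's cell `g` in round `k`,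
    -- so no visible message can reveal it.
    rw [(hρ _ q h (by omega) (Nat.lt_succ_self _)).2.2 k (by omega) (by omega) g]
    exact ⟨h7, h8⟩

end Views

end Play

/-! ### Scripts generated by plays, and their comparison. -/

section Contents

variable {n t : ℕ} {P : RoundProtocol n t} {ι : Type} [Fintype ι] {cell : Fin n → ι}

/-- The contents of the first `q` rounds, when cell `g` realizes a distribution `ν` by the multiset
`target g ν`. -/
def contentsUpTo (U : Views n t cell) (bit : ι → Bool) (target : ι → PMF P.Msg → Multiset P.Msg) :
    ℕ → ι → ℕ → Multiset P.Msg
  | 0 => fun _ _ => 0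
  | q + 1 => fun g k => if k = q + 1 then
      target g ((Script.mk cell bit U (contentsUpTo U bit target q)).dist g q)
    else contentsUpTo U bit target q g k

/-- The script in which cell `g` realizes a distribution `ν` by the multiset `target g ν`. -/
def scriptOf (U : Views n t cell) (bit : ι → Bool) (target : ι → PMF P.Msg → Multiset P.Msg) :
    Script P ι :=
  ⟨cell, bit, U, fun g k => contentsUpTo U bit target k g k⟩

variable (U : Views n t cell) (bit : ι → Bool) (target : ι → PMF P.Msg → Multiset P.Msg)

theorem contentsUpTo_of_le {q k : ℕ} (hk : k ≤ q) (g : ι) :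
    contentsUpTo U bit target q g k = contentsUpTo U bit target k g k := by
  induction q, hk using Nat.le_induction with
  | base => rfl
  | succ q hk ih =>
    simp only [contentsUpTo, if_neg (show ¬ k = q + 1 by omega), ih]

/-- The recursive equation of the script. Contents are built up by rounds, and the truncation is
invisible because a view at round `q` contains only rounds up to `q`. -/
theorem scriptOf_cont_succ (g : ι) (q : ℕ) :
    (scriptOf U bit target).cont g (q + 1) = target g ((scriptOf U bit target).dist g q) := by
  change contentsUpTo U bit target (q + 1) g (q + 1) = _
  simp only [contentsUpTo, if_true]
  congr 1
  simp only [Script.dist]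
  split_ifs
  · rfl
  · congr 1
    refine U.viewContent_congr fun g' k hk => ?_
    exact contentsUpTo_of_le U bit target (U.bounds hk).2 g'

end Contents

namespace Play

variable {n t : ℕ} {P : RoundProtocol n t} {ι : Type} [Fintype ι] {cell : Fin n → ι}
  {D : ι → Finset ι}

theorem viewContent_congr (hD : ∀ i, (Finset.univ.filter fun s => cell s ∈ D i).card = t)
    {ρ ρ' : Play ι} (hρ : ρ.Legit) (hρ' : ρ'.Legit) {cont cont' : ι → ℕ → Multiset P.Msg}
    {g : ι} {r : ℕ} (hr : ρ r g = ρ' r g)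
    (hc : ∀ g' k, (views hD hρ).sees g r g' k → cont g' k = cont' g' k) :
    (views hD hρ).viewContent cont g r = (views hD hρ').viewContent cont' g r := by
  rw [Views.viewContent_congr _ hc]
  refine Finset.sum_congr rfl fun k _ => Finset.sum_congr rfl fun g' _ => ?_
  have hiff : (views hD hρ).sees g r g' k ↔ (views hD hρ').sees g r g' k := by
    simp only [views, hr]
  by_cases hs : (views hD hρ).sees g r g' k
  · rw [if_pos hs, if_pos (hiff.1 hs)]
  · rw [if_neg hs, if_neg (hiff.not.1 hs)]

/-- For adjacent plays all cells but one see the same and decide alike. -/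
theorem Adjacent.decision_eq (hDself : ∀ i, i ∈ D i)
    (hD : ∀ i, (Finset.univ.filter fun s => cell s ∈ D i).card = t)
    (target : ι → PMF P.Msg → Multiset P.Msg)
    {bit bit' : ι → Bool} {ρ ρ' : Play ι} {h : ι} {l : ℕ} (hρ : ρ.Legit) (hρ' : ρ'.Legit)
    (hadj : Adjacent bit bit' ρ ρ' h l) {g : ι} (hg : g ≠ h) (q : ℕ) :
    (scriptOf (views hD hρ) bit target).decision g q =
      (scriptOf (views hD hρ') bit' target).decision g q := by
  set S := scriptOf (views hD hρ) bit target with hS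
  set S' := scriptOf (views hD hρ') bit' target with hS'
  have hview : ∀ r g, 1 ≤ r → ρ r g = ρ' r g →
      (∀ g k, k ≤ r → k < l ∨ g ≠ h → S.cont g k = S'.cont g k) →
      S.views.viewContent S.cont g r = S'.views.viewContent S'.cont g r := by
    intro r g _ hrow hc
    refine viewContent_congr hD hρ hρ' hrow fun g' k hk => hc g' k hk.2.1 ?_
    -- Only messages of `h` from round `l` on can differ, and these are withheld from everybody, as
    -- `h ∈ D h`.
    by_contra! hno
    have := hadj.silent r g (hno.1.trans hk.2.1)
    refine hk.2.2 ?_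
    rw [this, hno.2]
    exact ⟨hDself h, hno.1⟩
  -- The same `target` serves both plays, so equal distributions lead to equal contents.
  have hcont : ∀ r g k, k ≤ r → k < l ∨ g ≠ h → S.cont g k = S'.cont g k := by
    intro r
    induction r with
    | zero =>
      intro g k hk _
      obtain rfl : k = 0 := by omega
      rfl
    | succ r ih =>
      intro g k hk hgk
      rcases Nat.lt_or_ge k (r + 1) with hlt | hge
      · exact ih g k (by omega) hgk
      obtain rfl : k = r + 1 := by omega
      rw [hS, hS', scriptOf_cont_succ, scriptOf_cont_succ, ← hS, ← hS']
      congr 1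
      simp only [Script.dist]
      split_ifs with h0
      · subst h0
        change P.first (bit g) = P.first (bit' g)
        rw [hadj.bit_eq g (by simpa using hgk)]
      · rw [hview r g (by omega) (hadj.row_eq r g (by omega) (by tauto)) ih]
  induction q with
  | zero => rfl
  | succ q ih =>
    rw [Script.decision, Script.decision, ih]
    split_ifs with h0
    · rfl
    · rw [hview q g (by omega) (hadj.row_eq q g (by omega) (by tauto)) (hcont q)]

/-- On entry to round `L` a processor has used only views of rounds below `L`. -/
theorem decision_congr (hD : ∀ i, (Finset.univ.filter fun s => cell s ∈ D i).card = t)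
    (target : ι → PMF P.Msg → Multiset P.Msg)
    {bit : ι → Bool} {ρ ρ' : Play ι} {L : ℕ} (hρ : ρ.Legit) (hρ' : ρ'.Legit)
    (heq : ∀ q < L, ∀ g, ρ q g = ρ' q g) (g : ι) :
    (scriptOf (views hD hρ) bit target).decision g L =
      (scriptOf (views hD hρ') bit target).decision g L := by
  set S := scriptOf (views hD hρ) bit target with hS
  set S' := scriptOf (views hD hρ') bit target with hS'
  have hcont : ∀ r g k, r ≤ L → k ≤ r → S.cont g k = S'.cont g k := by
    intro r
    induction r with
    | zero =>
      intro g k _ hk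
      obtain rfl : k = 0 := by omega
      rfl
    | succ r ih =>
      intro g k hr hk
      rcases Nat.lt_or_ge k (r + 1) with hlt | hge
      · exact ih g k (by omega) (by omega)
      obtain rfl : k = r + 1 := by omega
      rw [hS, hS', scriptOf_cont_succ, scriptOf_cont_succ, ← hS, ← hS']
      congr 1
      simp only [Script.dist]
      split_ifs with h0
      · rfl
      · congr 1
        exact viewContent_congr hD hρ hρ' (heq r (by omega) g) fun g' k hk =>
          ih g' k (by omega) hk.2.1
  have hdec : ∀ q ≤ L, S.decision g q = S'.decision g q := by
    intro q
    induction q with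
    | zero => intro _; rfl
    | succ q ih =>
      intro hq
      rw [Script.decision, Script.decision, ih (by omega)]
      split_ifs with h0
      · rfl
      · have hv : S.views.viewContent S.cont g q = S'.views.viewContent S'.cont g q :=
          viewContent_congr hD hρ hρ' (heq q (by omega) g) fun g' k hk =>
            hcont q g' k (by omega) hk.2.1
        rw [hv]
  exact hdec L le_rfl

end Play

/-! ### Targets and tail bounds -/

/-- Rounding down the desired counts `d ν(m) + (w - d)/R` leaves a total of at most `w`, since there
are at most `R` outcomes. The deficit is filled with copies of one arbitrary possible outcome `m₀`.
-/
theorem exists_target {M : Type} (ν : PMF M) {R : ℕ} (hR : 0 < R) (hν : ν.support.encard ≤ R)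
    {w d : ℕ} (hd : d ≤ w) :
    ∃ T : Multiset M, T.card = w ∧ (∀ m ∈ T, m ∈ ν.support) ∧
      ∀ m ∈ ν.support, d * (ν m).toReal + ((w : ℝ) - d) / R < T.count m + 1 := by
  have hfin : ν.support.Finite := Set.finite_of_encard_le_coe hν
  set s := hfin.toFinset with hs
  have hcard : (s.card : ℝ) ≤ R := by
    rw [hfin.encard_eq_coe_toFinset_card] at hν
    exact_mod_cast hν
  have hsum : ∑ m ∈ s, (ν m).toReal = 1 := by
    rw [← ENNReal.toReal_sum fun m _ => ν.apply_ne_top m, ← ENNReal.toReal_one, ← ν.tsum_coe]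
    congr 1
    refine (tsum_eq_sum fun m hm => ?_).symm
    rw [PMF.apply_eq_zero_iff]
    simpa [hs] using hm
  have hd' : (0 : ℝ) ≤ (w : ℝ) - d := by
    rw [sub_nonneg]
    exact_mod_cast hd
  have hR' : (0 : ℝ) < R := by exact_mod_cast hR
  set c : M → ℕ := fun m => ⌊d * (ν m).toReal + ((w : ℝ) - d) / R⌋₊ with hc
  have hle : ∑ m ∈ s, c m ≤ w := by
    have h1 : (∑ m ∈ s, (c m : ℝ)) ≤ ∑ m ∈ s, (d * (ν m).toReal + ((w : ℝ) - d) / R) :=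
      Finset.sum_le_sum fun m _ => Nat.floor_le (by positivity)
    have h2 : ∑ m ∈ s, (d * (ν m).toReal + ((w : ℝ) - d) / R) ≤ w := by
      rw [Finset.sum_add_distrib, ← Finset.mul_sum, hsum, Finset.sum_const, nsmul_eq_mul, mul_one]
      have : s.card * (((w : ℝ) - d) / R) ≤ R * (((w : ℝ) - d) / R) := by gcongr
      rw [mul_div_cancel₀ _ hR'.ne'] at this
      linarith
    exact_mod_cast h1.trans h2
  obtain ⟨m₀, hm₀⟩ := ν.support_nonempty
  refine ⟨(∑ m ∈ s, Multiset.replicate (c m) m) +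
    Multiset.replicate (w - ∑ m ∈ s, c m) m₀, ?_, ?_, ?_⟩
  · rw [Multiset.card_add, Multiset.card_sum]
    simp only [Multiset.card_replicate]
    omega
  · intro m hm
    rcases Multiset.mem_add.1 hm with hm | hm
    · obtain ⟨m', hm', hmm⟩ := Multiset.mem_sum.1 hm
      obtain rfl := Multiset.eq_of_mem_replicate hmm
      simpa [hs] using hm'
    · rw [Multiset.eq_of_mem_replicate hm]
      exact hm₀
  · intro m hm
    refine (Nat.lt_floor_add_one _).trans_le ?_
    have : c m ≤ ((∑ m ∈ s, Multiset.replicate (c m) m) +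
        Multiset.replicate (w - ∑ m ∈ s, c m) m₀).count m := by
      rw [Multiset.count_add, Multiset.count_sum']
      refine le_add_right ?_
      have := Finset.single_le_sum (f := fun m' => (Multiset.replicate (c m') m').count m)
        (fun _ _ => Nat.zero_le _) (show m ∈ s by simpa [hs] using hm)
      simpa using this
    have : (c m : ℝ) ≤ _ := Nat.cast_le.2 this
    linarith

theorem indicatorMGF_le {M : Type} (ν : PMF M) (m : M) {x : ℝ} (hx : 0 ≤ x) :
    indicatorMGF (ENNReal.ofReal (Real.exp x)) ν m ≤
      ENNReal.ofReal (Real.exp ((ν m).toReal * (Real.exp x - 1))) := by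
  have h1 : (0 : ℝ) ≤ Real.exp x - 1 := by linarith [Real.add_one_le_exp x]
  have hX : ENNReal.ofReal (Real.exp x) = 1 + ENNReal.ofReal (Real.exp x - 1) := by
    rw [← ENNReal.ofReal_one, ← ENNReal.ofReal_add zero_le_one h1]
    congr 1
    ring
  have h2 : indicatorMGF (ENNReal.ofReal (Real.exp x)) ν m =
      1 + ν m * ENNReal.ofReal (Real.exp x - 1) := by
    have : ∀ m', (ν m' * if m' = m then ENNReal.ofReal (Real.exp x) else 1) =
        ν m' + if m' = m then ν m * ENNReal.ofReal (Real.exp x - 1) else 0 := by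
      intro m'
      split_ifs with h
      · subst h
        rw [hX, mul_add, mul_one]
      · simp
    rw [indicatorMGF]
    simp_rw [this]
    rw [ENNReal.tsum_add, ν.tsum_coe, tsum_ite_eq]
  rw [h2]
  nth_rw 1 [← ENNReal.ofReal_toReal (ν.apply_ne_top m)]
  rw [← ENNReal.ofReal_mul ENNReal.toReal_nonneg, ← ENNReal.ofReal_one,
    ← ENNReal.ofReal_add zero_le_one (by positivity)]
  refine ENNReal.ofReal_le_ofReal ?_
  linarith [Real.add_one_le_exp ((ν m).toReal * (Real.exp x - 1))]

/-- Chernoff: by `e^x - 1 ≤ x + x²`, the exponent is at most `d p (x + x²) - (d p + f) x ≤ n x² - 2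
x² n = -x² n`. -/
theorem tail_term_le {M : Type} (ν : PMF M) (m : M) {x : ℝ} (hx : 0 ≤ x) (hx1 : x ≤ 1)
    {d c n : ℕ} (hdn : d ≤ n) {f : ℝ} (hf : 2 * x * n ≤ f)
    (hc : d * (ν m).toReal + f < c + 1) :
    indicatorMGF (ENNReal.ofReal (Real.exp x)) ν m ^ d *
      (ENNReal.ofReal (Real.exp x) ^ (c + 1))⁻¹ ≤ ENNReal.ofReal (Real.exp (-(x ^ 2 * n))) := by
  set p := (ν m).toReal
  have hp0 : 0 ≤ p := ENNReal.toReal_nonneg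
  have hp1 : p ≤ 1 := by
    have := ENNReal.toReal_mono ENNReal.one_ne_top (ν.coe_le_one m)
    simpa using this
  have h1 : indicatorMGF (ENNReal.ofReal (Real.exp x)) ν m ^ d ≤
      ENNReal.ofReal (Real.exp (d * (p * (Real.exp x - 1)))) := by
    rw [Real.exp_nat_mul, ENNReal.ofReal_pow (Real.exp_pos _).le]
    exact pow_le_pow_left' (indicatorMGF_le ν m hx) d
  have h2 : (ENNReal.ofReal (Real.exp x) ^ (c + 1))⁻¹ =
      ENNReal.ofReal (Real.exp (-((c + 1 : ℕ) * x))) := by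
    rw [Real.exp_neg, Real.exp_nat_mul, ENNReal.ofReal_inv_of_pos (by positivity),
      ENNReal.ofReal_pow (Real.exp_pos _).le]
  rw [h2]
  refine (mul_le_mul_left h1 _).trans ?_
  rw [← ENNReal.ofReal_mul (Real.exp_pos _).le, ← Real.exp_add]
  refine ENNReal.ofReal_le_ofReal (Real.exp_le_exp.2 ?_)
  have h3 : Real.exp x - 1 ≤ x + x ^ 2 := by
    have := Real.abs_exp_sub_one_sub_id_le (x := x) (by rw [abs_of_nonneg hx]; exact hx1)
    have := (abs_le.1 this).2
    linarith
  have h4 : (d : ℝ) * (p * (Real.exp x - 1)) ≤ d * (p * (x + x ^ 2)) := by gcongr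
  have h5 : (d : ℝ) * p * x ^ 2 ≤ n * 1 * x ^ 2 := by
    have : (d : ℝ) ≤ n := by exact_mod_cast hdn
    gcongr
  have h6 : (d * p + f) * x ≤ (c + 1) * x := mul_le_mul_of_nonneg_right hc.le hx
  have h7 : 2 * x * n * x ≤ f * x := mul_le_mul_of_nonneg_right hf hx
  push_cast
  nlinarith

/-! ### Undecided executions -/

-- The condition `hfaulty` makes the slack of every cell, its number of faulty members divided by
-- `R`, at least `2 x n`, as the tail bound needs. The hypothesis on `L` is the union bound over
-- rounds, cells and outcomes.
open RoundProtocol in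
theorem exists_forces_undecided {n t : ℕ} {P : RoundProtocol n t} {R : ℕ} (hR : 0 < R)
    (hsym : P.FullySymmetric R) (hsolve : P.SolvesByzantineAgreement) (hnt : 2 ≤ n - t)
    (htn : 2 * t < n) {ι : Type} [Fintype ι] {cell : Fin n → ι} {D : ι → Finset ι}
    (hDself : ∀ i, i ∈ D i) (hD : ∀ i, (Finset.univ.filter fun s => cell s ∈ D i).card = t)
    {F : Finset (Fin n)} (hF : F.card ≤ t) {x : ℝ} (hx : 0 ≤ x) (hx1 : x ≤ 1)
    (hfaulty : ∀ g, 2 * x * R * n ≤ (Finset.univ.filter fun p => cell p = g ∧ p ∈ F).card)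
    {L : ℕ} (hL : (L : ENNReal) * (Fintype.card ι * (R * ENNReal.ofReal (Real.exp (-(x ^ 2 * n)))))
      ≤ 1 / 2) :
    ∃ (b : Fin n → Bool) (p : Fin n), p ∉ F ∧
      P.Forces b F (fun C => (∀ r, (C.proc r).round = L) ∧ (∀ r, L ≤ C.depth r + 1) ∧
        (C.proc p).decision = none) P.initConfig (1 / 2) := by
  set η : ENNReal := Fintype.card ι * (R * ENNReal.ofReal (Real.exp (-(x ^ 2 * n)))) with hη
  set w : ι → ℕ := fun g => (Finset.univ.filter fun p => cell p = g).card with hw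
  set d : ι → ℕ := fun g => ((Finset.univ.filter fun p => p ∉ F).filter
    fun p => cell p = g).card with hd
  have hdw : ∀ g, d g + (Finset.univ.filter fun p => cell p = g ∧ p ∈ F).card = w g := by
    intro g
    have := Finset.card_filter_add_card_filter_not
      (s := Finset.univ.filter fun p => cell p = g) (fun p => p ∉ F)
    change _ = (Finset.univ.filter fun p => cell p = g).card
    rw [← this, hd]
    simp only [Finset.filter_filter, not_not, and_comm]
  -- A target depends only on the cell and the distribution, not on the play; comparing plays relies
  -- on this. For distributions with too many outcomes the value `0` is a default.
  have htarget : ∀ g (ν : PMF P.Msg), ∃ T : Multiset P.Msg, ν.support.encard ≤ R →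
      T.card = w g ∧ (∀ m ∈ T, m ∈ ν.support) ∧
        ∀ m ∈ ν.support, d g * (ν m).toReal + ((w g : ℝ) - d g) / R < T.count m + 1 := by
    intro g ν
    by_cases hν : ν.support.encard ≤ R
    · obtain ⟨T, hT⟩ := exists_target ν hR hν (show d g ≤ w g by have := hdw g; omega)
      exact ⟨T, fun _ => hT⟩
    · exact ⟨0, fun h => absurd h hν⟩
  choose target htgt using htarget
  have hforces : ∀ (bit : ι → Bool) (ρ : Play ι) (hρ : ρ.Legit),
      P.Forces (fun p => bit (cell p)) F (fun C => (∀ p, (C.proc p).round = L) ∧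
        (∀ p, L ≤ C.depth p + 1) ∧ ∀ p, p ∉ F → (C.proc p).decision =
          (scriptOf (ρ.views hD hρ) bit target).decision (cell p) L) P.initConfig (1 / 2) := by
    intro bit ρ hρ
    set S := scriptOf (ρ.views hD hρ) bit target with hS
    have hdist : ∀ g q, (S.dist g q).support.encard ≤ R := by
      intro g q
      rw [Script.dist]
      split_ifs
      · exact hsym.first_support _
      · exact hsym.next_support _ _
    have hfin : ∀ g q, (S.dist g q).support.Finite := fun g q =>
      Set.finite_of_encard_le_coe (hdist g q)
    have hcons : S.Consistent := by
      refine ⟨fun g q => ?_, fun g q m hm => ?_⟩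
      · rw [hS, scriptOf_cont_succ]
        exact (htgt g _ (hdist g q)).1
      · rw [hS, scriptOf_cont_succ] at hm
        exact (htgt g _ (hdist g q)).2.1 m hm
    refine (S.forces (X := ENNReal.ofReal (Real.exp x)) (η := η) hsym.receiverOrder hsym.complete hnt
      hcons hfin ?_ ENNReal.ofReal_ne_top (fun p => rfl) L ?_).mono hL
    · rw [← ENNReal.ofReal_one]
      exact ENNReal.ofReal_le_ofReal (Real.one_le_exp hx)
    · intro q msg
      rw [Script.potential, hη, ← nsmul_eq_mul, ← Finset.card_univ, ← Finset.sum_const]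
      refine Finset.sum_le_sum fun g _ => ?_
      have hcard : ((hfin g q).toFinset.card : ENNReal) ≤ R := by
        have := hdist g q
        rw [(hfin g q).encard_eq_coe_toFinset_card] at this
        exact_mod_cast this
      refine le_trans ?_ (mul_le_mul_left hcard _)
      rw [← nsmul_eq_mul, ← Finset.sum_const]
      refine Finset.sum_le_sum fun m hm => ?_
      rw [Finset.filter_empty, Finset.card_empty, pow_zero, one_mul]
      refine tail_term_le _ m hx hx1 (n := n) (f := ((w g : ℝ) - d g) / R) ?_ ?_ ?_
      · exact (Finset.card_le_univ _).trans (by simp)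
      · rw [le_div_iff₀ (by exact_mod_cast hR)]
        have h1 := hfaulty g
        have h2 : (d g : ℝ) + ((Finset.univ.filter fun p => cell p = g ∧ p ∈ F).card : ℝ) = w g := by
          exact_mod_cast hdw g
        linarith
      · rw [hS, scriptOf_cont_succ]
        exact (htgt g _ (hdist g q)).2.2 m (by simpa using hm)
  -- Otherwise every play makes all good processors decide by round `L`.
  by_contra hcon
  have hdec : ∀ (bit : ι → Bool) (ρ : Play ι) (hρ : ρ.Legit) p, p ∉ F →
      (scriptOf (ρ.views hD hρ) bit target).decision (cell p) L ≠ none := by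
    intro bit ρ hρ p hp hnone
    refine hcon ⟨_, p, hp, (hforces bit ρ hρ).imp fun C hC => ⟨hC.1, hC.2.1, ?_⟩⟩
    rw [hC.2.2 p hp, hnone]
  have hreach : ∀ (bit : ι → Bool) (ρ : Play ι) (hρ : ρ.Legit), ∃ C,
      P.Reachable (fun p => bit (cell p)) F C ∧ ∀ p, p ∉ F → (C.proc p).decision =
          (scriptOf (ρ.views hD hρ) bit target).decision (cell p) L := by
    intro bit ρ hρ
    obtain ⟨C, hC, hQ⟩ := (hforces bit ρ hρ).exists_reachable (by simp) .init
    exact ⟨C, hC, hQ.2.2⟩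
  -- `F` and `D h` have at most `2 t < n` members together, and `D h` contains `h`.
  have hgood : ∀ h, ∃ p, p ∉ F ∧ cell p ≠ h := by
    intro h
    by_contra! hno
    have hsub : (Finset.univ : Finset (Fin n)) ⊆
        F ∪ Finset.univ.filter fun s => cell s ∈ D h := by
      intro p _
      by_cases hp : p ∈ F
      · exact Finset.mem_union_left _ hp
      · refine Finset.mem_union_right _ ?_
        simp only [Finset.mem_filter, Finset.mem_univ, true_and]
        rw [hno p hp]
        exact hDself h
    have h1 := (Finset.card_le_card hsub).trans (Finset.card_union_le _ _)
    rw [hD, Finset.card_univ, Fintype.card_fin] at h1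
    omega
  have hι : Nonempty ι := ⟨cell ⟨0, by omega⟩⟩
  obtain ⟨p₀, hp₀, -⟩ := hgood (Classical.arbitrary ι)
  -- Agreement makes the decision of `p₀` that of all good processors. The values `false` for
  -- undecided or illegitimate plays are defaults.
  let val : (ι → Bool) → Play ι → Bool := fun bit ρ =>
    if hρ : ρ.Legit then
      ((scriptOf (ρ.views hD hρ) bit target).decision (cell p₀) L).getD false else false
  have hval : ∀ (bit : ι → Bool) (ρ : Play ι) (hρ : ρ.Legit) p, p ∉ F →
      (scriptOf (ρ.views hD hρ) bit target).decision (cell p) L = some (val bit ρ) := by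
    intro bit ρ hρ p hp
    obtain ⟨C, hC, hd⟩ := hreach bit ρ hρ
    obtain ⟨v, hv⟩ := Option.ne_none_iff_exists'.1 (hdec bit ρ hρ p hp)
    obtain ⟨v₀, hv₀⟩ := Option.ne_none_iff_exists'.1 (hdec bit ρ hρ p₀ hp₀)
    have := hsolve.agreement _ F hF C hC p p₀ hp hp₀ v v₀ (by rw [hd p hp, hv])
      (by rw [hd p₀ hp₀, hv₀])
    rw [hv, this]
    simp only [val, dif_pos hρ, hv₀, Option.getD_some]
  obtain ⟨ρ, hρ, heq⟩ := Play.exists_val_eq (val := val) (L := L)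
    (fun bit bit' ρ ρ' h l hρ hρ' hadj => by
      obtain ⟨p, hp, hph⟩ := hgood h
      have h1 := hadj.decision_eq hDself hD target hρ hρ' hph L
      rw [hval bit ρ hρ p hp, hval bit' ρ' hρ' p hp] at h1
      exact Option.some.inj h1)
    (fun bit ρ ρ' hρ hρ' h => by
      have h1 := Play.decision_congr hD target (bit := bit) hρ hρ' h (cell p₀)
      rw [hval bit ρ hρ p₀ hp₀, hval bit ρ' hρ' p₀ hp₀] at h1
      exact Option.some.inj h1)
  -- Under unanimous inputs, validity forces the common input as the decision.
  have hvalid : ∀ v, val (fun _ => v) ρ = v := by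
    intro v
    obtain ⟨C, hC, hd⟩ := hreach (fun _ => v) ρ hρ
    obtain ⟨-, -, h⟩ := hsolve.validity _ F hF C hC p₀ hp₀ (val (fun _ => v) ρ)
      (by rw [hd p₀ hp₀, hval _ ρ hρ p₀ hp₀])
    exact h.symm
  rw [hvalid, hvalid] at heq
  exact Bool.false_ne_true heq

/-! ### Cells -/

theorem exists_cells {n : ℕ} {ι : Type} [Fintype ι] {w : ι → ℕ} (hw : ∑ i, w i = n) :
    ∃ cell : Fin n → ι, ∀ i, (Finset.univ.filter fun p => cell p = i).card = w i := by
  have e : Fin n ≃ Σ i, Fin (w i) := Fintype.equivOfCardEq (by simp [hw])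
  refine ⟨fun p => (e p).1, fun i => ?_⟩
  rw [← Fintype.card_fin (w i), ← Finset.card_univ]
  symm
  refine Finset.card_bij (fun x _ => e.symm ⟨i, x⟩) ?_ ?_ ?_
  · intro x _
    simp
  · intro x _ y _ h
    simpa using h
  · intro p hp
    simp only [Finset.mem_filter, Finset.mem_univ, true_and] at hp
    subst hp
    exact ⟨(e p).2, Finset.mem_univ _, by simp⟩

theorem card_filter_mem_eq_sum {α ι : Type} [Fintype α] (cell : α → ι) (A : Finset ι) :
    (Finset.univ.filter fun s => cell s ∈ A).card =
      ∑ j ∈ A, (Finset.univ.filter fun s => cell s = j).card := by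
  rw [Finset.card_eq_sum_card_fiberwise (f := cell) (t := A) (fun s hs => by simpa using hs)]
  refine Finset.sum_congr rfl fun j hj => ?_
  rw [Finset.filter_filter]
  congr 1
  ext s
  simp only [Finset.mem_filter, Finset.mem_univ, true_and, and_iff_right_iff_imp]
  rintro rfl
  exact hj

/-- Take `⌊c |cell|⌋` processors from each cell, at most `c n = t` in all, and enlarge the set
arbitrarily to size `t`. -/
theorem exists_faulty {n t : ℕ} {c : ℝ} (hc0 : 0 ≤ c) (hc1 : c ≤ 1) (ht : (t : ℝ) = c * n)
    {ι : Type} [Fintype ι] (cell : Fin n → ι) :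
    ∃ F : Finset (Fin n), F.card = t ∧ ∀ g,
      c * (Finset.univ.filter fun p => cell p = g).card - 1 ≤
        (Finset.univ.filter fun p => cell p = g ∧ p ∈ F).card := by
  set fiber : ι → Finset (Fin n) := fun g => Finset.univ.filter fun p => cell p = g with hfiber
  have h1 : ∀ g, ∃ A ⊆ fiber g, A.card = ⌊c * (fiber g).card⌋₊ := by
    intro g
    refine Finset.exists_subset_card_eq (Nat.floor_le_of_le ?_)
    exact mul_le_of_le_one_left (Nat.cast_nonneg _) hc1
  choose A hA hAcard using h1
  have hsum : ∑ g, (fiber g).card = n := by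
    rw [hfiber, ← Finset.card_eq_sum_card_fiberwise (s := Finset.univ) (f := cell)
      (t := Finset.univ) (fun _ _ => Finset.mem_coe.2 (Finset.mem_univ _))]
    simp
  have hcard : (Finset.univ.biUnion A).card ≤ t := by
    refine Finset.card_biUnion_le.trans ?_
    have : ((∑ g, (A g).card : ℕ) : ℝ) ≤ t := by
      have hsum' : (n : ℝ) = ∑ g, ((fiber g).card : ℝ) := by exact_mod_cast hsum.symm
      rw [ht, hsum', Finset.mul_sum]
      push_cast
      refine Finset.sum_le_sum fun g _ => ?_
      rw [hAcard]
      exact Nat.floor_le (by positivity)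
    exact_mod_cast this
  have htn : t ≤ Fintype.card (Fin n) := by
    rw [Fintype.card_fin]
    have : (t : ℝ) ≤ n := by
      rw [ht]
      exact mul_le_of_le_one_left (Nat.cast_nonneg _) hc1
    exact_mod_cast this
  obtain ⟨F, hF, hFcard⟩ := Finset.exists_superset_card_eq hcard htn
  refine ⟨F, hFcard, fun g => ?_⟩
  have hle : (A g).card ≤ (Finset.univ.filter fun p => cell p = g ∧ p ∈ F).card := by
    refine Finset.card_le_card fun p hp => ?_
    have := hA g hp
    simp only [hfiber, Finset.mem_filter, Finset.mem_univ, true_and] at this ⊢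
    exact ⟨this, hF (Finset.mem_biUnion.2 ⟨g, Finset.mem_univ _, hp⟩)⟩
  rw [hAcard] at hle
  have h2 : c * (fiber g).card - 1 ≤ ⌊c * (fiber g).card⌋₊ := by
    linarith [Nat.lt_floor_add_one (c * (fiber g).card)]
  exact h2.trans (by exact_mod_cast hle)

/-- Cell sizes proportional to `n`, with a silent set of total size `t` around every cell. -/
theorem exists_cell_sizes {c : ℝ} (hc0 : 0 < c) (hc1 : c < 1) :
    ∃ (β : ℝ) (K : ℕ), 0 < β ∧ ∀ n t : ℕ, (t : ℝ) = c * n →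
      ∃ (ι : Type) (_ : Fintype ι) (w : ι → ℕ) (D : ι → Finset ι),
        Fintype.card ι ≤ K ∧ ∑ i, w i = n ∧ (∀ i, i ∈ D i) ∧ (∀ i, ∑ j ∈ D i, w j = t) ∧
          ∀ i, β * n ≤ w i := by
  -- If `1/c` is an integer, `q` cells of size `t` suffice, each its own silent set. Otherwise `n =
  -- q t + r` with `0 < r < t` for positive `n`: use `q - 1` cells of size `t` and three of sizes
  -- `r`, `t - r`, `r`, where the middle one completes either neighbour to size `t`.
  set q := ⌊1 / c⌋₊ with hq
  have hq1 : (q : ℝ) * c ≤ 1 := by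
    have := Nat.floor_le (show 0 ≤ 1 / c by positivity)
    rw [le_div_iff₀ hc0] at this
    exact this
  have hq2 : 1 < ((q : ℝ) + 1) * c := by
    have := Nat.lt_floor_add_one (1 / c)
    rw [div_lt_iff₀ hc0] at this
    exact this
  have hqpos : 1 ≤ q := by
    rw [hq, Nat.one_le_floor_iff, le_div_iff₀ hc0]
    linarith
  rcases hq1.eq_or_lt with heq | hlt
  · refine ⟨c, q, hc0, fun n t ht => ⟨Fin q, inferInstance, fun _ => t, fun i => {i}, by simp, ?_,
      by simp, by simp, fun i => ht.symm.le⟩⟩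
    have : (q : ℝ) * t = n := by rw [ht, ← mul_assoc, heq, one_mul]
    simp only [Finset.sum_const, Finset.card_univ, Fintype.card_fin, smul_eq_mul]
    exact_mod_cast this
  · refine ⟨min c (min (1 - q * c) ((q + 1) * c - 1)), q - 1 + 3,
      lt_min hc0 (lt_min (by linarith) (by linarith)), fun n t ht => ?_⟩
    have hn : (0 : ℝ) ≤ n := Nat.cast_nonneg n
    have hqt : q * t ≤ n := by
      have : (q : ℝ) * t ≤ n := by
        rw [ht, ← mul_assoc]
        exact mul_le_of_le_one_left hn hlt.le
      exact_mod_cast this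
    have hnt : n ≤ (q + 1) * t := by
      have : (n : ℝ) ≤ (q + 1) * t := by
        rw [ht, ← mul_assoc]
        exact le_mul_of_one_le_left hn hq2.le
      exact_mod_cast this
    have hr : ((n - q * t : ℕ) : ℝ) = (1 - q * c) * n := by
      rw [Nat.cast_sub hqt]
      push_cast
      rw [ht]
      ring
    have hs : (((q + 1) * t - n : ℕ) : ℝ) = ((q + 1) * c - 1) * n := by
      rw [Nat.cast_sub hnt]
      push_cast
      rw [ht]
      ring
    let w : Fin (q - 1) ⊕ Fin 3 → ℕ := Sum.elim (fun _ => t)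
      ![n - q * t, (q + 1) * t - n, n - q * t]
    let D : Fin (q - 1) ⊕ Fin 3 → Finset (Fin (q - 1) ⊕ Fin 3) := Sum.elim (fun i => {.inl i})
      ![{.inr 0, .inr 1}, {.inr 0, .inr 1}, {.inr 1, .inr 2}]
    have hqt' : (q + 1) * t = q * t + t := by ring
    refine ⟨Fin (q - 1) ⊕ Fin 3, inferInstance, w, D, by simp, ?_, ?_, ?_, ?_⟩
    · obtain ⟨q', hq'⟩ : ∃ q', q = q' + 1 := ⟨q - 1, by omega⟩
      have h1 : (q - 1) * t + t = q * t := by rw [hq']; simp; ring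
      simp only [w, Fintype.sum_sum_type, Sum.elim_inl, Sum.elim_inr, Finset.sum_const,
        Finset.card_univ, Fintype.card_fin, smul_eq_mul, Fin.sum_univ_three, Matrix.cons_val_zero,
        Matrix.cons_val_one, Matrix.cons_val]
      omega
    · rintro (i | i)
      · simp [D]
      · fin_cases i <;> simp [D]
    · rintro (i | i)
      · simp [D, w]
      · fin_cases i <;> simp [D, w] <;> omega
    · rintro (i | i)
      · simp only [w, Sum.elim_inl, ht]
        gcongr
        exact min_le_left _ _
      · fin_cases i
        · simp only [w, Sum.elim_inr, Fin.zero_eta, Matrix.cons_val_zero]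
          rw [hr]
          gcongr
          exact (min_le_right _ _).trans (min_le_left _ _)
        · simp only [w, Sum.elim_inr, Fin.mk_one, Matrix.cons_val_one, Matrix.cons_val_zero]
          rw [hs]
          gcongr
          exact (min_le_right _ _).trans (min_le_right _ _)
        · simp only [w, Sum.elim_inr, Fin.reduceFinMk, Matrix.cons_val]
          rw [hr]
          gcongr
          exact (min_le_right _ _).trans (min_le_left _ _)

/-! ### The first round -/

namespace RoundProtocol

variable {n t : ℕ} {P : RoundProtocol n t} {b : Fin n → Bool} {F : Finset (Fin n)}

/-- Nobody has accepted at the start, yet everybody can be made to accept; so something can be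
delivered. -/
theorem startConfig_buffer_ne_zero (hB : P.bc.ArbitraryReceiverOrder) (hn : 2 ≤ n) (s : Fin n)
    (k : ℕ) (m : P.Msg) : (P.bc.startConfig s k m).buffer ≠ 0 := by
  obtain ⟨pl⟩ := hB.nonempty_plan hn s k m (T := fun _ => Finset.univ) monotone_const
  have hpos : 0 < pl.cut 0 := by
    rw [Nat.pos_iff_ne_zero]
    intro h0
    have h1 := pl.accepted_cut 0 s
    rw [h0, pl.st_zero, hB.start_accepted hn] at h1
    simp at h1
  obtain ⟨x, hx, -⟩ := pl.step 0 0 hpos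
  rw [pl.st_zero] at hx
  exact fun h => by simp [h] at hx

/-- Good processors are starting their first round. -/
structure Starting (F : Finset (Fin n)) (C : P.Config) (l : List (Fin n)) : Prop where
  waiting : ∀ p ∈ l, (C.proc p).round = 0 ∧ (C.proc p).log = [] ∧ ∀ s k,
    (C.proc p).inst s k = P.bc.initLocal s k p
  started : ∀ p, p ∉ F → p ∉ l → (C.proc p).round = 1 ∧ (C.proc p).log.length ≤ 1
  decision : ∀ p, p ∉ F → (C.proc p).decision = none
  depth : ∀ x ∈ C.buffer, 1 ≤ x.depth

/-- For `E < 1` it is enough that the good processors start and one packet is received: everybody is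
in round `1`, a chain has length `1`, and no round has been completed, so nobody has decided. -/
theorem forces_first_round (hB : P.bc.ArbitraryReceiverOrder) (hnt : 2 ≤ n - t)
    (hfin : ∀ v, (P.first v).support.Finite) {E : ℝ} (hE : E < 1) :
    ∀ (l : List (Fin n)) (C : P.Config), l.Nodup → (∀ p ∈ l, p ∉ F) → Starting F C l →
      (l ≠ [] ∨ C.buffer ≠ 0) → (∃ p, p ∉ F) →
      P.Forces b F (fun C => C.Outlasts F E) C 0 := by
  intro l
  induction l with
  | nil =>
    intro C _ _ hC hbuf hgood
    obtain ⟨x, hx⟩ := Multiset.exists_mem_of_ne_zero (hbuf.resolve_left (by simp))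
    refine Script.forces_of_receive hx (fun hxF hr => ?_) (Forces.of_mem ⟨fun p hp => ?_, ?_, ?_⟩)
    · obtain ⟨h1, h2⟩ := hC.started x.dst hxF (by simp)
      rcases hr with hr | hr
      · omega
      · have h3 := (hr.trans (Finset.card_filter_le _ _)).trans
          ((Finset.card_le_card (P.validate_subset _)).trans (List.toFinset_card_le _))
        omega
    · rw [Script.Follows.receive_round, (hC.started p hp (by simp)).1]
      simpa using hE
    · refine hE.le.trans ?_
      have h1 : (C.receive x).depth x.dst ≤ (C.receive x).chainLength :=
        Finset.le_sup (f := (C.receive x).depth) (Finset.mem_univ _)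
      have h2 : x.depth ≤ (C.receive x).depth x.dst := by
        simp [Config.receive, Config.put, Config.take]
      have h3 := hC.depth x hx
      exact_mod_cast h3.trans (h2.trans h1)
    · intro hall
      obtain ⟨p, hp⟩ := hgood
      exact hall p hp (by rw [Script.Follows.receive_decision]; exact hC.decision p hp)
  | cons p l ih =>
    intro C hnd hl hC _ hgood
    obtain ⟨h0, hlog, hinst⟩ := hC.waiting p (by simp)
    have hpF := hl p (by simp)
    have hnext : P.nextMessage (b p) (C.proc p) = P.first (b p) := by rw [nextMessage, if_pos h0]
    refine Forces.of_enter hpF (.inl h0) (fun _ => 0) (by rw [hnext]; exact hfin _)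
      (fun m _ => ?_) (by simp)
    change P.Forces b F _ (C.enter p m) 0
    have hpl := (List.nodup_cons.1 hnd).1
    refine ih _ (List.nodup_cons.1 hnd).2 (fun r hr => hl r (by simp [hr]))
      ⟨fun r hr => ?_, fun r hr hrl => ?_, fun r hr => ?_, fun x hx => ?_⟩ (.inr ?_) hgood
    · have hrp : r ≠ p := fun h => hpl (h ▸ hr)
      simpa [Config.enter, Config.put, hrp] using hC.waiting r (by simp [hr])
    · by_cases hrp : r = p
      · subst hrp
        obtain ⟨l', h1, h2, -⟩ := exists_enterRound_log r (C.proc r) m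
        have hproc : (C.enter r m).proc r = (P.enterRound r (C.proc r) m).1 := by
          simp [Config.enter, Config.put]
        rw [hproc, enterRound_round, h1, h0, hlog]
        exact ⟨rfl, by simpa using h2⟩
      · simpa [Config.enter, Config.put, hrp] using hC.started r hr (by simp [hrp, hrl])
    · by_cases hrp : r = p
      · subst hrp
        have := hC.decision r hr
        simpa [Config.enter, Config.put, enterRound, feed, nextDecision, h0] using this
      · simpa [Config.enter, Config.put, hrp] using hC.decision r hr
    · rcases mem_put_buffer hx with hx | ⟨o, ho, h1, h2⟩
      · exact hC.depth x hx
      · omega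
    · obtain ⟨y, hy⟩ := Multiset.exists_mem_of_ne_zero
        (startConfig_buffer_ne_zero hB (by omega) p ((C.proc p).round + 1) m)
      have hy' : y ∈ ((P.bc.react p ((C.proc p).round + 1) p (.invoke m)
          (P.bc.initLocal p ((C.proc p).round + 1) p)).2.map
          fun o => (⟨p, o.1, o.2⟩ : P.bc.InstPacket)) := by
        simpa [BroadcastProtocol.startConfig, BroadcastProtocol.InstConfig.apply] using hy
      obtain ⟨o, ho, -⟩ := List.mem_map.1 hy'
      intro hzero
      have hout : (P.enterRound p (C.proc p) m).2 = [] := by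
        have := congrArg Multiset.card hzero
        simp only [Config.enter, Config.put, Multiset.card_add, Multiset.coe_card,
          List.length_map, Multiset.card_zero, Nat.add_eq_zero_iff] at this
        exact List.length_eq_zero_iff.1 this.2
      simp only [enterRound, feed, hinst, List.map_eq_nil_iff] at hout
      rw [hout] at ho
      simp at ho

theorem forces_of_lt_one (hB : P.bc.ArbitraryReceiverOrder) (hnt : 2 ≤ n - t) (hF : F.card < n)
    (hfin : ∀ v, (P.first v).support.Finite) {E : ℝ} (hE : E < 1) :
    P.Forces b F (fun C => C.Outlasts F E) P.initConfig (1 / 2) := by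
  obtain ⟨p₀, -, hp₀⟩ := Finset.exists_mem_notMem_of_card_lt_card
    (show F.card < (Finset.univ : Finset (Fin n)).card by simpa using hF)
  refine (forces_first_round hB hnt hfin hE (Finset.univ.filter fun p => p ∉ F).toList P.initConfig
    (Finset.nodup_toList _) (by simp) ⟨fun p _ => ⟨rfl, rfl, fun _ _ => rfl⟩, fun p h1 h2 => ?_,
      fun _ _ => rfl, by simp [initConfig]⟩ (.inl ?_) ⟨p₀, hp₀⟩).mono zero_le
  · simp [h1] at h2
  · intro h
    have : p₀ ∈ (Finset.univ.filter fun p => p ∉ F).toList := by simp [hp₀]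
    rw [h] at this
    simp at this

end RoundProtocol

end AsyncBA

end

/-! ### Choice of constants and conclusion. -/

open AsyncBA in
theorem theorem1 (c : ℝ) (hc0 : 0 < c) (hc1 : c < 1 / 3) (R : ℕ) (hR : 0 < R) :
    ∃ δ : ℝ, 0 < δ ∧
      ∀ (n t : ℕ), 0 < n → (t : ℝ) = c * n →
        ∀ P : RoundProtocol n t, P.FullySymmetric R → P.SolvesByzantineAgreement →
          ∃ (b : Fin n → Bool) (F : Finset (Fin n)) (A : P.Adversary),
            F.card = t ∧ P.Fair b F A ∧
            1 / 2 ≤ P.probEventually b F A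
              (fun C => C.Outlasts F (c / (2 * R) * Real.exp (δ * n))) ∧
            ENNReal.ofReal (c / (2 * R) * Real.exp (δ * n) / 2) ≤
              P.expectedRunningTime b F A := by
  classical
  obtain ⟨β, K, hβ, hcells⟩ := exists_cell_sizes hc0 (by linarith : c < 1)
  have hR' : (1 : ℝ) ≤ R := by exact_mod_cast hR
  -- the parameter of the exponential moments
  set x : ℝ := min 1 (c * β / (4 * R)) with hx
  have hx0 : 0 < x := lt_min one_pos (by positivity)
  have hx1 : x ≤ 1 := min_le_left _ _
  have hx2 : x * (4 * R) ≤ c * β := by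
    rw [← le_div_iff₀ (by positivity)]
    exact min_le_right _ _
  -- For `n ≥ B`, `c β n ≥ 2` absorbs the rounding loss of one faulty processor per cell, and `3 c K
  -- ≤ exp (x² n / 2)` absorbs the number of cells. For `n < B`, `δ n ≤ 1` and hence `E ≤ 3 c / 2 <
  -- 1`.
  set B : ℝ := max 1 (max (2 / (c * β)) (2 / x ^ 2 * (3 * c * K))) with hB
  have hB0 : 0 < B := lt_max_of_lt_left one_pos
  refine ⟨min (x ^ 2 / 2) (1 / B), lt_min (by positivity) (by positivity), ?_⟩
  set δ := min (x ^ 2 / 2) (1 / B) with hδ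
  have hδ1 : δ ≤ x ^ 2 / 2 := min_le_left _ _
  have hδ2 : δ * B ≤ 1 := by
    rw [← le_div_iff₀ hB0]
    exact min_le_right _ _
  intro n t hn ht P hsym hsolve
  have hn' : (0 : ℝ) < n := by exact_mod_cast hn
  have ht0 : 0 < t := by
    have : (0 : ℝ) < t := by rw [ht]; positivity
    exact_mod_cast this
  have htn : 3 * t < n := by
    have : (3 : ℝ) * t < n := by rw [ht]; nlinarith
    exact_mod_cast this
  set E : ℝ := c / (2 * R) * Real.exp (δ * n) with hE
  have hE0 : 0 ≤ E := by positivity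
  suffices h : ∃ (b : Fin n → Bool) (F : Finset (Fin n)), F.card = t ∧
      P.Forces b F (fun C => C.Outlasts F E) P.initConfig (1 / 2) by
    obtain ⟨b, F, hF, hf⟩ := h
    obtain ⟨A, hA⟩ := hf.exists_adversary hE0 (by omega) (by omega)
    exact ⟨b, F, A, hF, hA⟩
  -- The case `E < 1`, which includes all small `n`, is settled within the first round.
  rcases lt_or_ge E 1 with hlt | hge
  · obtain ⟨F, -, hF⟩ := Finset.exists_subset_card_eq
      (show t ≤ (Finset.univ : Finset (Fin n)).card by simp; omega)
    exact ⟨fun _ => false, F, hF, RoundProtocol.forces_of_lt_one hsym.receiverOrder (by omega)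
      (by omega) (fun v => Set.finite_of_encard_le_coe (hsym.first_support v)) hlt⟩
  -- `n` is large
  have hnB : B ≤ n := by
    by_contra! hlt
    have h1 : δ * n ≤ 1 := by
      refine le_trans ?_ hδ2
      gcongr
    have h2 : Real.exp (δ * n) ≤ 3 :=
      (Real.exp_le_exp.2 h1).trans (by linarith [Real.exp_one_lt_d9])
    have h3 : c / (2 * R) ≤ c / 2 := by
      gcongr
      linarith
    have h4 : E ≤ c / 2 * 3 := by
      rw [hE]
      gcongr
    linarith
  obtain ⟨ι, _, w, D, hK, hw, hDself, hD, hwβ⟩ := hcells n t ht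
  obtain ⟨cell, hcell⟩ := exists_cells hw
  obtain ⟨F, hF, hFcell⟩ := exists_faulty hc0.le (by linarith) ht cell
  have hnβ : 2 ≤ c * β * n := by
    have h1 : 2 / (c * β) ≤ n := ((le_max_left _ _).trans (le_max_right _ _)).trans hnB
    rw [div_le_iff₀ (by positivity)] at h1
    linarith
  have hfaulty : ∀ g, 2 * x * R * n ≤ (Finset.univ.filter fun p => cell p = g ∧ p ∈ F).card := by
    intro g
    refine le_trans ?_ (hFcell g)
    rw [hcell]
    have h1 : c * (β * n) ≤ c * w g := by
      have := hwβ g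
      gcongr
    have h2 : x * (4 * R) * n ≤ c * β * n := by gcongr
    linarith
  obtain ⟨b, p, hp, hf⟩ := exists_forces_undecided hR hsym hsolve (by omega) (by omega) hDself
    (fun i => by rw [card_filter_mem_eq_sum]; simp_rw [hcell]; exact hD i) hF.le hx0.le hx1 hfaulty
    -- Being in round `L` exceeds `E` strictly, and the chain length `L - 1 = ⌈E⌉` is still at least
    -- `E`. With `δ ≤ x² / 2`, one factor `exp (-x² n / 2)` cancels the growth of `E` and the other
    -- the constant `3 c K`.
    (L := ⌈E⌉₊ + 1) (by
      have h1 : ((⌈E⌉₊ + 1 : ℕ) : ℝ) ≤ 3 * E := by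
        push_cast
        linarith [Nat.ceil_lt_add_one hE0]
      have h2 : 3 * E * (K * (R * Real.exp (-(x ^ 2 * n)))) ≤ 1 / 2 := by
        have h3 : Real.exp (δ * n) ≤ Real.exp (x ^ 2 / 2 * n) := by gcongr
        have h4 : 3 * c * K ≤ Real.exp (x ^ 2 / 2 * n) := by
          have h5 : 2 / x ^ 2 * (3 * c * K) ≤ n :=
            ((le_max_right _ _).trans (le_max_right _ _)).trans hnB
          have h6 : 3 * c * K ≤ x ^ 2 / 2 * n := by
            have := mul_le_mul_of_nonneg_left h5 (show 0 ≤ x ^ 2 / 2 by positivity)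
            refine le_trans (le_of_eq ?_) this
            field_simp
          linarith [Real.add_one_le_exp (x ^ 2 / 2 * n)]
        have h7 : Real.exp (-(x ^ 2 * n)) =
            (Real.exp (x ^ 2 / 2 * n))⁻¹ * (Real.exp (x ^ 2 / 2 * n))⁻¹ := by
          rw [← mul_inv, ← Real.exp_add, ← Real.exp_neg]
          congr 1
          ring
        set y := Real.exp (x ^ 2 / 2 * n)
        have hy : 0 < y := Real.exp_pos _
        calc 3 * E * (K * (R * Real.exp (-(x ^ 2 * n))))
            = (3 * c * K) * y⁻¹ * (Real.exp (δ * n) * y⁻¹) / 2 := by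
              rw [hE, h7]
              field_simp
          _ ≤ y * y⁻¹ * (y * y⁻¹) / 2 := by gcongr
          _ = 1 / 2 := by rw [mul_inv_cancel₀ hy.ne']; norm_num
      have h8 : ((⌈E⌉₊ + 1 : ℕ) : ℝ) * (Fintype.card ι * (R * Real.exp (-(x ^ 2 * n)))) ≤ 1 / 2 := by
        have hK' : (Fintype.card ι : ℝ) ≤ K := by exact_mod_cast hK
        refine le_trans ?_ h2
        gcongr
      have h9 := ENNReal.ofReal_le_ofReal h8
      rw [ENNReal.ofReal_mul (by positivity), ENNReal.ofReal_mul (by positivity),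
        ENNReal.ofReal_mul (by positivity), ENNReal.ofReal_natCast, ENNReal.ofReal_natCast,
        ENNReal.ofReal_natCast, ENNReal.ofReal_div_of_pos two_pos] at h9
      simpa using h9)
  refine ⟨b, F, hF, hf.imp fun C hC => ⟨fun r _ => ?_, ?_, fun hall => hall p hp hC.2.2⟩⟩
  · rw [hC.1 r]
    push_cast
    linarith [Nat.le_ceil E]
  · refine (Nat.le_ceil E).trans ?_
    have h1 : C.depth p ≤ C.chainLength := Finset.le_sup (f := C.depth) (Finset.mem_univ _)
    have h2 := hC.2.1 p
    exact_mod_cast (by omega : ⌈E⌉₊ ≤ C.chainLength)
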